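/- Let $\lambda=0.95$ and $$H(x,y)=\frac{y^2}{2}+\frac{x^4}{4}+\frac{1-\lambda}{3}x^3-\frac{\lambda}{2}x^2,$$ let $\alpha=438.4905$, $\beta=-25.2469$, $\gamma=-452.7899$, $\delta=-741.0341$, $g(x,y)=(\alpha+\beta x+\gamma x^2)y+\delta\frac{y^3}{3}$, and consider the perturbed Hamiltonian system $$\dot x=-y,\qquad \dot y=x^3+(1-\lambda)x^2-\lambda x+\epsilon\, g(x,y).\qquad (X_\epsilon)$$ An oval $\Gamma$ of $H$ is a closed orbit of $X_0$, oriented by the flow of $X_0$; its Abelian integral is $\int_\Gamma\omega$ with $\omega=-g(x,y)\,dx$. The figure eight loop is $\{H=0\}$; the regions inside its left and right halves are $\{x<0,\,H<0\}$ and $\{x>0,\,H<0\}$. For $h>0$ let $\Gamma^o_h=\{H=h\}$, and for $h<0$ let $\Gamma^l_h=\{H=h,\,x<0\}$ and $\Gamma^r_h=\{H=h,\,x>0\}$; write $I^o(h)$, $I^l(h)$, $I^r(h)$ for the corresponding Abelian integrals. A limit cycle is an isolated closed orbit; it is attracting if it is asymptotically orbitally stable, and repelling if it is attracting after reversal of time.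 Limit cycles $C_\epsilon$ of $X_\epsilon$, defined for all small $\epsilon\neq0$, bifurcate from an oval $\Gamma$ if $C_\epsilon\to\Gamma$ in the Hausdorff distance as $\epsilon\to0$. A closed curve surrounds a set if every point of the set lies in a bounded component of the complement of the curve. Then $\Gamma^o_{0.09}$ and $\Gamma^o_{0.11}$ are ovals of $H$, and $$I^o(0.09)\in[8.715,\,24.83],\qquad I^o(0.11)\in[-25.37,\,-9.821],$$ so $I^o$ has opposite signs there. Moreover there are levels $h^o\in(0.09,0.11)$, $h^l_1\in(-0.1933,-0.0846)$, $h^l_2\in(-0.0846,-0.0121)$, $h^r_1\in(-0.1686,-0.0738)$, $h^r_2\in(-0.0738,-0.0105)$ such that $\Gamma^o_{h^o}$, $\Gamma^l_{h^l_i}$, $\Gamma^r_{h^r_i}$ are ovals whose Abelian integrals vanish, $\Gamma^o_{h^o}$ surrounds the figure eight loop, and from each of these five ovals there bifurcates a family of limit cycles of $X_\epsilon$. For all sufficiently small $\epsilon\ne0$ these five limit cycles are distinct (so $X_\epsilon$ has at least five limit cycles), the one bifurcating from $\Gamma^o_{h^o}$ surrounds the figure eight loop, two lie inside the left half of the loop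 and two inside the right half. For all sufficiently small $\epsilon>0$ the limit cycles bifurcating from $\Gamma^o_{h^o}$, $\Gamma^l_{h^l_1}$ and $\Gamma^r_{h^r_1}$ are attracting and those bifurcating from $\Gamma^l_{h^l_2}$ and $\Gamma^r_{h^r_2}$ are repelling. -/

import Mathlib

open Set Filter Topology

noncomputable section

namespace Bifurcation

/-! ### Closed orbits and limit cycles of planar vector fields -/

/-- `γ` is a solution of `γ' = X(γ)` on the whole line that is periodic with least period `T > 0`
and whose trajectory is `Γ`. -/
structure IsPeriodParam (X : ℝ × ℝ → ℝ × ℝ) (γ : ℝ → ℝ × ℝ) (T : ℝ) (Γ : Set (ℝ × ℝ)) :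
    Prop where
  pos : 0 < T
  solves : IsIntegralCurve γ (fun _ => X)
  periodic : Function.Periodic γ T
  injOn : InjOn γ (Ico 0 T)
  range_eq : range γ = Γ

/-- One turn `t ↦ γ (T * t)`, `0 ≤ t ≤ 1`, of a periodic solution, as a loop. -/
def IsPeriodParam.loop {X : ℝ × ℝ → ℝ × ℝ} {γ : ℝ → ℝ × ℝ} {T : ℝ} {Γ : Set (ℝ × ℝ)}
    (h : IsPeriodParam X γ T Γ) : Path (γ 0) (γ 0) where
  toFun t := γ (T * t)
  continuous_toFun := by
    have hc : Continuous γ :=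
      continuous_iff_continuousAt.2 fun t => (h.solves t).continuousAt
    fun_prop
  source' := by simp
  target' := by simpa using h.periodic 0

/-- `Γ` is a closed orbit (the trajectory of a nonconstant periodic solution) of `X`. -/
def IsClosedOrbit (X : ℝ × ℝ → ℝ × ℝ) (Γ : Set (ℝ × ℝ)) : Prop :=
  ∃ γ T, IsPeriodParam X γ T Γ

/-- A limit cycle is an isolated closed orbit: no other closed orbit comes near it. -/
def IsLimitCycle (X : ℝ × ℝ → ℝ × ℝ) (Γ : Set (ℝ × ℝ)) : Prop :=
  IsClosedOrbit X Γ ∧ ∃ U : Set (ℝ × ℝ), IsOpen U ∧ Γ ⊆ U ∧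
    ∀ Γ', IsClosedOrbit X Γ' → (Γ' ∩ U).Nonempty → Γ' = Γ

/-- `Γ` is asymptotically orbitally stable: the solutions that start close enough to `Γ` exist for
all positive time, stay in a prescribed neighbourhood of `Γ`, and converge to `Γ`.
(For the locally Lipschitz fields below, the solution starting at `p` is unique.) -/
def IsAttracting (X : ℝ × ℝ → ℝ × ℝ) (Γ : Set (ℝ × ℝ)) : Prop :=
  ∀ V : Set (ℝ × ℝ), IsOpen V → Γ ⊆ V → ∃ U : Set (ℝ × ℝ), IsOpen U ∧ Γ ⊆ U ∧
    ∀ p ∈ U, ∃ γ : ℝ → ℝ × ℝ, γ 0 = p ∧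
      IsIntegralCurveOn γ (fun _ => X) (Ici 0) ∧
      (∀ t ∈ Ici (0 : ℝ), γ t ∈ V) ∧
      Tendsto (fun t => Metric.infDist (γ t) Γ) atTop (𝓝 0)

/-- `Γ` is attracting after reversal of time. -/
def IsRepelling (X : ℝ × ℝ → ℝ × ℝ) (Γ : Set (ℝ × ℝ)) : Prop :=
  IsAttracting (fun p => -X p) Γ

/-- `Γ` surrounds `K`: every point of `K` lies in a bounded component of the complement of `Γ`. -/
def Surrounds (Γ K : Set (ℝ × ℝ)) : Prop :=
  ∀ p ∈ K, p ∉ Γ ∧ Bornology.IsBounded (connectedComponentIn Γᶜ p)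

/-- The sets `C ε` are, for all small `ε ≠ 0`, limit cycles of `X ε`, and they tend to `Γ` in the
Hausdorff distance as `ε → 0`. -/
def BifurcatesFrom (X : ℝ → ℝ × ℝ → ℝ × ℝ) (C : ℝ → Set (ℝ × ℝ)) (Γ : Set (ℝ × ℝ)) : Prop :=
  (∀ᶠ ε in 𝓝[≠] 0, IsLimitCycle (X ε) (C ε)) ∧
    Tendsto (fun ε => Metric.hausdorffDist (C ε) Γ) (𝓝[≠] 0) (𝓝 0)

/-! ### The Hamiltonian and its perturbation -/

def lam : ℝ := 0.95

def H (p : ℝ × ℝ) : ℝ :=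
  p.2 ^ 2 / 2 + p.1 ^ 4 / 4 + (1 - lam) / 3 * p.1 ^ 3 - lam / 2 * p.1 ^ 2

/-- The Hamiltonian vector field `(-H_y, H_x)`. -/
def hamField (p : ℝ × ℝ) : ℝ × ℝ :=
  (-p.2, p.1 ^ 3 + (1 - lam) * p.1 ^ 2 - lam * p.1)

def α : ℝ := 438.4905
def β : ℝ := -25.2469
def γ : ℝ := -452.7899
def δ : ℝ := -741.0341

/-- The perturbation of the second component. -/
def g (p : ℝ × ℝ) : ℝ := (α + β * p.1 + γ * p.1 ^ 2) * p.2 + δ * (p.2 ^ 3 / 3)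

/-- The perturbed vector field. -/
def field (ε : ℝ) (p : ℝ × ℝ) : ℝ × ℝ := hamField p + ε • (0, g p)

/-- The 1-form `ω = -g(x, y) dx`. -/
def ω (p : ℝ × ℝ) : ℝ × ℝ →L[ℝ] ℝ := -(g p • ContinuousLinearMap.fst ℝ ℝ ℝ)

/-- `Γ` is an oval of `H` (a closed orbit of the Hamiltonian field, which orients it), and the
Abelian integral of `ω` along `Γ` is `v`. -/
def HasAbelianIntegral (Γ : Set (ℝ × ℝ)) (v : ℝ) : Prop :=
  IsClosedOrbit hamField Γ ∧
    ∀ γ T, ∀ h : IsPeriodParam hamField γ T Γ, curveIntegral ω h.loop = v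

/-- The level curve that is an oval outside the figure eight loop when `h > 0`. -/
def outerOval (h : ℝ) : Set (ℝ × ℝ) := {p | H p = h}

/-- The part of a level curve in the left half plane; for `-(2λ + 1) / 12 < h < 0` this is an oval
around the left centre. -/
def leftOval (h : ℝ) : Set (ℝ × ℝ) := {p | p.1 < 0 ∧ H p = h}

/-- The part of a level curve in the right half plane; for `-λ ^ 3 (λ + 2) / 12 < h < 0` this is an
oval around the right centre. -/
def rightOval (h : ℝ) : Set (ℝ × ℝ) := {p | 0 < p.1 ∧ H p = h}

def figureEightLoop : Set (ℝ × ℝ) := {p | H p = 0}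

/-- The open region enclosed by the left half of the loop. -/
def insideLeftLoop : Set (ℝ × ℝ) := {p | p.1 < 0 ∧ H p < 0}

/-- The open region enclosed by the right half of the loop. -/
def insideRightLoop : Set (ℝ × ℝ) := {p | 0 < p.1 ∧ H p < 0}

end Bifurcation

end

/-! Along `field ε` one has `dH/dt = ε y g`. To first order in `ε`, the value of `H` therefore
changes over one turn around the oval of level `h` by `ε I(h)`, where `I` is the Abelian integral. A
simple zero of `I` produces a limit cycle: for `ε > 0` it is attracting if `I' < 0` and, by time
reversal, repelling if `I' > 0`. An analytic half makes this rigorous, and an arithmetic half finds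
five simple zeros.

Analytic half. On each of three annuli of ovals the polar angle `θ` about a point `(c, 0)`, with `c
= -1`, `lam` or `0`, and the value of `H` serve as coordinates (`IsPolarAnnulus`), because `H` has
positive derivative in the radial direction. Orbits become solutions of the scalar `2π`-periodic
equation `dH/dθ = ε avg` (`hasDerivAt_pt_field`). Averaging, in the form of a contracting period map
(`exists_attracting_periodic_of_average`), gives an attracting periodic solution near `h₀`. Such a
solution is a closed orbit (`exists_isPeriodParam`), orbitally attracting
(`isAttracting_polarGraph`) and hence isolated. The reflection `y ↦ -y` exchanges `field ε` with the
time reversal of `field (-ε)`, so only the attracting case is analysed (`exists_bifurcatesFrom`).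

Arithmetic half. `I` is the integral of `y g dt` and `I'` that of `divg dt` (`integral_avgDeriv`).
Adding the total derivative of `y w(x)` changes neither. On a level, `y²` is a polynomial in `x`, so
for polynomial `w` the corrected integrand is a polynomial in `x` alone. With a suitable `w` it has
constant sign on the range of `x`, which is a finite check on integer coefficients
(`ev_pos_of_posOn`). Opposite signs of `I` at two levels give a zero. For `I'` the polynomial is
affine in the level, so a check at the two end levels covers all levels between (`ev_derivPoly`).
The numerical bounds for the outer ovals come from comparing the corrected integrand, taken per unit
of angle, with constants (`bound_integral_avg`).

The cycles are graphs `H = u(θ)` with `u` close to the level of the oval; this settles their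
distinctness and their position relative to the figure eight loop. -/

namespace Bifurcation

/-! ### Ordinary differential equations -/

/-- A bounded, globally Lipschitz scalar differential equation has global solutions. -/
theorem exists_global_solution {f : ℝ → ℝ → ℝ} {K M : NNReal} (hl : ∀ t, LipschitzWith K (f t))
    (hc : ∀ x, Continuous fun t => f t x) (hb : ∀ t x, ‖f t x‖ ≤ M) (t₀ x₀ : ℝ) :
    ∃ u : ℝ → ℝ, u t₀ = x₀ ∧ ∀ t, HasDerivAt u (f t (u t)) t := by
  have key : ∀ n : ℕ, ∃ α : ℝ → ℝ, α t₀ = x₀ ∧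
      ∀ t ∈ Ioo (t₀ - (n + 1)) (t₀ + (n + 1)), HasDerivAt α (f t (α t)) t := by
    intro n
    have hn : (0 : ℝ) < n + 1 := by positivity
    -- A solution of speed at most `M` moves by at most `M * (n + 1)` in time `n + 1`, so a ball of
    -- this radius suffices. The solutions for different `n` are then glued by uniqueness.
    have hp : IsPicardLindelof f (tmin := t₀ - (n + 1)) (tmax := t₀ + (n + 1))
        ⟨t₀, by constructor <;> linarith⟩ x₀ (M * (n + 1)) 0 M K := by
      refine ⟨fun t _ => (hl t).lipschitzOnWith, fun x _ => (hc x).continuousOn,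
        fun t _ x _ => hb t x, ?_⟩
      simp
    obtain ⟨α, h0, h1⟩ := hp.exists_eq_forall_mem_Icc_hasDerivWithinAt₀
    exact ⟨α, h0, fun t ht => (h1 t (Ioo_subset_Icc_self ht)).hasDerivAt (Icc_mem_nhds ht.1 ht.2)⟩
  choose α h0 h1 using key
  have agree : ∀ (n m : ℕ) (s : ℝ), |s - t₀| < n + 1 → |s - t₀| < m + 1 → α n s = α m s := by
    intro n m s hn hm
    set k := min n m with hk
    have hkn : (k : ℝ) ≤ n := by exact_mod_cast min_le_left n m
    have hkm : (k : ℝ) ≤ m := by exact_mod_cast min_le_right n m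
    have hks : |s - t₀| < k + 1 := by
      rcases min_choice n m with h | h <;> rw [hk, h] <;> assumption
    have hs := abs_lt.1 hks
    have hk0 : (0 : ℝ) < k + 1 := by positivity
    refine ODE_solution_unique_of_mem_Ioo (v := f) (s := fun _ => univ) (K := K) (t₀ := t₀)
      (a := t₀ - (k + 1)) (b := t₀ + (k + 1)) (fun t _ => (hl t).lipschitzOnWith)
      ⟨by linarith, by linarith⟩ (fun t ht => ⟨h1 n t ⟨?_, ?_⟩, trivial⟩)
      (fun t ht => ⟨h1 m t ⟨?_, ?_⟩, trivial⟩) ((h0 n).trans (h0 m).symm) ⟨?_, ?_⟩ <;>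
    first
      | linarith [ht.1, ht.2]
      | linarith [hs.1, hs.2]
  refine ⟨fun t => α ⌈|t - t₀|⌉₊ t, by simpa using h0 _, fun t => ?_⟩
  set N := ⌈|t - t₀|⌉₊ with hN
  have htN : |t - t₀| < N + 1 := (Nat.le_ceil _).trans_lt (lt_add_one _)
  have ht := abs_lt.1 htN
  refine (h1 N t ⟨by linarith, by linarith⟩).congr_of_eventuallyEq ?_
  have : ∀ᶠ s in 𝓝 t, |s - t₀| < N + 1 :=
    (isOpen_lt (by fun_prop) continuous_const).mem_nhds htN
  filter_upwards [this] with s hs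
  exact agree _ _ _ ((Nat.le_ceil _).trans_lt (lt_add_one _)) hs

/-- Forward uniqueness for continuously differentiable autonomous fields. -/
theorem eqOn_of_isIntegralCurveOn {E : Type*} [NormedAddCommGroup E] [NormedSpace ℝ E]
    [ProperSpace E]
    {X : E → E} (hX : ContDiff ℝ 1 X) {f g : ℝ → E}
    (hf : IsIntegralCurveOn f (fun _ => X) (Ici 0))
    (hg : IsIntegralCurveOn g (fun _ => X) (Ici 0)) (h0 : f 0 = g 0) : EqOn f g (Ici 0) := by
  intro T hT
  have hfc : ContinuousOn f (Icc 0 T) := hf.continuousOn.mono Icc_subset_Ici_self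
  have hgc : ContinuousOn g (Icc 0 T) := hg.continuousOn.mono Icc_subset_Ici_self
  obtain ⟨R, hR⟩ := ((isCompact_Icc.image_of_continuousOn hfc).union
    (isCompact_Icc.image_of_continuousOn hgc)).isBounded.subset_closedBall (0 : E)
  obtain ⟨K, hK⟩ := hX.contDiffOn.exists_lipschitzOnWith one_ne_zero
    (convex_closedBall (0 : E) R) (isCompact_closedBall _ _)
  refine ODE_solution_unique_of_mem_Icc_right (v := fun _ => X)
    (s := fun _ => Metric.closedBall 0 R) (K := K) (fun _ _ => hK) hfc
    (fun t ht => (hf t ht.1).mono (Ici_subset_Ici.2 ht.1))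
    (fun t ht => hR (Or.inl (mem_image_of_mem _ (Ico_subset_Icc_self ht)))) hgc
    (fun t ht => (hg t ht.1).mono (Ici_subset_Ici.2 ht.1))
    (fun t ht => hR (Or.inr (mem_image_of_mem _ (Ico_subset_Icc_self ht)))) h0
    ⟨hT, le_rfl⟩

/-- A positive bounded speed on the line defines a global change of time. -/
theorem exists_time_change {w : ℝ → ℝ} (hw : Continuous w) (hpos : ∀ s, 0 < w s) {M : ℝ}
    (hM : ∀ s, w s ≤ M) (s₀ : ℝ) :
    ∃ Θ τ : ℝ → ℝ, Θ 0 = s₀ ∧ τ s₀ = 0 ∧ StrictMono Θ ∧ StrictMono τ ∧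
      (∀ s, Θ (τ s) = s) ∧ (∀ t, τ (Θ t) = t) ∧
      (∀ t, HasDerivAt Θ (w (Θ t)) t) ∧ ∀ s, HasDerivAt τ (w s)⁻¹ s := by
  have hwi : Continuous fun s => (w s)⁻¹ := hw.inv₀ fun s => (hpos s).ne'
  set τ : ℝ → ℝ := fun s => ∫ x in s₀..s, (w x)⁻¹ with hτ
  have hder : ∀ s, HasDerivAt τ (w s)⁻¹ s := fun s =>
    intervalIntegral.integral_hasDerivAt_right (hwi.intervalIntegrable _ _)
      (hwi.stronglyMeasurableAtFilter _ _) hwi.continuousAt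
  have hM0 : 0 < M := (hpos 0).trans_le (hM 0)
  have hmono : StrictMono τ := strictMono_of_hasDerivAt_pos hder fun s => inv_pos.2 (hpos s)
  have hcont : Continuous τ := continuous_iff_continuousAt.2 fun s => (hder s).continuousAt
  have hτ0 : τ s₀ = 0 := by simp [hτ]
  -- Since `w ≤ M`, `τ` grows at least as fast as `s / M` and is onto the line. Without the upper
  -- bound the inverse `Θ` might exist only for a finite time.
  have hlin : Monotone fun s => τ s - M⁻¹ * s := by
    refine monotone_of_hasDerivAt_nonneg
      (fun s => (hder s).sub ((hasDerivAt_id s).const_mul M⁻¹)) fun s => ?_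
    simpa using inv_anti₀ (hpos s) (hM s)
  have htop : Tendsto τ atTop atTop := by
    have h1 : Tendsto (fun s => M⁻¹ * s + (τ 0 - M⁻¹ * 0)) atTop atTop :=
      tendsto_atTop_add_const_right _ _ (tendsto_id.const_mul_atTop (inv_pos.2 hM0))
    refine tendsto_atTop_mono' _ ?_ h1
    filter_upwards [eventually_ge_atTop 0] with s hs
    have := hlin hs
    simp only at this
    linarith
  have hbot : Tendsto τ atBot atBot := by
    have h1 : Tendsto (fun s => M⁻¹ * s + (τ 0 - M⁻¹ * 0)) atBot atBot :=
      tendsto_atBot_add_const_right _ _ (tendsto_id.const_mul_atBot (inv_pos.2 hM0))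
    refine tendsto_atBot_mono' _ ?_ h1
    filter_upwards [eventually_le_atBot 0] with s hs
    have := hlin hs
    simp only at this
    linarith
  have hsurj : Function.Surjective τ := hcont.surjective htop hbot
  let e : ℝ ≃o ℝ := hmono.orderIsoOfSurjective τ hsurj
  have he : ∀ s, e s = τ s := fun s => rfl
  have h1 : ∀ s, e.symm (τ s) = s := fun s => e.symm_apply_apply s
  have h2 : ∀ t, τ (e.symm t) = t := fun t => e.apply_symm_apply t
  refine ⟨e.symm, τ, by rw [← hτ0, h1], hτ0, e.symm.strictMono, hmono, h1, h2, fun t => ?_, hder⟩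
  have := HasDerivAt.of_local_left_inverse (f := τ) (g := e.symm) (a := t)
    e.symm.continuous.continuousAt (hder (e.symm t)) (inv_pos.2 (hpos _)).ne'
    (Eventually.of_forall h2)
  simpa using this

/-! ### Periodic scalar equations: attracting periodic solutions and averaging -/

-- Grönwall's inequality in squared form: `v² exp(-2 ∫ a)` is nonincreasing. Squaring avoids the
-- corner of `|v|` at zero. The rate `a` may change sign, so the same estimate yields crude growth
-- bounds and contraction in the mean over a period.
open Real in
theorem abs_le_exp_integral_mul {v v' a : ℝ → ℝ} {s t : ℝ} (hst : s ≤ t)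
    (hv : ∀ x ∈ Icc s t, HasDerivAt v (v' x) x) (ha : Continuous a)
    (h : ∀ x ∈ Icc s t, v' x * v x ≤ a x * v x ^ 2) :
    |v t| ≤ exp (∫ x in s..t, a x) * |v s| := by
  set I : ℝ → ℝ := fun x => ∫ y in s..x, a y with hI
  have hId : ∀ x, HasDerivAt I (a x) x := fun x =>
    intervalIntegral.integral_hasDerivAt_right (ha.intervalIntegrable _ _)
      (ha.stronglyMeasurableAtFilter _ _) ha.continuousAt
  have hd : ∀ x ∈ Icc s t, HasDerivAt (fun x => v x ^ 2 * exp (-2 * I x))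
      (2 * (v' x * v x - a x * v x ^ 2) * exp (-2 * I x)) x := by
    intro x hx
    refine (((hv x hx).pow 2).mul (((hId x).const_mul (-2)).exp)).congr_deriv ?_
    simp
    ring
  have hanti : AntitoneOn (fun x => v x ^ 2 * exp (-2 * I x)) (Icc s t) := by
    refine antitoneOn_of_deriv_nonpos (convex_Icc s t)
      (fun x hx => (hd x hx).continuousAt.continuousWithinAt)
      (fun x hx => (hd x (interior_subset hx)).differentiableAt.differentiableWithinAt)
      fun x hx => ?_
    rw [(hd x (interior_subset hx)).deriv]
    have := h x (interior_subset hx)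
    exact mul_nonpos_of_nonpos_of_nonneg (by linarith) (exp_pos _).le
  have h1 := hanti (left_mem_Icc.2 hst) (right_mem_Icc.2 hst) hst
  have hI0 : I s = 0 := by simp [hI]
  simp only [hI0, mul_zero, exp_zero, mul_one] at h1
  refine abs_le_of_sq_le_sq (a := v t) (b := exp (I t) * |v s|) ?_ (by positivity)
  have h2 : exp (-2 * I t) * exp (I t) ^ 2 = 1 := by
    rw [← exp_nat_mul, ← exp_add]; simp
  calc v t ^ 2 = (v t ^ 2 * exp (-2 * I t)) * exp (I t) ^ 2 := by rw [mul_assoc, h2, mul_one]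
    _ ≤ v s ^ 2 * exp (I t) ^ 2 := by gcongr
    _ = (exp (I t) * |v s|) ^ 2 := by rw [mul_pow, sq_abs]; ring

open Real in
/-- A `2π`-periodic scalar equation that contracts over one period and has a small displacement
has an attracting periodic solution. -/
theorem exists_attracting_periodic {G : ℝ → ℝ → ℝ} {A : ℝ → ℝ} {h₀ η r k : ℝ} {m K : NNReal}
    (hη : 0 < η) (hr : 0 < r) (hk : 0 < k) (hrm : r + 2 * π * m ≤ η / 2)
    (hper : ∀ θ, ∀ h ∈ Icc (h₀ - η) (h₀ + η), G (θ + 2 * π) h = G θ h)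
    (hcont : ∀ h ∈ Icc (h₀ - η) (h₀ + η), Continuous fun θ => G θ h)
    (hm : ∀ θ, ∀ h ∈ Icc (h₀ - η) (h₀ + η), |G θ h| ≤ m)
    (hK : ∀ θ, LipschitzOnWith K (G θ) (Icc (h₀ - η) (h₀ + η)))
    (hA : Continuous A) (hAper : Function.Periodic A (2 * π)) (hAk : ∫ θ in 0..2 * π, A θ = -k)
    (hGA : ∀ θ, ∀ x ∈ Icc (h₀ - η) (h₀ + η), ∀ y ∈ Icc (h₀ - η) (h₀ + η),
      (G θ x - G θ y) * (x - y) ≤ A θ * (x - y) ^ 2)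
    (hdisp : ∀ w : ℝ → ℝ, Continuous w → (∀ θ ∈ Icc 0 (2 * π), |w θ - h₀| ≤ 2 * π * m) →
      |∫ θ in 0..2 * π, G θ (w θ)| ≤ r * (1 - exp (-k))) :
    ∃ u : ℝ → ℝ, Function.Periodic u (2 * π) ∧ (∀ θ, |u θ - h₀| ≤ r + 2 * π * m) ∧
      (∀ θ, HasDerivAt u (G θ (u θ)) θ) ∧
      ∃ d > 0, ∃ C, ∀ θ₀ v₀, |v₀ - u θ₀| ≤ d → ∃ v : ℝ → ℝ, Continuous v ∧ v θ₀ = v₀ ∧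
        (∀ θ ≥ θ₀, |v θ - h₀| ≤ η ∧ HasDerivAt v (G θ (v θ)) θ ∧
          |v θ - u θ| ≤ C * |v₀ - u θ₀|) ∧
        Tendsto (fun θ => v θ - u θ) atTop (𝓝 0) := by
  have hπ := pi_pos
  set J := Icc (h₀ - η) (h₀ + η) with hJ
  have hab : h₀ - η ≤ h₀ + η := by linarith
  -- Composing with the projection onto `J` makes the equation globally bounded and Lipschitz and
  -- leaves it unchanged on `J`. Each solution is shown to remain in `J` wherever the original
  -- equation is needed.
  set p : ℝ → ℝ := fun h => (projIcc (h₀ - η) (h₀ + η) hab h : ℝ) with hp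
  have hpJ : ∀ h, p h ∈ J := fun h => (projIcc _ _ hab h).2
  have hpid : ∀ h ∈ J, p h = h := fun h hh => by simp [hp, projIcc_of_mem hab hh]
  have hmemJ : ∀ x, |x - h₀| ≤ η → x ∈ J := fun x hx => by
    have := abs_le.1 hx; constructor <;> linarith
  have hplip : LipschitzWith 1 p := LipschitzWith.projIcc hab
  set P : ℝ → ℝ → ℝ := fun θ h => G θ (p h) with hP
  have hPl : ∀ θ, LipschitzWith K (P θ) := fun θ => by
    have := (hK θ).comp (hplip.lipschitzOnWith (s := univ)) fun h _ => hpJ h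
    rw [mul_one, lipschitzOnWith_univ] at this
    exact this
  have hPc : ∀ x, Continuous fun θ => P θ x := fun x => hcont _ (hpJ x)
  have hPm : ∀ θ x, ‖P θ x‖ ≤ m := fun θ x => hm θ _ (hpJ x)
  have hPjoint : Continuous fun q : ℝ × ℝ => P q.1 q.2 :=
    continuous_prod_of_continuous_lipschitzWith' _ K hPl hPc
  choose S hS0 hS using exists_global_solution hPl hPc hPm
  have uniq : ∀ {u v : ℝ → ℝ} (t : ℝ), (∀ θ, HasDerivAt u (P θ (u θ)) θ) →
      (∀ θ, HasDerivAt v (P θ (v θ)) θ) → u t = v t → u = v := fun t hu hv h =>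
    ODE_solution_unique_univ (v := P) (s := fun _ => univ) (fun t => (hPl t).lipschitzOnWith)
      (fun t => ⟨hu t, trivial⟩) (fun t => ⟨hv t, trivial⟩) h
  have slow : ∀ {u : ℝ → ℝ}, (∀ θ, HasDerivAt u (P θ (u θ)) θ) → ∀ s t,
      |u s - u t| ≤ m * |s - t| := by
    intro u hu s t
    have := (lipschitzWith_of_nnnorm_deriv_le (C := m) (fun x => (hu x).differentiableAt)
      fun x => by rw [(hu x).deriv]; exact hPm _ _).dist_le_mul s t
    simpa [Real.dist_eq] using this
  have ucont : ∀ {u : ℝ → ℝ}, (∀ θ, HasDerivAt u (P θ (u θ)) θ) → Continuous u := fun hu =>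
    continuous_iff_continuousAt.2 fun x => (hu x).continuousAt
  -- A crude bound inside one period. Unlike `contr` below, it does not presuppose that the
  -- solutions stay in `J`, and so can be used to prove that they do.
  have grow : ∀ {u v : ℝ → ℝ}, (∀ θ, HasDerivAt u (P θ (u θ)) θ) →
      (∀ θ, HasDerivAt v (P θ (v θ)) θ) → ∀ s t, s ≤ t → t ≤ s + 2 * π →
      |v t - u t| ≤ exp (2 * π * K) * |v s - u s| := by
    intro u v hu hv s t hst hts
    have h1 := abs_le_exp_integral_mul (v := fun x => v x - u x) (a := fun _ => (K : ℝ)) hst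
      (fun x _ => (hv x).sub (hu x)) continuous_const fun x _ => by
        have h2 := (hPl x).dist_le_mul (v x) (u x)
        rw [Real.dist_eq, Real.dist_eq] at h2
        calc (P x (v x) - P x (u x)) * (v x - u x)
            ≤ |P x (v x) - P x (u x)| * |v x - u x| := by rw [← abs_mul]; exact le_abs_self _
          _ ≤ (K * |v x - u x|) * |v x - u x| := by gcongr
          _ = K * (v x - u x) ^ 2 := by rw [mul_assoc, ← sq, sq_abs]
    refine h1.trans ?_
    gcongr
    simp only [intervalIntegral.integral_const, smul_eq_mul]
    exact mul_le_mul_of_nonneg_right (by linarith) K.2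
  have contr : ∀ {u v : ℝ → ℝ}, (∀ θ, HasDerivAt u (P θ (u θ)) θ) →
      (∀ θ, HasDerivAt v (P θ (v θ)) θ) → ∀ s, (∀ θ ∈ Icc s (s + 2 * π), u θ ∈ J ∧ v θ ∈ J) →
      |v (s + 2 * π) - u (s + 2 * π)| ≤ exp (-k) * |v s - u s| := by
    intro u v hu hv s hJs
    have h1 := abs_le_exp_integral_mul (v := fun x => v x - u x) (a := A)
      (by linarith : s ≤ s + 2 * π)
      (fun x _ => (hv x).sub (hu x)) hA fun x hx => by
        simp only [hP, hpid _ (hJs x hx).1, hpid _ (hJs x hx).2]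
        exact hGA x _ (hJs x hx).2 _ (hJs x hx).1
    rwa [hAper.intervalIntegral_add_eq s 0, zero_add, hAk] at h1
  have hexpk : exp (-k) < 1 := by
    rw [← exp_zero]; exact exp_lt_exp.2 (by linarith)
  have hm0 : (0 : ℝ) ≤ 2 * π * m := by positivity
  -- The period map. It contracts by `exp (-k)` on the interval of radius `r` about `h₀` and moves
  -- the centre by at most `r * (1 - exp (-k))`, so it maps the interval into itself and has a fixed
  -- point there.
  set φ : ℝ → ℝ := fun x => S 0 x (2 * π) with hφ
  have stay : ∀ x, |x - h₀| ≤ r → ∀ θ ∈ Icc 0 (2 * π), |S 0 x θ - h₀| ≤ r + 2 * π * m := by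
    intro x hx θ hθ
    have h1 := slow (hS 0 x) θ 0
    rw [hS0, sub_zero, abs_of_nonneg hθ.1] at h1
    calc |S 0 x θ - h₀| = |(S 0 x θ - x) + (x - h₀)| := by ring_nf
      _ ≤ |S 0 x θ - x| + |x - h₀| := abs_add_le _ _
      _ ≤ m * (2 * π) + r := add_le_add (h1.trans (by gcongr; exact hθ.2)) hx
      _ = _ := by ring
  have hφl : ∀ x y, |x - h₀| ≤ r → |y - h₀| ≤ r → |φ x - φ y| ≤ exp (-k) * |x - y| := by
    intro x y hx hy
    have := contr (hS 0 y) (hS 0 x) 0 fun θ hθ => by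
      rw [zero_add] at hθ
      exact ⟨hmemJ _ ((stay y hy θ hθ).trans (by linarith)),
        hmemJ _ ((stay x hx θ hθ).trans (by linarith))⟩
    simpa [hS0] using this
  have hφ0 : |φ h₀ - h₀| ≤ r * (1 - exp (-k)) := by
    have hw : ∀ θ ∈ Icc 0 (2 * π), |S 0 h₀ θ - h₀| ≤ 2 * π * m := by
      intro θ hθ
      have h1 := slow (hS 0 h₀) θ 0
      rw [hS0, sub_zero, abs_of_nonneg hθ.1] at h1
      exact h1.trans (by rw [mul_comm]; gcongr; exact hθ.2)
    have h2 := hdisp (S 0 h₀) (ucont (hS 0 h₀)) hw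
    have h3 : ∫ θ in 0..2 * π, P θ (S 0 h₀ θ) = φ h₀ - h₀ := by
      rw [intervalIntegral.integral_eq_sub_of_hasDerivAt (fun θ _ => hS 0 h₀ θ), hS0]
      exact (hPjoint.comp (continuous_id.prodMk (ucont (hS 0 h₀)))).intervalIntegrable _ _
    rw [← h3]
    convert h2 using 2
    refine intervalIntegral.integral_congr fun θ hθ => ?_
    rw [uIcc_of_le (by positivity)] at hθ
    simp only [hP]
    rw [hpid _ (hmemJ _ ((hw θ hθ).trans (by linarith)))]
  obtain ⟨x, hxr, hx⟩ : ∃ x, |x - h₀| ≤ r ∧ φ x = x := by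
    have hball : ∀ x ∈ Icc (h₀ - r) (h₀ + r), |x - h₀| ≤ r := fun x hx =>
      abs_le.2 ⟨by linarith [hx.1], by linarith [hx.2]⟩
    have hcφ : ContinuousOn (fun x => x - φ x) (Icc (h₀ - r) (h₀ + r)) := by
      refine continuousOn_id.sub (LipschitzOnWith.continuousOn (K := 1)
        (LipschitzOnWith.of_dist_le_mul fun x hx y hy => ?_))
      rw [Real.dist_eq, Real.dist_eq]
      refine (hφl x y (hball x hx) (hball y hy)).trans ?_
      exact mul_le_mul_of_nonneg_right (by simpa using hexpk.le) (abs_nonneg _)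
    have hle : h₀ - r ≤ h₀ + r := by linarith
    have e1 := abs_le.1 (hφl (h₀ + r) h₀ (by simp [abs_of_pos hr]) (by simp [hr.le]))
    have e2 := abs_le.1 (hφl (h₀ - r) h₀ (by simp [abs_of_pos hr]) (by simp [hr.le]))
    have e0 := abs_le.1 hφ0
    simp only [add_sub_cancel_left, sub_sub_cancel_left, abs_neg, abs_of_pos hr] at e1 e2
    have := intermediate_value_Icc hle hcφ
    obtain ⟨x, hx, hx0⟩ := this (show (0 : ℝ) ∈ _ from ⟨by linarith, by linarith⟩)
    exact ⟨x, hball x hx, by simp only at hx0; linarith⟩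
  set u := S 0 x with hu
  have hud : ∀ θ, HasDerivAt u (P θ (u θ)) θ := hS 0 x
  have huper : Function.Periodic u (2 * π) := by
    have : (fun θ => u (θ + 2 * π)) = u := by
      refine uniq 0 (fun θ => ?_) hud ?_
      · have h1 := (hud (θ + 2 * π)).comp_add_const θ (2 * π)
        refine h1.congr_deriv ?_
        simp only [hP]
        exact hper _ _ (hpJ _)
      · simp only [zero_add]
        exact hx.trans (hS0 0 x).symm
    exact fun θ => congrFun this θ
  have hub : ∀ θ, |u θ - h₀| ≤ r + 2 * π * m := by
    intro θ
    obtain ⟨y, hy, hyθ⟩ := huper.exists_mem_Ico₀ (by positivity) θ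
    rw [hyθ]
    exact stay x hxr y (Ico_subset_Icc_self hy)
  have huJ : ∀ θ, u θ ∈ J := fun θ => hmemJ _ ((hub θ).trans (by linarith))
  -- A solution this close to `u` at the start of a turn stays within `η / 2` of `u`, hence in `J`,
  -- during the whole turn; the contraction then keeps it at least as close at the start of the next
  -- one.
  refine ⟨u, huper, hub, fun θ => ?_, η / 2 * exp (-(2 * π * K)), by positivity,
    exp (2 * π * K), ?_⟩
  · have := hud θ
    simp only [hP, hpid _ (huJ θ)] at this
    exact this
  intro θ₀ v₀ hv₀
  set v := S θ₀ v₀ with hv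
  have hvd : ∀ θ, HasDerivAt v (P θ (v θ)) θ := hS θ₀ v₀
  have hv0 : v θ₀ = v₀ := hS0 θ₀ v₀
  have hclose : ∀ s, |v s - u s| ≤ |v₀ - u θ₀| → ∀ θ ∈ Icc s (s + 2 * π), v θ ∈ J := by
    intro s hs θ hθ
    have h1 := grow hud hvd s θ hθ.1 hθ.2
    have h2 : exp (2 * π * K) * |v s - u s| ≤ η / 2 := by
      calc exp (2 * π * K) * |v s - u s| ≤ exp (2 * π * K) * (η / 2 * exp (-(2 * π * K))) := by
            gcongr; exact hs.trans hv₀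
        _ = η / 2 * (exp (2 * π * K) * exp (-(2 * π * K))) := by ring
        _ = η / 2 := by rw [← exp_add]; simp
    refine hmemJ _ ?_
    calc |v θ - h₀| = |(v θ - u θ) + (u θ - h₀)| := by ring_nf
      _ ≤ |v θ - u θ| + |u θ - h₀| := abs_add_le _ _
      _ ≤ η / 2 + η / 2 := add_le_add (h1.trans h2) ((hub θ).trans hrm)
      _ = η := by ring
  have iter : ∀ n : ℕ, |v (θ₀ + n * (2 * π)) - u (θ₀ + n * (2 * π))| ≤
      exp (-k) ^ n * |v₀ - u θ₀| := by
    intro n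
    induction n with
    | zero => simp [hv0]
    | succ n ih =>
      have hle : |v (θ₀ + n * (2 * π)) - u (θ₀ + n * (2 * π))| ≤ |v₀ - u θ₀| :=
        ih.trans (mul_le_of_le_one_left (abs_nonneg _) (pow_le_one₀ (exp_pos _).le hexpk.le))
      have h1 := contr hud hvd (θ₀ + n * (2 * π)) fun θ hθ => ⟨huJ θ, hclose _ hle θ hθ⟩
      have h2 : θ₀ + (n + 1 : ℕ) * (2 * π) = θ₀ + n * (2 * π) + 2 * π := by push_cast; ring
      rw [h2, pow_succ', mul_assoc]
      exact h1.trans (by gcongr)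
  have bound : ∀ θ ≥ θ₀, v θ ∈ J ∧ |v θ - u θ| ≤
      exp (2 * π * K) * (exp (-k) ^ ⌊(θ - θ₀) / (2 * π)⌋₊ * |v₀ - u θ₀|) := by
    intro θ hθ
    set n := ⌊(θ - θ₀) / (2 * π)⌋₊ with hn
    have hn1 : (n : ℝ) * (2 * π) ≤ θ - θ₀ := by
      rw [← le_div_iff₀ (by positivity)]
      exact Nat.floor_le (div_nonneg (by linarith) (by positivity))
    have hn2 : θ - θ₀ < (n + 1) * (2 * π) := by
      rw [← div_lt_iff₀ (by positivity)]
      exact Nat.lt_floor_add_one _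
    have hmem : θ ∈ Icc (θ₀ + n * (2 * π)) (θ₀ + n * (2 * π) + 2 * π) :=
      ⟨by linarith, by linarith⟩
    refine ⟨hclose _ ((iter n).trans (mul_le_of_le_one_left (abs_nonneg _)
      (pow_le_one₀ (exp_pos _).le hexpk.le))) θ hmem, ?_⟩
    exact (grow hud hvd _ _ hmem.1 hmem.2).trans (by gcongr; exact iter n)
  refine ⟨v, ucont hvd, hv0, fun θ hθ => ⟨?_, ?_, ?_⟩, ?_⟩
  · have := (bound θ hθ).1
    exact abs_le.2 ⟨by linarith [this.1], by linarith [this.2]⟩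
  · have := hvd θ
    simp only [hP, hpid _ (bound θ hθ).1] at this
    exact this
  · refine (bound θ hθ).2.trans ?_
    gcongr
    exact mul_le_of_le_one_left (abs_nonneg _) (pow_le_one₀ (exp_pos _).le hexpk.le)
  · rw [tendsto_zero_iff_abs_tendsto_zero]
    have hfl : Tendsto (fun θ : ℝ => ⌊(θ - θ₀) / (2 * π)⌋₊) atTop atTop :=
      tendsto_nat_floor_atTop.comp
        ((tendsto_atTop_add_const_right _ (-θ₀) tendsto_id).atTop_div_const (by positivity))
    have h1 : Tendsto (fun θ : ℝ => exp (2 * π * K) *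
        (exp (-k) ^ ⌊(θ - θ₀) / (2 * π)⌋₊ * |v₀ - u θ₀|)) atTop (𝓝 0) := by
      have := ((tendsto_pow_atTop_nhds_zero_of_lt_one (exp_pos (-k)).le hexpk).comp hfl).mul_const
        |v₀ - u θ₀| |>.const_mul (exp (2 * π * K))
      simpa using this
    refine squeeze_zero' (Eventually.of_forall fun _ => abs_nonneg _) ?_ h1
    filter_upwards [eventually_ge_atTop θ₀] with θ hθ using (bound θ hθ).2

open Real in
/-- First-order averaging: a zero of the averaged equation with negative derivative yields
attracting `2π`-periodic solutions of `h' = ε F(ε, θ, h)` for small `ε > 0`. -/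
theorem exists_attracting_periodic_of_average {F F' : ℝ → ℝ → ℝ → ℝ} {h₀ η₀ ε₀ : ℝ}
    (hη₀ : 0 < η₀) (hε₀ : 0 < ε₀)
    (hc : ContinuousOn (fun q : ℝ × ℝ × ℝ => F q.1 q.2.1 q.2.2)
      (Icc 0 ε₀ ×ˢ univ ×ˢ Icc (h₀ - η₀) (h₀ + η₀)))
    (hc' : ContinuousOn (fun q : ℝ × ℝ × ℝ => F' q.1 q.2.1 q.2.2)
      (Icc 0 ε₀ ×ˢ univ ×ˢ Icc (h₀ - η₀) (h₀ + η₀)))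
    (hd : ∀ ε ∈ Icc 0 ε₀, ∀ θ, ∀ h ∈ Icc (h₀ - η₀) (h₀ + η₀), HasDerivAt (F ε θ) (F' ε θ h) h)
    (hper : ∀ ε ∈ Icc 0 ε₀, ∀ h ∈ Icc (h₀ - η₀) (h₀ + η₀),
      Function.Periodic (fun θ => F ε θ h) (2 * π))
    (hper' : ∀ ε ∈ Icc 0 ε₀, ∀ h ∈ Icc (h₀ - η₀) (h₀ + η₀),
      Function.Periodic (fun θ => F' ε θ h) (2 * π))
    (hI : ∫ θ in 0..2 * π, F 0 θ h₀ = 0) (hI' : ∫ θ in 0..2 * π, F' 0 θ h₀ < 0)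
    {r : ℝ} (hr : 0 < r) :
    ∀ᶠ ε in 𝓝[>] (0 : ℝ), ∃ u : ℝ → ℝ, Function.Periodic u (2 * π) ∧ (∀ θ, |u θ - h₀| ≤ r) ∧
      (∀ θ, HasDerivAt u (ε * F ε θ (u θ)) θ) ∧
      ∃ d > 0, ∃ C, ∀ θ₀ v₀, |v₀ - u θ₀| ≤ d → ∃ v : ℝ → ℝ, Continuous v ∧ v θ₀ = v₀ ∧
        (∀ θ ≥ θ₀, |v θ - h₀| ≤ η₀ ∧ HasDerivAt v (ε * F ε θ (v θ)) θ ∧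
          |v θ - u θ| ≤ C * |v₀ - u θ₀|) ∧
        Tendsto (fun θ => v θ - u θ) atTop (𝓝 0) := by
  have hπ := pi_pos
  set J := Icc (h₀ - η₀) (h₀ + η₀) with hJ
  have hh₀ : h₀ ∈ J := ⟨by linarith, by linarith⟩
  have h00 : (0 : ℝ) ∈ Icc 0 ε₀ := ⟨le_rfl, hε₀.le⟩
  set Q : Set (ℝ × ℝ × ℝ) := Icc 0 ε₀ ×ˢ Icc 0 (2 * π) ×ˢ J with hQ
  have hQc : IsCompact Q := isCompact_Icc.prod (isCompact_Icc.prod isCompact_Icc)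
  have hQs : Q ⊆ Icc 0 ε₀ ×ˢ univ ×ˢ J := prod_mono le_rfl (prod_mono (subset_univ _) le_rfl)
  obtain ⟨M, hM⟩ := hQc.exists_bound_of_continuousOn (hc.mono hQs)
  obtain ⟨K, hK⟩ := hQc.exists_bound_of_continuousOn (hc'.mono hQs)
  have hM' : ∀ ε ∈ Icc 0 ε₀, ∀ θ, ∀ h ∈ J, |F ε θ h| ≤ M := by
    intro ε hε θ h hh
    obtain ⟨y, hy, hyθ⟩ := (hper ε hε h hh).exists_mem_Ico₀ (by positivity) θ
    rw [hyθ]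
    exact hM (ε, y, h) ⟨hε, Ico_subset_Icc_self hy, hh⟩
  have hK' : ∀ ε ∈ Icc 0 ε₀, ∀ θ, ∀ h ∈ J, |F' ε θ h| ≤ K := by
    intro ε hε θ h hh
    obtain ⟨y, hy, hyθ⟩ := (hper' ε hε h hh).exists_mem_Ico₀ (by positivity) θ
    rw [hyθ]
    exact hK (ε, y, h) ⟨hε, Ico_subset_Icc_self hy, hh⟩
  have hM0 : 0 ≤ M := (abs_nonneg _).trans (hM' 0 h00 0 h₀ hh₀)
  have hK0 : 0 ≤ K := (abs_nonneg _).trans (hK' 0 h00 0 h₀ hh₀)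
  have hslice : ∀ {f : ℝ → ℝ → ℝ → ℝ}, ContinuousOn (fun q : ℝ × ℝ × ℝ => f q.1 q.2.1 q.2.2)
      (Icc 0 ε₀ ×ˢ univ ×ˢ J) → ∀ ε ∈ Icc 0 ε₀, ∀ w : ℝ → ℝ, ∀ s : Set ℝ, ContinuousOn w s →
      (∀ θ ∈ s, w θ ∈ J) → ContinuousOn (fun θ => f ε θ (w θ)) s := by
    intro f hf ε hε w s hw hws
    exact hf.comp (continuousOn_const.prodMk (continuousOn_id.prodMk hw))
      fun θ hθ => ⟨hε, trivial, hws θ hθ⟩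
  -- Half of the averaged derivative is given away: `A` exceeds `F' 0 θ h₀` by `κ / (2π)`, so its
  -- integral over a period is `-2κ + κ = -κ`, and the margin lets it dominate `F' ε θ h` for all
  -- small `ε` and all `h` near `h₀`.
  set κ := -(∫ θ in 0..2 * π, F' 0 θ h₀) / 2 with hκ
  have hκ0 : 0 < κ := by rw [hκ]; linarith
  set A : ℝ → ℝ := fun θ => F' 0 θ h₀ + κ / (2 * π) with hA
  have hF'c : Continuous fun θ => F' 0 θ h₀ := by
    rw [← continuousOn_univ]
    exact hslice hc' 0 h00 (fun _ => h₀) univ continuousOn_const fun _ _ => hh₀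
  have hAc : Continuous A := hF'c.add continuous_const
  have hAper : Function.Periodic A (2 * π) := fun θ => by
    have := hper' 0 h00 h₀ hh₀ θ
    simp only at this
    simp only [hA, this]
  have hAI : ∫ θ in 0..2 * π, A θ = -κ := by
    simp only [hA]
    rw [intervalIntegral.integral_add (hF'c.intervalIntegrable _ _) (by simp)]
    simp only [intervalIntegral.integral_const, smul_eq_mul, sub_zero]
    rw [mul_div_cancel₀ _ (by positivity)]
    rw [hκ]; ring
  obtain ⟨δ, hδ, hδF⟩ := Metric.uniformContinuousOn_iff.1
    (hQc.uniformContinuousOn_of_continuous (hc'.mono hQs)) (κ / (2 * π)) (by positivity)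
  set η := min η₀ (δ / 2) with hη
  have hη0 : 0 < η := lt_min hη₀ (by linarith)
  have hηJ : Icc (h₀ - η) (h₀ + η) ⊆ J :=
    Icc_subset_Icc (by linarith [min_le_left η₀ (δ / 2)]) (by linarith [min_le_left η₀ (δ / 2)])
  have hF'A : ∀ ε ∈ Icc 0 ε₀, ε < δ → ∀ θ, ∀ h ∈ Icc (h₀ - η) (h₀ + η), F' ε θ h ≤ A θ := by
    intro ε hε hεδ θ h hh
    have hp : Function.Periodic (fun θ => F' ε θ h - A θ) (2 * π) :=
      (hper' ε hε h (hηJ hh)).sub hAper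
    obtain ⟨y, hy, hyθ⟩ := hp.exists_mem_Ico₀ (by positivity) θ
    have h1 := hδF (ε, y, h) ⟨hε, Ico_subset_Icc_self hy, hηJ hh⟩ (0, y, h₀)
      ⟨h00, Ico_subset_Icc_self hy, hh₀⟩ ?_
    · rw [Real.dist_eq] at h1
      have h2 := (abs_lt.1 h1).2
      simp only [hA] at h2 hyθ ⊢
      linarith
    · rw [Prod.dist_eq, Prod.dist_eq]
      refine max_lt ?_ (max_lt ?_ ?_)
      · simpa [abs_of_nonneg hε.1] using hεδ
      · simpa using hδ
      · rw [Real.dist_eq]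
        have : |h - h₀| ≤ η := abs_le.2 ⟨by linarith [hh.1], by linarith [hh.2]⟩
        have := min_le_right η₀ (δ / 2)
        simp only; linarith
  -- The drift `2πMε` in one turn will be made smaller than `r₁`, so `2 r₁` must exceed neither `r`
  -- nor `η / 2`.
  set r₁ := min (r / 2) (η / 4) with hr₁
  have hr₁0 : 0 < r₁ := lt_min (by linarith) (by linarith)
  have hr₁r : r₁ ≤ r / 2 := min_le_left _ _
  have hr₁η : r₁ ≤ η / 4 := min_le_right _ _
  -- Over a turn of length `2π` this tolerance adds up to `r₁ κ / 2`, and `1 - exp (-εκ) ≥ εκ / 2`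
  -- as long as `εκ < 1`.
  obtain ⟨δ₂, hδ₂, hδF₂⟩ := Metric.uniformContinuousOn_iff.1
    (hQc.uniformContinuousOn_of_continuous (hc.mono hQs)) (r₁ * κ / (4 * π)) (by positivity)
  have ev : ∀ c > 0, ∀ b ≥ 0, ∀ᶠ ε in 𝓝[>] (0 : ℝ), b * ε < c := by
    intro c hc b hb
    have : Tendsto (fun ε : ℝ => b * ε) (𝓝[>] 0) (𝓝 0) := by
      have : Tendsto (fun ε : ℝ => b * ε) (𝓝 0) (𝓝 (b * 0)) := (continuous_const_mul b).tendsto 0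
      rw [mul_zero] at this
      exact this.mono_left nhdsWithin_le_nhds
    exact this.eventually (gt_mem_nhds hc)
  filter_upwards [self_mem_nhdsWithin, ev ε₀ hε₀ 1 zero_le_one, ev δ hδ 1 zero_le_one,
    ev δ₂ hδ₂ 1 zero_le_one, ev δ₂ hδ₂ (2 * π * M) (by positivity),
    ev r₁ hr₁0 (2 * π * M) (by positivity), ev 1 one_pos κ hκ0.le]
    with ε hεpos e1 e2 e3 e4 e5 e6
  simp only [one_mul] at e1 e2 e3
  have hε0 : 0 < ε := hεpos
  have hε : ε ∈ Icc 0 ε₀ := ⟨hε0.le, e1.le⟩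
  have hexp : κ * ε / 2 ≤ 1 - exp (-(ε * κ)) := by
    have h1 : 1 + ε * κ ≤ exp (ε * κ) := by linarith [add_one_le_exp (ε * κ)]
    have h2 : 0 < ε * κ := by positivity
    have h3 : exp (-(ε * κ)) ≤ (1 + ε * κ)⁻¹ := by
      rw [exp_neg]; exact inv_anti₀ (by linarith) h1
    have h4 : (1 + ε * κ)⁻¹ ≤ 1 - ε * κ / 2 := by
      rw [inv_le_iff_one_le_mul₀ (by linarith)]
      nlinarith
    linarith
  obtain ⟨u, hu1, hu2, hu3, d, hd0, C, hC⟩ := exists_attracting_periodic (h₀ := h₀)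
    (G := fun θ h => ε * F ε θ h) (A := fun θ => ε * A θ) (η := η) (r := r₁) (k := ε * κ)
    (m := (ε * M).toNNReal) (K := (ε * K).toNNReal) hη0 hr₁0 (by positivity)
    (by rw [coe_toNNReal _ (by positivity)]; linarith)
    (fun θ h hh => by
      have := hper ε hε h (hηJ hh) θ
      simp only at this
      rw [this])
    (fun h hh => by
      rw [← continuousOn_univ]
      exact continuousOn_const.mul
        (hslice hc ε hε (fun _ => h) univ continuousOn_const fun _ _ => hηJ hh))
    (fun θ h hh => by
      rw [coe_toNNReal _ (by positivity), abs_mul, abs_of_pos hε0]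
      gcongr
      exact hM' ε hε θ h (hηJ hh))
    (fun θ => by
      refine Convex.lipschitzOnWith_of_nnnorm_hasDerivWithin_le (convex_Icc _ _)
        (f' := fun h => ε * F' ε θ h)
        (fun h hh => ((hd ε hε θ h (hηJ hh)).const_mul ε).hasDerivWithinAt) fun h hh => ?_
      rw [← NNReal.coe_le_coe, coe_toNNReal _ (by positivity), coe_nnnorm, norm_eq_abs, abs_mul,
        abs_of_pos hε0]
      gcongr
      exact hK' ε hε θ h (hηJ hh))
    (hAc.const_mul ε |> fun h => by simpa using h)
    (fun θ => by simp only [hAper θ])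
    (by rw [intervalIntegral.integral_const_mul, hAI]; ring)
    (fun θ => by
      have mono : ∀ x ∈ Icc (h₀ - η) (h₀ + η), ∀ y ∈ Icc (h₀ - η) (h₀ + η), x ≤ y →
          F ε θ y - F ε θ x ≤ A θ * (y - x) := by
        intro x hx y hy hxy
        refine Convex.image_sub_le_mul_sub_of_deriv_le (convex_Icc (h₀ - η) (h₀ + η))
          (fun h hh => (hd ε hε θ h (hηJ hh)).continuousAt.continuousWithinAt)
          (fun h hh => (hd ε hε θ h
            (hηJ (interior_subset hh))).differentiableAt.differentiableWithinAt)
          (fun h hh => ?_) x hx y hy hxy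
        rw [(hd ε hε θ h (hηJ (interior_subset hh))).deriv]
        exact hF'A ε hε e2 θ h (interior_subset hh)
      intro x hx y hy
      rcases le_total x y with h | h
      · have := mul_le_mul_of_nonneg_left (mul_le_mul_of_nonneg_right (mono x hx y hy h)
          (sub_nonneg.2 h)) hε0.le
        nlinarith [this]
      · have := mul_le_mul_of_nonneg_left (mul_le_mul_of_nonneg_right (mono y hy x hx h)
          (sub_nonneg.2 h)) hε0.le
        nlinarith [this])
    (fun w hw hwb => by
      rw [coe_toNNReal _ (by positivity)] at hwb
      have hwJ : ∀ θ ∈ Icc 0 (2 * π), w θ ∈ J := fun θ hθ => by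
        have := abs_le.1 (hwb θ hθ)
        exact hηJ ⟨by nlinarith, by nlinarith⟩
      have i1 : IntervalIntegrable (fun θ => F ε θ (w θ)) MeasureTheory.volume 0 (2 * π) := by
        refine ContinuousOn.intervalIntegrable ?_
        rw [uIcc_of_le (by positivity)]
        exact hslice hc ε hε w _ hw.continuousOn hwJ
      have i2 : IntervalIntegrable (fun θ => F 0 θ h₀) MeasureTheory.volume 0 (2 * π) :=
        (hslice hc 0 h00 (fun _ => h₀) _ continuousOn_const fun _ _ => hh₀).intervalIntegrable
      have h1 : ∫ θ in 0..2 * π, F ε θ (w θ) =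
          ∫ θ in 0..2 * π, (F ε θ (w θ) - F 0 θ h₀) := by
        rw [intervalIntegral.integral_sub i1 i2, hI, sub_zero]
      have h2 : ‖∫ θ in 0..2 * π, (F ε θ (w θ) - F 0 θ h₀)‖ ≤
          r₁ * κ / (4 * π) * |2 * π - 0| := by
        refine intervalIntegral.norm_integral_le_of_norm_le_const fun θ hθ => ?_
        rw [uIoc_of_le (by positivity)] at hθ
        have hθ' := Ioc_subset_Icc_self hθ
        have := hδF₂ (ε, θ, w θ) ⟨hε, hθ', hwJ θ hθ'⟩ (0, θ, h₀) ⟨h00, hθ', hh₀⟩ ?_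
        · rw [Real.dist_eq] at this
          exact this.le
        · rw [Prod.dist_eq, Prod.dist_eq]
          refine max_lt ?_ (max_lt ?_ ?_)
          · simpa [abs_of_pos hε0] using e3
          · simpa using hδ₂
          · rw [Real.dist_eq]
            refine (hwb θ hθ').trans_lt ?_
            linarith
      rw [sub_zero, abs_of_pos (by positivity : 0 < 2 * π), norm_eq_abs] at h2
      rw [intervalIntegral.integral_const_mul, h1, abs_mul, abs_of_pos hε0]
      calc ε * |∫ θ in 0..2 * π, (F ε θ (w θ) - F 0 θ h₀)|
          ≤ ε * (r₁ * κ / (4 * π) * (2 * π)) := by gcongr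
        _ = r₁ * (κ * ε / 2) := by field_simp; ring
        _ ≤ _ := by gcongr)
  refine ⟨u, hu1, fun θ => (hu2 θ).trans ?_, hu3, d, hd0, C, fun θ₀ v₀ hv => ?_⟩
  · rw [coe_toNNReal _ (by positivity)]
    linarith
  · obtain ⟨v, hv1, hv2, hv3, hv4⟩ := hC θ₀ v₀ hv
    exact ⟨v, hv1, hv2, fun θ hθ => ⟨(hv3 θ hθ).1.trans (min_le_left _ _), (hv3 θ hθ).2⟩, hv4⟩

/-! ### Closed orbits -/

section ClosedOrbits

variable {X : ℝ × ℝ → ℝ × ℝ}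

theorem IsPeriodParam.continuous {γ : ℝ → ℝ × ℝ} {T : ℝ} {Γ : Set (ℝ × ℝ)}
    (h : IsPeriodParam X γ T Γ) : Continuous γ :=
  IsIntegralCurve.continuous h.solves

theorem IsPeriodParam.isCompact {γ : ℝ → ℝ × ℝ} {T : ℝ} {Γ : Set (ℝ × ℝ)}
    (h : IsPeriodParam X γ T Γ) : IsCompact Γ := by
  have : Γ = γ '' Icc 0 T := by
    rw [← h.range_eq]
    refine Subset.antisymm ?_ (image_subset_range _ _)
    rintro _ ⟨t, rfl⟩
    obtain ⟨y, hy, hyt⟩ := h.periodic.exists_mem_Ico₀ h.pos t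
    exact ⟨y, Ico_subset_Icc_self hy, hyt.symm⟩
  rw [this]
  exact isCompact_Icc.image h.continuous

theorem IsPeriodParam.nonempty {γ : ℝ → ℝ × ℝ} {T : ℝ} {Γ : Set (ℝ × ℝ)}
    (h : IsPeriodParam X γ T Γ) : Γ.Nonempty := by
  rw [← h.range_eq]; exact range_nonempty γ

theorem IsPeriodParam.exists_eq_zsmul {γ : ℝ → ℝ × ℝ} {T : ℝ} {Γ : Set (ℝ × ℝ)}
    (h : IsPeriodParam X γ T Γ) {a b : ℝ} (hab : γ a = γ b) : ∃ n : ℤ, b - a = n • T := by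
  have hmod : ∀ a, γ (toIcoMod h.pos 0 a) = γ a := fun a => by
    rw [toIcoMod]; exact h.periodic.sub_zsmul_eq _
  have hmem : ∀ a, toIcoMod h.pos 0 a ∈ Ico 0 T := fun a => by
    simpa using toIcoMod_mem_Ico h.pos 0 a
  have := h.injOn (hmem a) (hmem b) (by rw [hmod, hmod, hab])
  exact (toIcoMod_eq_toIcoMod h.pos).1 this

theorem IsPeriodParam.shift_isIntegralCurveOn {γ : ℝ → ℝ × ℝ} {T : ℝ} {Γ : Set (ℝ × ℝ)}
    (h : IsPeriodParam X γ T Γ) (s : ℝ) :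
    IsIntegralCurveOn (fun t => γ (t + s)) (fun _ => X) (Ici 0) := fun t _ =>
  ((h.solves (t + s)).comp_add_const t s).hasDerivWithinAt

/-- By uniqueness, two parametrisations of one orbit differ by a shift of time. Each period is then
a positive integer multiple of the other, so they are equal. This makes the Abelian integral
independent of the parametrisation. -/
theorem IsPeriodParam.exists_shift (hX : ContDiff ℝ 1 X) {γ γ₀ : ℝ → ℝ × ℝ} {T T₀ : ℝ}
    {Γ : Set (ℝ × ℝ)} (h : IsPeriodParam X γ T Γ) (h₀ : IsPeriodParam X γ₀ T₀ Γ) :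
    T = T₀ ∧ ∃ s, ∀ t ≥ 0, γ t = γ₀ (t + s) := by
  obtain ⟨s, hs⟩ : γ 0 ∈ range γ₀ := by rw [h₀.range_eq, ← h.range_eq]; exact mem_range_self _
  have heq : ∀ t ≥ 0, γ t = γ₀ (t + s) := fun t ht => by
    have := eqOn_of_isIntegralCurveOn hX (h.shift_isIntegralCurveOn 0)
      (h₀.shift_isIntegralCurveOn s) (by simp [hs]) ht
    simpa using this
  refine ⟨?_, s, heq⟩
  obtain ⟨n, hn⟩ := h₀.exists_eq_zsmul (a := s) (b := T + s) (by
    rw [← heq T h.pos.le, hs]; simpa using (h.periodic 0).symm)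
  obtain ⟨m, hm⟩ := h.exists_eq_zsmul (a := 0) (b := T₀) (by
    rw [heq T₀ h₀.pos.le, add_comm, h₀.periodic, hs])
  rw [add_sub_cancel_right, zsmul_eq_mul] at hn
  rw [sub_zero, zsmul_eq_mul] at hm
  have one_le : ∀ {k : ℤ} {a b : ℝ}, 0 < a → 0 < b → a = k * b → b ≤ a := by
    intro k a b ha hb hab
    have hk : (0 : ℝ) < k := by
      by_contra hk
      rw [not_lt] at hk
      nlinarith
    have hk0 : 0 < k := by exact_mod_cast hk
    have hk1 : (1 : ℝ) ≤ k := by exact_mod_cast Int.add_one_le_iff.2 hk0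
    nlinarith
  exact le_antisymm (one_le h₀.pos h.pos hm) (one_le h.pos h₀.pos hn)

theorem IsClosedOrbit.subset_of_mem (hX : ContDiff ℝ 1 X) {Γ Γ' : Set (ℝ × ℝ)}
    (h : IsClosedOrbit X Γ) (h' : IsClosedOrbit X Γ') {p : ℝ × ℝ} (hp : p ∈ Γ) (hp' : p ∈ Γ') :
    Γ ⊆ Γ' := by
  obtain ⟨γ, T, h⟩ := h
  obtain ⟨γ', T', h'⟩ := h'
  obtain ⟨s, rfl⟩ : p ∈ range γ := by rwa [h.range_eq]
  obtain ⟨s', hs'⟩ : γ s ∈ range γ' := by rwa [h'.range_eq]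
  rw [← h.range_eq]
  rintro _ ⟨t, rfl⟩
  -- Uniqueness is only used forward in time, so a point at time `t` is reached from time `s` after
  -- adding enough periods.
  obtain ⟨n, hn⟩ := exists_nat_gt ((s - t) / T)
  rw [div_lt_iff₀ h.pos] at hn
  have := eqOn_of_isIntegralCurveOn hX (h.shift_isIntegralCurveOn s)
      (h'.shift_isIntegralCurveOn s') (by simp [hs']) (show (0 : ℝ) ≤ t + n * T - s by linarith)
  simp only [sub_add_cancel] at this
  rw [h.periodic.nat_mul n t] at this
  rw [this, ← h'.range_eq]
  exact mem_range_self _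

theorem IsClosedOrbit.eq_of_mem (hX : ContDiff ℝ 1 X) {Γ Γ' : Set (ℝ × ℝ)}
    (h : IsClosedOrbit X Γ) (h' : IsClosedOrbit X Γ') {p : ℝ × ℝ} (hp : p ∈ Γ) (hp' : p ∈ Γ') :
    Γ = Γ' :=
  (h.subset_of_mem hX h' hp hp').antisymm (h'.subset_of_mem hX h hp' hp)

/-- A closed orbit that enters the basin must converge to `Γ`, yet it returns to its starting point
after every period. The distance of this point to `Γ` is therefore zero, and two closed orbits that
meet coincide. -/
theorem IsClosedOrbit.isLimitCycle_of_isAttracting (hX : ContDiff ℝ 1 X) {Γ : Set (ℝ × ℝ)}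
    (h : IsClosedOrbit X Γ) (ha : IsAttracting X Γ) : IsLimitCycle X Γ := by
  obtain ⟨U, hU, hΓU, hat⟩ := ha univ isOpen_univ (subset_univ _)
  refine ⟨h, U, hU, hΓU, fun Γ' h' ⟨p, hpΓ', hpU⟩ => ?_⟩
  refine h'.eq_of_mem hX h hpΓ' ?_
  obtain ⟨γ₀, T₀, h₀⟩ := h
  obtain ⟨γ', T', h'⟩ := h'
  obtain ⟨s, rfl⟩ : p ∈ range γ' := by rwa [h'.range_eq]
  obtain ⟨η, hη0, hη, -, hlim⟩ := hat _ hpU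
  have heq := eqOn_of_isIntegralCurveOn hX (h'.shift_isIntegralCurveOn s) hη (by simp [hη0])
  have hseq : Tendsto (fun n : ℕ => (n : ℝ) * T') atTop atTop :=
    tendsto_natCast_atTop_atTop.atTop_mul_const h'.pos
  have h1 := hlim.comp hseq
  have h2 : (fun t => Metric.infDist (η t) Γ) ∘ (fun n : ℕ => (n : ℝ) * T') =
      fun _ => Metric.infDist (γ' s) Γ := by
    funext n
    have hn : (0 : ℝ) ≤ n * T' := mul_nonneg n.cast_nonneg h'.pos.le
    simp only [Function.comp]
    rw [← heq hn]
    simp only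
    rw [add_comm, h'.periodic.nat_mul n s]
  rw [h2] at h1
  exact (h₀.isCompact.isClosed.mem_iff_infDist_zero h₀.nonempty).2
    (tendsto_nhds_unique tendsto_const_nhds h1)

end ClosedOrbits

/-! ### The Hamiltonian family -/

theorem contDiff_field (ε : ℝ) : ContDiff ℝ 1 (field ε) := by
  unfold field hamField g
  fun_prop

theorem field_zero : field 0 = hamField := by
  funext p; simp [field]

theorem field_apply (ε : ℝ) (p : ℝ × ℝ) : field ε p =
    (-p.2, p.1 ^ 3 + (1 - lam) * p.1 ^ 2 - lam * p.1 + ε * g p) := by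
  simp [field, hamField]

theorem continuous_g : Continuous g := by unfold g; fun_prop

theorem continuous_H : Continuous H := by unfold H; fun_prop

/-- Along the Hamiltonian flow `dx = -y dt`, so `-g dx` pulls back to `y g dt`. -/
theorem IsPeriodParam.curveIntegral_eq {γ : ℝ → ℝ × ℝ} {T : ℝ} {Γ : Set (ℝ × ℝ)}
    (h : IsPeriodParam hamField γ T Γ) :
    curveIntegral ω h.loop = ∫ t in 0..T, (γ t).2 * g (γ t) := by
  rw [curveIntegral_eq_intervalIntegral_deriv]
  have h1 := intervalIntegral.smul_integral_comp_mul_left (a := 0) (b := 1)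
    (fun t => (γ t).2 * g (γ t)) T
  rw [mul_zero, mul_one] at h1
  rw [← h1, ← intervalIntegral.integral_smul]
  refine intervalIntegral.integral_congr_ae ?_
  -- The extended loop is constant beyond `1` and need not be differentiable there, so the end point
  -- is discarded as a null set.
  have hne : ∀ᵐ t : ℝ, t ≠ 1 := by
    simp [MeasureTheory.ae_iff, MeasureTheory.measure_singleton]
  filter_upwards [hne] with t ht1 ht
  rw [uIoc_of_le zero_le_one] at ht
  have htI : t ∈ Ioo (0 : ℝ) 1 := ⟨ht.1, lt_of_le_of_ne ht.2 ht1⟩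
  have hext : h.loop.extend =ᶠ[𝓝 t] fun t => γ (T * t) := by
    filter_upwards [Ioo_mem_nhds htI.1 htI.2] with x hx
    rw [Path.extend_apply _ (Ioo_subset_Icc_self hx)]
    rfl
  have hd : HasDerivAt (fun t => γ (T * t)) (T • hamField (γ (T * t))) t := by
    have := (h.solves (T * t)).scomp t ((hasDerivAt_id t).const_mul T)
    simpa [Function.comp_def] using this
  rw [hext.deriv_eq, hd.deriv, hext.eq_of_nhds]
  simp [ω, hamField]
  ring

theorem hasAbelianIntegral_of_isPeriodParam {γ₀ : ℝ → ℝ × ℝ} {T₀ v : ℝ} {Γ : Set (ℝ × ℝ)}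
    (h₀ : IsPeriodParam hamField γ₀ T₀ Γ) (hv : ∫ t in 0..T₀, (γ₀ t).2 * g (γ₀ t) = v) :
    HasAbelianIntegral Γ v := by
  refine ⟨⟨γ₀, T₀, h₀⟩, fun γ T h => ?_⟩
  rw [h.curveIntegral_eq, ← hv]
  have hX : ContDiff ℝ 1 hamField := field_zero ▸ contDiff_field 0
  obtain ⟨rfl, s, hs⟩ := h.exists_shift hX h₀
  have hper : Function.Periodic (fun t => (γ₀ t).2 * g (γ₀ t)) T := fun t => by
    simp only [h₀.periodic t]
  have h1 : ∫ t in 0..T, (γ t).2 * g (γ t) =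
      ∫ t in 0..T, (fun t => (γ₀ t).2 * g (γ₀ t)) (t + s) := by
    refine intervalIntegral.integral_congr fun t ht => ?_
    rw [uIcc_of_le h.pos.le] at ht
    simp only [hs t ht.1]
  rw [h1, intervalIntegral.integral_comp_add_right (fun t => (γ₀ t).2 * g (γ₀ t)), zero_add, add_comm T s,
    hper.intervalIntegral_add_eq s 0, zero_add]

/-! ### The reversing symmetry -/

/-- The reflection `(x, y) ↦ (x, -y)`. -/
def reflect (p : ℝ × ℝ) : ℝ × ℝ := (p.1, -p.2)

@[simp] theorem reflect_reflect (p : ℝ × ℝ) : reflect (reflect p) = p := by simp [reflect]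

theorem reflect_involutive : Function.Involutive reflect := reflect_reflect

theorem continuous_reflect : Continuous reflect := by unfold reflect; fun_prop

theorem isometry_reflect : Isometry reflect := by
  refine Isometry.of_dist_eq fun p q => ?_
  simp [reflect, Prod.dist_eq]

theorem mem_image_reflect {Γ : Set (ℝ × ℝ)} {p : ℝ × ℝ} : p ∈ reflect '' Γ ↔ reflect p ∈ Γ := by
  rw [reflect_involutive.image_eq_preimage_symm]; rfl

theorem reflect_image_image (Γ : Set (ℝ × ℝ)) : reflect '' (reflect '' Γ) = Γ := by
  ext p; rw [mem_image_reflect, mem_image_reflect, reflect_reflect]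

theorem H_reflect (p : ℝ × ℝ) : H (reflect p) = H p := by simp [H, reflect]

theorem g_reflect (p : ℝ × ℝ) : g (reflect p) = -g p := by simp [g, reflect]; ring

/-- `g` is odd in `y`, so the reflection conjugates `field ε` to the time reversal of `field (-ε)`.
Attracting cycles for one sign of `ε` thus become repelling cycles for the other. -/
theorem field_neg_reflect (ε : ℝ) (p : ℝ × ℝ) :
    field (-ε) (reflect p) = -reflect (field ε p) := by
  rw [field_apply, field_apply, g_reflect]
  simp [reflect]

theorem hasDerivWithinAt_reflect {γ : ℝ → ℝ × ℝ} {w : ℝ × ℝ} {s : Set ℝ} {t : ℝ}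
    (h : HasDerivWithinAt γ w s t) :
    HasDerivWithinAt (fun t => reflect (γ t)) (reflect w) s t := by
  have h1 : HasDerivWithinAt (fun t => (γ t).1) w.1 s t :=
    (hasFDerivAt_fst (𝕜 := ℝ) (p := γ t)).comp_hasDerivWithinAt t h
  have h2 : HasDerivWithinAt (fun t => (γ t).2) w.2 s t :=
    (hasFDerivAt_snd (𝕜 := ℝ) (p := γ t)).comp_hasDerivWithinAt t h
  exact h1.prodMk h2.neg

theorem IsClosedOrbit.reflect {ε : ℝ} {Γ : Set (ℝ × ℝ)} (h : IsClosedOrbit (field ε) Γ) :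
    IsClosedOrbit (field (-ε)) (reflect '' Γ) := by
  obtain ⟨γ, T, h⟩ := h
  refine ⟨fun t => Bifurcation.reflect (γ (-t)), T, h.pos, fun t => ?_, fun t => ?_, ?_, ?_⟩
  · have h1 : HasDerivAt (fun t => γ (-t)) (-field ε (γ (-t))) t := by
      have := (h.solves (-t)).scomp t (hasDerivAt_neg t)
      simpa [Function.comp_def] using this
    have h2 := hasDerivWithinAt_reflect h1.hasDerivWithinAt (s := univ)
    rw [hasDerivWithinAt_univ] at h2
    refine h2.congr_deriv ?_
    simp only [field_neg_reflect]
    simp [Bifurcation.reflect]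
  · rw [neg_add, ← sub_eq_add_neg, h.periodic.sub_eq]
  · intro a ha b hb hab
    obtain ⟨n, hn⟩ := h.exists_eq_zsmul (reflect_involutive.injective hab)
    rw [zsmul_eq_mul] at hn
    have hT := h.pos
    have hn1 : (n : ℝ) < 1 := by
      by_contra hc
      nlinarith [ha.1, ha.2, hb.1, hb.2]
    have hn2 : (-1 : ℝ) < n := by
      by_contra hc
      nlinarith [ha.1, ha.2, hb.1, hb.2]
    have hn0 : n = 0 := by
      have : n < 1 := by exact_mod_cast hn1
      have : -1 < n := by exact_mod_cast hn2
      omega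
    rw [hn0] at hn
    push_cast at hn
    linarith
  · rw [← h.range_eq, ← range_comp]
    have : (fun t => Bifurcation.reflect (γ (-t))) = (Bifurcation.reflect ∘ γ) ∘ Neg.neg := rfl
    rw [this, neg_involutive.surjective.range_comp]

theorem IsLimitCycle.reflect {ε : ℝ} {Γ : Set (ℝ × ℝ)} (h : IsLimitCycle (field ε) Γ) :
    IsLimitCycle (field (-ε)) (reflect '' Γ) := by
  obtain ⟨h, U, hU, hΓU, hiso⟩ := h
  refine ⟨h.reflect, Bifurcation.reflect ⁻¹' U, hU.preimage continuous_reflect, ?_,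
    fun Γ' h' ⟨p, hp, hpU⟩ => ?_⟩
  · rintro _ ⟨p, hp, rfl⟩
    simpa using hΓU hp
  · have h1 := h'.reflect
    rw [neg_neg] at h1
    rw [← hiso _ h1 ⟨Bifurcation.reflect p, mem_image_of_mem _ hp, hpU⟩, reflect_image_image]

theorem IsAttracting.isRepelling_reflect {ε : ℝ} {Γ : Set (ℝ × ℝ)}
    (h : IsAttracting (field ε) Γ) : IsRepelling (field (-ε)) (reflect '' Γ) := by
  intro V hV hΓV
  obtain ⟨U, hU, hΓU, hat⟩ := h (reflect ⁻¹' V) (hV.preimage continuous_reflect)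
    fun p hp => hΓV (mem_image_of_mem _ hp)
  refine ⟨reflect ⁻¹' U, hU.preimage continuous_reflect, ?_, fun p hp => ?_⟩
  · rintro _ ⟨p, hp, rfl⟩
    simpa using hΓU hp
  · obtain ⟨γ, h0, hsol, hin, hlim⟩ := hat _ hp
    refine ⟨fun t => reflect (γ t), by simp [h0], fun t ht => ?_, hin, ?_⟩
    · refine (hasDerivWithinAt_reflect (hsol t ht)).congr_deriv ?_
      simp only [field_neg_reflect, neg_neg]
    · refine hlim.congr fun t => ?_
      rw [Metric.infDist_image isometry_reflect]

/-! ### Polar coordinates adapted to the levels of `H` -/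

/-- The derivative of the potential of `H`. -/
def dV (x : ℝ) : ℝ := x ^ 3 + (1 - lam) * x ^ 2 - lam * x

/-- The derivative of `dV`. -/
def ddV (x : ℝ) : ℝ := 3 * x ^ 2 + 2 * (1 - lam) * x - lam

/-- The derivative of `H` along the field `p ↦ p - (c, 0)`. -/
def radial (c : ℝ) (p : ℝ × ℝ) : ℝ := (p.1 - c) * dV p.1 + p.2 ^ 2

/-- The squared Euclidean distance from `(c, 0)`. -/
def sqDist (c : ℝ) (p : ℝ × ℝ) : ℝ := (p.1 - c) ^ 2 + p.2 ^ 2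

noncomputable def ray (c θ r : ℝ) : ℝ × ℝ := (c + r * Real.cos θ, r * Real.sin θ)

theorem field_eq (ε : ℝ) (p : ℝ × ℝ) : field ε p = (-p.2, dV p.1 + ε * g p) := by
  rw [field_apply, dV]

theorem hamField_eq (p : ℝ × ℝ) : hamField p = (-p.2, dV p.1) := rfl

theorem hasDerivAt_dV (x : ℝ) : HasDerivAt dV (ddV x) x := by
  have := (((hasDerivAt_id x).pow 3).add (((hasDerivAt_id x).pow 2).const_mul (1 - lam))).sub
    ((hasDerivAt_id x).const_mul lam)
  refine this.congr_deriv ?_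
  simp [ddV]; ring

theorem hasDerivAt_H_comp {γ : ℝ → ℝ × ℝ} {w : ℝ × ℝ} {t : ℝ} (h : HasDerivAt γ w t) :
    HasDerivAt (fun t => H (γ t)) (dV (γ t).1 * w.1 + (γ t).2 * w.2) t := by
  have h1 : HasDerivAt (fun t => (γ t).1) w.1 t :=
    (hasFDerivAt_fst (𝕜 := ℝ) (p := γ t)).comp_hasDerivAt t h
  have h2 : HasDerivAt (fun t => (γ t).2) w.2 t :=
    (hasFDerivAt_snd (𝕜 := ℝ) (p := γ t)).comp_hasDerivAt t h
  have := ((((h2.pow 2).div_const 2).add ((h1.pow 4).div_const 4)).add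
    ((h1.pow 3).const_mul ((1 - lam) / 3))).sub ((h1.pow 2).const_mul (lam / 2))
  refine this.congr_deriv ?_
  simp [dV]; ring

theorem hasDerivAt_ray (c θ r : ℝ) :
    HasDerivAt (ray c θ) (Real.cos θ, Real.sin θ) r := by
  have h1 : HasDerivAt (fun r : ℝ => c + r * Real.cos θ) (Real.cos θ) r := by
    simpa using ((hasDerivAt_id r).mul_const (Real.cos θ)).const_add c
  have h2 : HasDerivAt (fun r : ℝ => r * Real.sin θ) (Real.sin θ) r := by
    simpa using (hasDerivAt_id r).mul_const (Real.sin θ)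
  exact h1.prodMk h2

theorem sqDist_ray (c θ r : ℝ) : sqDist c (ray c θ r) = r ^ 2 := by
  simp only [sqDist, ray, add_sub_cancel_left]
  nlinarith [Real.sin_sq_add_cos_sq θ]

/-- Where `radial` is positive, `H` increases along the rays; this makes the level curves graphs
over the angle. -/
theorem hasDerivAt_H_ray (c θ : ℝ) {r : ℝ} (hr : r ≠ 0) :
    HasDerivAt (fun r => H (ray c θ r)) (radial c (ray c θ r) / r) r := by
  refine (hasDerivAt_H_comp (hasDerivAt_ray c θ r)).congr_deriv ?_
  simp only [radial, ray, add_sub_cancel_left]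
  field_simp

theorem ray_add_two_pi (c θ r : ℝ) : ray c (θ + 2 * Real.pi) r = ray c θ r := by simp [ray]

theorem exists_ray_eq (c : ℝ) {p : ℝ × ℝ} (hp : 0 < sqDist c p) :
    ∃ θ, ∃ r > 0, ray c θ r = p := by
  have hne : (⟨p.1 - c, p.2⟩ : ℂ) ≠ 0 := by
    intro h
    have h1 := congrArg Complex.re h
    have h2 := congrArg Complex.im h
    simp only [Complex.zero_re, Complex.zero_im] at h1 h2
    simp [sqDist, h1, h2] at hp
  refine ⟨Complex.arg ⟨p.1 - c, p.2⟩, ‖(⟨p.1 - c, p.2⟩ : ℂ)‖, norm_pos_iff.2 hne, ?_⟩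
  simp [ray, Complex.norm_mul_cos_arg, Complex.norm_mul_sin_arg]

/-- The levels `h ∈ (a, b)` of `H` in `S` are graphs in polar coordinates about `(c, 0)`. -/
structure IsPolarAnnulus (c : ℝ) (S : Set (ℝ × ℝ)) (a b : ℝ) : Prop where
  isOpen : IsOpen S
  exists_ray : ∀ θ, ∀ h ∈ Ioo a b, ∃ r > 0, ray c θ r ∈ S ∧ H (ray c θ r) = h
  unique : ∀ θ r s, 0 < r → 0 < s → ray c θ r ∈ S → ray c θ s ∈ S →
    H (ray c θ r) = H (ray c θ s) → H (ray c θ r) ∈ Ioo a b → r = s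
  radial_pos : ∀ p ∈ S, H p ∈ Ioo a b → 0 < radial c p

/-- The polar radius of the level `h` of `H` in the direction `θ`. -/
noncomputable def rho (c : ℝ) (S : Set (ℝ × ℝ)) (θ h : ℝ) : ℝ :=
  Classical.epsilon fun r => 0 < r ∧ ray c θ r ∈ S ∧ H (ray c θ r) = h

/-- The point of the level `h` of `H` in the direction `θ`. -/
noncomputable def pt (c : ℝ) (S : Set (ℝ × ℝ)) (θ h : ℝ) : ℝ × ℝ := ray c θ (rho c S θ h)

theorem rho_periodic (c : ℝ) (S : Set (ℝ × ℝ)) (h : ℝ) :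
    Function.Periodic (fun θ => rho c S θ h) (2 * Real.pi) := fun θ => by
  simp only [rho, ray_add_two_pi]

theorem pt_periodic (c : ℝ) (S : Set (ℝ × ℝ)) (h : ℝ) :
    Function.Periodic (fun θ => pt c S θ h) (2 * Real.pi) := fun θ => by
  have := rho_periodic c S h θ
  simp only at this
  simp only [pt, ray_add_two_pi, this]

namespace IsPolarAnnulus

variable {c a b : ℝ} {S : Set (ℝ × ℝ)}

theorem rho_spec (hA : IsPolarAnnulus c S a b) (θ : ℝ) {h : ℝ} (hh : h ∈ Ioo a b) :
    0 < rho c S θ h ∧ pt c S θ h ∈ S ∧ H (pt c S θ h) = h := by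
  obtain ⟨r, hr⟩ := hA.exists_ray θ h hh
  exact Classical.epsilon_spec (p := fun r => 0 < r ∧ ray c θ r ∈ S ∧ H (ray c θ r) = h) ⟨r, hr⟩

theorem rho_eq (hA : IsPolarAnnulus c S a b) {θ r : ℝ} (hr : 0 < r) (hS : ray c θ r ∈ S) (hH : H (ray c θ r) ∈ Ioo a b) :
    rho c S θ (H (ray c θ r)) = r := by
  obtain ⟨h1, h2, h3⟩ := hA.rho_spec θ hH
  exact hA.unique θ _ _ h1 hr h2 hS h3 (h3.symm ▸ hH)

theorem radial_pt_pos (hA : IsPolarAnnulus c S a b) (θ : ℝ) {h : ℝ} (hh : h ∈ Ioo a b) : 0 < radial c (pt c S θ h) := by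
  obtain ⟨-, h2, h3⟩ := hA.rho_spec θ hh
  exact hA.radial_pos _ h2 (h3.symm ▸ hh)

theorem sqDist_pt_pos (hA : IsPolarAnnulus c S a b) (θ : ℝ) {h : ℝ} (hh : h ∈ Ioo a b) : 0 < sqDist c (pt c S θ h) := by
  rw [pt, sqDist_ray]
  exact pow_pos (hA.rho_spec θ hh).1 2

theorem exists_pt_eq (hA : IsPolarAnnulus c S a b) {p : ℝ × ℝ} (hS : p ∈ S) (hH : H p ∈ Ioo a b) :
    ∃ θ, pt c S θ (H p) = p := by
  have hpos : 0 < sqDist c p := by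
    have h1 := hA.radial_pos p hS hH
    have h2 : 0 ≤ sqDist c p := by unfold sqDist; positivity
    refine lt_of_le_of_ne h2 fun h0 => ?_
    have hx : p.1 - c = 0 := by
      unfold sqDist at h0; nlinarith [sq_nonneg (p.1 - c), sq_nonneg p.2]
    have hy : p.2 = 0 := by
      unfold sqDist at h0; nlinarith [sq_nonneg (p.1 - c), sq_nonneg p.2]
    simp [radial, hx, hy] at h1
  obtain ⟨θ, r, hr, rfl⟩ := exists_ray_eq c hpos
  exact ⟨θ, by rw [pt, hA.rho_eq hr hS hH]⟩

theorem pt_injOn (hA : IsPolarAnnulus c S a b) {θ θ' h h' : ℝ} (hh : h ∈ Ioo a b) (hh' : h' ∈ Ioo a b)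
    (heq : pt c S θ h = pt c S θ' h') :
    Real.cos θ = Real.cos θ' ∧ Real.sin θ = Real.sin θ' ∧ h = h' := by
  obtain ⟨h1, -, h3⟩ := hA.rho_spec θ hh
  obtain ⟨h1', -, h3'⟩ := hA.rho_spec θ' hh'
  have e : rho c S θ h = rho c S θ' h' := by
    have := congrArg (sqDist c) heq
    rw [pt, pt, sqDist_ray, sqDist_ray] at this
    exact (pow_left_inj₀ h1.le h1'.le two_ne_zero).1 this
  simp only [pt, ray, e, Prod.mk.injEq, add_right_inj] at heq
  refine ⟨mul_left_cancel₀ h1'.ne' heq.1, mul_left_cancel₀ h1'.ne' heq.2, ?_⟩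
  rw [← h3, ← h3', pt, pt, ray, ray, e]
  congr 1
  simp only [heq.1, heq.2]

/-- The inverse function theorem for `(θ, r) ↦ (θ, H (ray c θ r))`, whose `r`-derivative `radial /
r` does not vanish. Although `rho` is defined by a choice, uniqueness of the radius in `S`
identifies it near `(θ, h)` with a component of the local inverse. -/
theorem differentiableAt_rho (hA : IsPolarAnnulus c S a b) (θ : ℝ) {h : ℝ} (hh : h ∈ Ioo a b) :
    DifferentiableAt ℝ (fun q : ℝ × ℝ => rho c S q.1 q.2) (θ, h) := by
  obtain ⟨hr, hS, hH⟩ := hA.rho_spec θ hh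
  set r := rho c S θ h with hrdef
  have hN : 0 < radial c (ray c θ r) := hA.radial_pt_pos θ hh
  have hray : Continuous fun q : ℝ × ℝ => ray c q.1 q.2 := by unfold ray; fun_prop
  set φ : ℝ × ℝ → ℝ := fun q => H (ray c q.1 q.2) with hφ
  have hφd : ContDiff ℝ 1 φ := by
    simp only [hφ, H, ray]
    fun_prop
  have hφs : HasStrictFDerivAt φ (fderiv ℝ φ (θ, r)) (θ, r) :=
    hφd.contDiffAt.hasStrictFDerivAt one_ne_zero
  set D := fderiv ℝ φ (θ, r) with hD
  have hDr : D (0, 1) = radial c (ray c θ r) / r := by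
    have h1 : HasDerivAt (fun s => φ (θ, s)) (D (0, 1)) r :=
      hφs.hasFDerivAt.comp_hasDerivAt r ((hasDerivAt_const r θ).prodMk (hasDerivAt_id r))
    exact h1.unique (hasDerivAt_H_ray c θ hr.ne')
  have hq : D (0, 1) ≠ 0 := by rw [hDr]; positivity
  have hDlin : ∀ u v : ℝ, D (u, v) = u * D (1, 0) + v * D (0, 1) := fun u v => by
    have : ((u, v) : ℝ × ℝ) = u • (1, 0) + v • (0, 1) := by simp
    rw [this, map_add, map_smul, map_smul, smul_eq_mul, smul_eq_mul]
  let L : (ℝ × ℝ) →L[ℝ] ℝ × ℝ := (ContinuousLinearMap.fst ℝ ℝ ℝ).prod D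
  let L' : (ℝ × ℝ) →L[ℝ] ℝ × ℝ := (ContinuousLinearMap.fst ℝ ℝ ℝ).prod
    ((D (0, 1))⁻¹ • (ContinuousLinearMap.snd ℝ ℝ ℝ - D (1, 0) • ContinuousLinearMap.fst ℝ ℝ ℝ))
  let e : (ℝ × ℝ) ≃L[ℝ] ℝ × ℝ := ContinuousLinearEquiv.equivOfInverse L L'
    (fun ⟨u, v⟩ => by
      simp only [L, L', ContinuousLinearMap.prod_apply, ContinuousLinearMap.coe_fst',
        FunLike.coe_smul, FunLike.coe_sub, Pi.smul_apply, Pi.sub_apply,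
        ContinuousLinearMap.coe_snd', smul_eq_mul, hDlin u v]
      congr 1; field_simp; ring)
    (fun ⟨u, v⟩ => by
      simp only [L, L', ContinuousLinearMap.prod_apply, ContinuousLinearMap.coe_fst',
        FunLike.coe_smul, FunLike.coe_sub, Pi.smul_apply, Pi.sub_apply,
        ContinuousLinearMap.coe_snd', smul_eq_mul]
      rw [hDlin]
      congr 1; field_simp; ring)
  have hΨ : HasStrictFDerivAt (fun q : ℝ × ℝ => (q.1, φ q)) (e : (ℝ × ℝ) →L[ℝ] ℝ × ℝ) (θ, r) :=
    hasStrictFDerivAt_fst.prodMk hφs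
  have hφh : φ (θ, r) = h := hH
  have hinv := hΨ.to_localInverse
  have hright := hΨ.eventually_right_inverse
  have hval := hΨ.localInverse_apply_image
  set G := hΨ.localInverse _ _ _ with hG
  simp only [hφh] at hinv hright hval
  have hGc : ContinuousAt G (θ, h) := hinv.continuousAt
  have hG2 : Tendsto (fun y => (G y).2) (𝓝 (θ, h)) (𝓝 r) := by
    have : Tendsto (fun y => (G y).2) (𝓝 (θ, h)) (𝓝 (G (θ, h)).2) :=
      (continuous_snd.tendsto _).comp hGc
    rwa [hval] at this
  have hG3 : Tendsto (fun y : ℝ × ℝ => ray c y.1 (G y).2) (𝓝 (θ, h)) (𝓝 (ray c θ r)) :=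
    (hray.tendsto (θ, r)).comp ((continuous_fst.tendsto _).prodMk_nhds hG2)
  have hev : (fun q : ℝ × ℝ => rho c S q.1 q.2) =ᶠ[𝓝 (θ, h)] fun q => (G q).2 := by
    filter_upwards [hright, hG2.eventually (lt_mem_nhds hr), hG3.eventually (hA.isOpen.mem_nhds hS),
      (continuous_snd.tendsto (θ, h)).eventually (isOpen_Ioo.mem_nhds hh)] with y h1 h2 h3 h4
    have h1' : ((G y).1, φ (G y)) = y := h1
    have e1 : (G y).1 = y.1 := (Prod.ext_iff.1 h1').1
    have e2 : H (ray c y.1 (G y).2) = y.2 := by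
      have := (Prod.ext_iff.1 h1').2
      simpa only [hφ, e1] using this
    have h5 := hA.rho_eq h2 h3 (e2.symm ▸ h4)
    rwa [e2] at h5
  have hd : DifferentiableAt ℝ (fun q => (G q).2) (θ, h) :=
    hinv.hasFDerivAt.differentiableAt.snd
  exact hd.congr_of_eventuallyEq hev

/-- The hypotheses say that the angle and the value of `H` change as they would under the velocity
`X`. A vector is determined by its angular momentum about `(c, 0)` and its image under `dH`, since
the determinant of these two forms is `radial` up to sign. -/
theorem hasDerivAt_pt (hA : IsPolarAnnulus c S a b) {Θ u : ℝ → ℝ} {t : ℝ} (hut : u t ∈ Ioo a b) {X : ℝ × ℝ}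
    (hΘ : HasDerivAt Θ ((((pt c S (Θ t) (u t)).1 - c) * X.2 - (pt c S (Θ t) (u t)).2 * X.1) /
      sqDist c (pt c S (Θ t) (u t))) t)
    (hu : HasDerivAt u (dV (pt c S (Θ t) (u t)).1 * X.1 + (pt c S (Θ t) (u t)).2 * X.2) t) :
    HasDerivAt (fun s => pt c S (Θ s) (u s)) X t := by
  have hN := hA.radial_pt_pos (Θ t) hut
  have hR := hA.sqDist_pt_pos (Θ t) hut
  obtain ⟨r', hrd⟩ : ∃ r', HasDerivAt (fun s => rho c S (Θ s) (u s)) r' t :=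
    ⟨_, HasFDerivAt.comp_hasDerivAt (f := fun s => (Θ s, u s))
      (l := fun q : ℝ × ℝ => rho c S q.1 q.2) t
      (hA.differentiableAt_rho (Θ t) hut).hasFDerivAt (hΘ.prodMk hu)⟩
  set w := (((pt c S (Θ t) (u t)).1 - c) * X.2 - (pt c S (Θ t) (u t)).2 * X.1) /
      sqDist c (pt c S (Θ t) (u t)) with hw
  have h1 := (hrd.mul hΘ.cos).const_add c
  have h2 := hrd.mul hΘ.sin
  have hp : HasDerivAt (fun s => pt c S (Θ s) (u s)) _ t := h1.prodMk h2
  have hHd := hasDerivAt_H_comp hp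
  have hHu : HasDerivAt (fun s => H (pt c S (Θ s) (u s)))
      (dV (pt c S (Θ t) (u t)).1 * X.1 + (pt c S (Θ t) (u t)).2 * X.2) t := by
    refine hu.congr_of_eventuallyEq ?_
    filter_upwards [hu.continuousAt.eventually (isOpen_Ioo.mem_nhds hut)] with s hs
    exact (hA.rho_spec (Θ s) hs).2.2
  have hE := hHd.unique hHu
  refine hp.congr_deriv ?_
  set p := pt c S (Θ t) (u t) with hpd
  have hx : p.1 - c = rho c S (Θ t) (u t) * Real.cos (Θ t) := by simp [hpd, pt, ray]
  have hy : p.2 = rho c S (Θ t) (u t) * Real.sin (Θ t) := by simp [hpd, pt, ray]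
  have hRr : sqDist c p = (rho c S (Θ t) (u t)) ^ 2 := by rw [hpd, pt, sqDist_ray]
  have hww : w * sqDist c p = (p.1 - c) * X.2 - p.2 * X.1 := by
    rw [hw]; field_simp
  simp only at hE
  set A := r' * Real.cos (Θ t) + rho c S (Θ t) (u t) * (-Real.sin (Θ t) * w) with hAd
  set B := r' * Real.sin (Θ t) + rho c S (Θ t) (u t) * (Real.cos (Θ t) * w) with hBd
  have hAB : (p.1 - c) * B - p.2 * A = (p.1 - c) * X.2 - p.2 * X.1 := by
    rw [← hww, hRr, hx, hy, hAd, hBd]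
    linear_combination (rho c S (Θ t) (u t)) ^ 2 * w * Real.sin_sq_add_cos_sq (Θ t)
  have hN' : (p.1 - c) * dV p.1 + p.2 ^ 2 ≠ 0 := hN.ne'
  have e1 : A = X.1 := by
    refine mul_left_cancel₀ hN' ?_
    linear_combination (p.1 - c) * hE - p.2 * hAB
  have e2 : B = X.2 := by
    refine mul_left_cancel₀ hN' ?_
    linear_combination p.2 * hE + dV p.1 * hAB
  exact Prod.ext e1 e2

theorem continuousOn_pt (hA : IsPolarAnnulus c S a b) :
    ContinuousOn (fun q : ℝ × ℝ => pt c S q.1 q.2) (univ ×ˢ Ioo a b) := by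
  have hray : Continuous fun q : ℝ × ℝ => ray c q.1 q.2 := by unfold ray; fun_prop
  have hrho : ContinuousOn (fun q : ℝ × ℝ => rho c S q.1 q.2) (univ ×ˢ Ioo a b) := fun q hq =>
    (hA.differentiableAt_rho q.1 hq.2).continuousAt.continuousWithinAt
  exact hray.comp_continuousOn (continuousOn_fst.prodMk hrho)

end IsPolarAnnulus

/-! ### The averaged equation -/

/-- The derivative `∂g/∂y`, that is, the divergence of the perturbation. -/
noncomputable def divg (p : ℝ × ℝ) : ℝ := α + β * p.1 + γ * p.1 ^ 2 + δ * p.2 ^ 2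

/-- The derivative of `g` along `p ↦ p - (c, 0)`. -/
noncomputable def gEuler (c : ℝ) (p : ℝ × ℝ) : ℝ :=
  (p.1 - c) * ((β + 2 * γ * p.1) * p.2) + p.2 * divg p

/-- The angular momentum about `(c, 0)` of `field e`. -/
noncomputable def den (c e : ℝ) (p : ℝ × ℝ) : ℝ := radial c p + e * ((p.1 - c) * g p)

/-- The derivative of `den c e` along `p ↦ p - (c, 0)`. -/
noncomputable def denEuler (c e : ℝ) (p : ℝ × ℝ) : ℝ :=
  (p.1 - c) * dV p.1 + (p.1 - c) ^ 2 * ddV p.1 + 2 * p.2 ^ 2 +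
    e * ((p.1 - c) * g p + (p.1 - c) * gEuler c p)

/-- The solutions of `field e` satisfy `dH/dθ = e * avg c e`. -/
noncomputable def avg (c e : ℝ) (p : ℝ × ℝ) : ℝ := p.2 * g p * sqDist c p / den c e p

/-- The derivative of `avg c e` with respect to the level of `H` on the rays from `(c, 0)`. -/
noncomputable def avgDeriv (c e : ℝ) (p : ℝ × ℝ) : ℝ :=
  ((3 * (p.2 * g p) + p.2 * gEuler c p) * sqDist c p / den c e p -
    p.2 * g p * sqDist c p * denEuler c e p / den c e p ^ 2) / radial c p

theorem den_zero (c : ℝ) (p : ℝ × ℝ) : den c 0 p = radial c p := by simp [den]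

theorem continuous_dV : Continuous dV := by unfold dV; fun_prop

theorem continuous_sqDist (c : ℝ) : Continuous (sqDist c) := by unfold sqDist; fun_prop

theorem continuous_radial (c : ℝ) : Continuous (radial c) := by
  have := continuous_dV
  unfold radial; fun_prop

theorem continuous_divg : Continuous divg := by unfold divg; fun_prop

theorem continuous_den (c : ℝ) : Continuous fun q : ℝ × ℝ × ℝ => den c q.1 q.2 := by
  have := continuous_radial c
  have := continuous_g
  unfold den; fun_prop

theorem continuousOn_avg (c : ℝ) :
    ContinuousOn (fun q : ℝ × ℝ × ℝ => avg c q.1 q.2) {q | den c q.1 q.2 ≠ 0} := by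
  have := continuous_g
  have := continuous_sqDist c
  unfold avg
  exact ContinuousOn.div (by fun_prop) (continuous_den c).continuousOn fun q hq => hq

theorem continuousOn_avgDeriv (c : ℝ) : ContinuousOn (fun q : ℝ × ℝ × ℝ => avgDeriv c q.1 q.2)
    {q | den c q.1 q.2 ≠ 0 ∧ radial c q.2 ≠ 0} := by
  have h1 := continuous_g
  have h2 := continuous_sqDist c
  have h3 := continuous_divg
  have h4 := continuous_dV
  have h5 : Continuous ddV := by unfold ddV; fun_prop
  have h6 : Continuous (gEuler c) := by unfold gEuler; fun_prop
  have h7 : Continuous fun q : ℝ × ℝ × ℝ => denEuler c q.1 q.2 := by unfold denEuler; fun_prop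
  have hr : Continuous fun q : ℝ × ℝ × ℝ => radial c q.2 :=
    (continuous_radial c).comp continuous_snd
  unfold avgDeriv
  refine ContinuousOn.div (ContinuousOn.sub ?_ ?_) hr.continuousOn fun q hq => hq.2
  · exact ContinuousOn.div (by fun_prop) (continuous_den c).continuousOn fun q hq => hq.1
  · exact ContinuousOn.div (by fun_prop) ((continuous_den c).pow 2).continuousOn
      fun q hq => pow_ne_zero 2 hq.1

theorem hasDerivAt_g_comp {f : ℝ → ℝ × ℝ} {w : ℝ × ℝ} {t : ℝ} (h : HasDerivAt f w t) :
    HasDerivAt (fun t => g (f t))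
      ((β + 2 * γ * (f t).1) * (f t).2 * w.1 + divg (f t) * w.2) t := by
  have h1 : HasDerivAt (fun t => (f t).1) w.1 t :=
    (hasFDerivAt_fst (𝕜 := ℝ) (p := f t)).comp_hasDerivAt t h
  have h2 : HasDerivAt (fun t => (f t).2) w.2 t :=
    (hasFDerivAt_snd (𝕜 := ℝ) (p := f t)).comp_hasDerivAt t h
  have := ((((h1.const_mul β).const_add α).add ((h1.pow 2).const_mul γ)).mul h2).add
    (((h2.pow 3).div_const 3).const_mul δ)
  refine this.congr_deriv ?_
  simp [divg]; ring

theorem hasDerivAt_radial_comp (c : ℝ) {f : ℝ → ℝ × ℝ} {w : ℝ × ℝ} {t : ℝ}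
    (h : HasDerivAt f w t) :
    HasDerivAt (fun t => radial c (f t))
      ((dV (f t).1 + ((f t).1 - c) * ddV (f t).1) * w.1 + 2 * (f t).2 * w.2) t := by
  have h1 : HasDerivAt (fun t => (f t).1) w.1 t :=
    (hasFDerivAt_fst (𝕜 := ℝ) (p := f t)).comp_hasDerivAt t h
  have h2 : HasDerivAt (fun t => (f t).2) w.2 t :=
    (hasFDerivAt_snd (𝕜 := ℝ) (p := f t)).comp_hasDerivAt t h
  have h3 : HasDerivAt (fun t => dV (f t).1) (ddV (f t).1 * w.1) t :=
    HasDerivAt.comp (h₂ := dV) (h := fun t => (f t).1) t (hasDerivAt_dV (f t).1) h1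
  refine (((h1.sub_const c).mul h3).add (h2.pow 2)).congr_deriv ?_
  simp; ring

namespace IsPolarAnnulus

variable {c a b : ℝ} {S : Set (ℝ × ℝ)}

theorem hasDerivAt_pt_level (hA : IsPolarAnnulus c S a b) (θ : ℝ) {h : ℝ} (hh : h ∈ Ioo a b) :
    HasDerivAt (fun h => pt c S θ h) (((pt c S θ h).1 - c) / radial c (pt c S θ h),
      (pt c S θ h).2 / radial c (pt c S θ h)) h := by
  have hN := hA.radial_pt_pos θ hh
  refine hA.hasDerivAt_pt (Θ := fun _ => θ) (u := fun h => h) hh ?_ ?_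
  · refine (hasDerivAt_const h θ).congr_deriv ?_
    simp only
    rw [eq_comm, div_eq_zero_iff]
    left; ring
  · refine (hasDerivAt_id h).congr_deriv ?_
    simp only
    rw [eq_comm, mul_div_assoc', mul_div_assoc', ← add_div, div_eq_one_iff_eq hN.ne', radial]
    ring

/-- With `H` fixed the point moves along the Hamiltonian flow; the factor `sqDist / radial` is `dt /
dθ` for that flow, and it is the weight in all the integrals below. -/
theorem hasDerivAt_pt_angle (hA : IsPolarAnnulus c S a b) (θ : ℝ) {h : ℝ} (hh : h ∈ Ioo a b) :
    HasDerivAt (fun θ => pt c S θ h)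
      ((sqDist c (pt c S θ h) / radial c (pt c S θ h)) • hamField (pt c S θ h)) θ := by
  have hN := hA.radial_pt_pos θ hh
  have hR := hA.sqDist_pt_pos θ hh
  refine hA.hasDerivAt_pt (Θ := fun θ => θ) (u := fun _ => h) hh ?_ ?_
  · refine (hasDerivAt_id θ).congr_deriv ?_
    rw [hamField_eq]
    simp only [Prod.smul_mk, smul_eq_mul]
    rw [eq_comm, div_eq_one_iff_eq hR.ne']
    rw [div_mul_eq_mul_div, div_mul_eq_mul_div, mul_div_assoc', mul_div_assoc', ← sub_div,
      div_eq_iff hN.ne', radial]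
    ring
  · refine (hasDerivAt_const θ h).congr_deriv ?_
    rw [hamField_eq]
    simp only [Prod.smul_mk, smul_eq_mul]
    ring

theorem hasDerivAt_avg (hA : IsPolarAnnulus c S a b) (e θ : ℝ) {h : ℝ} (hh : h ∈ Ioo a b)
    (hM : den c e (pt c S θ h) ≠ 0) :
    HasDerivAt (fun h => avg c e (pt c S θ h)) (avgDeriv c e (pt c S θ h)) h := by
  have hN := (hA.radial_pt_pos θ hh).ne'
  have hp := hA.hasDerivAt_pt_level θ hh
  have h1 : HasDerivAt (fun h => (pt c S θ h).1) (((pt c S θ h).1 - c) / radial c (pt c S θ h)) h :=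
    (hasFDerivAt_fst (𝕜 := ℝ) (p := pt c S θ h)).comp_hasDerivAt h hp
  have h2 : HasDerivAt (fun h => (pt c S θ h).2) ((pt c S θ h).2 / radial c (pt c S θ h)) h :=
    (hasFDerivAt_snd (𝕜 := ℝ) (p := pt c S θ h)).comp_hasDerivAt h hp
  have hg := hasDerivAt_g_comp hp
  have hr := hasDerivAt_radial_comp c hp
  have hnum := (h2.mul hg).mul (((h1.sub_const c).pow 2).add (h2.pow 2))
  have hden := hr.add (((h1.sub_const c).mul hg).const_mul e)
  refine (hnum.div hden hM).congr_deriv ?_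
  have hM' : radial c (pt c S θ h) + e * (((pt c S θ h).1 - c) * g (pt c S θ h)) ≠ 0 := hM
  simp only [avgDeriv, gEuler, den, denEuler, sqDist, Pi.add_apply, Pi.mul_apply, Pi.pow_apply]
  set p := pt c S θ h
  generalize radial c p = N at *
  generalize g p = G at *
  generalize divg p = D
  generalize dV p.1 = V1
  generalize ddV p.1 = V2
  generalize hu : p.1 - c = u at *
  have hx : p.1 = u + c := by linarith
  rw [hx]
  generalize p.2 = y
  push_cast
  field_simp
  ring

theorem continuousOn_pt_angle (hA : IsPolarAnnulus c S a b) {h : ℝ} (hh : h ∈ Ioo a b) :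
    Continuous fun θ => pt c S θ h :=
  continuous_iff_continuousAt.2 fun θ => (hA.hasDerivAt_pt_angle θ hh).continuousAt

theorem continuous_comp_mul_sqDist_div (hA : IsPolarAnnulus c S a b) {h : ℝ} (hh : h ∈ Ioo a b)
    {f : ℝ × ℝ → ℝ} (hf : Continuous f) :
    Continuous fun θ => f (pt c S θ h) * (sqDist c (pt c S θ h) / radial c (pt c S θ h)) := by
  have hp := hA.continuousOn_pt_angle hh
  exact (hf.comp hp).mul (((continuous_sqDist c).comp hp).div ((continuous_radial c).comp hp)
    fun θ => (hA.radial_pt_pos θ hh).ne')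

theorem integral_derivative_eq_zero (c : ℝ) (S : Set (ℝ × ℝ)) (h : ℝ) {W : ℝ × ℝ → ℝ} {f' : ℝ → ℝ} (hW : ∀ θ, HasDerivAt (fun θ => W (pt c S θ h)) (f' θ) θ)
    (hc : Continuous f') : ∫ θ in 0..2 * Real.pi, f' θ = 0 := by
  rw [intervalIntegral.integral_eq_sub_of_hasDerivAt (fun θ _ => hW θ) (hc.intervalIntegrable _ _)]
  have := pt_periodic c S h 0
  simp only [zero_add] at this
  rw [this, sub_self]

/-- The exact form `d(y w(x))` integrates to zero over a level. -/
theorem integral_exact_eq_zero (hA : IsPolarAnnulus c S a b) {h : ℝ} (hh : h ∈ Ioo a b)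
    {w w' : ℝ → ℝ} (hw : ∀ x, HasDerivAt w (w' x) x) (hc : Continuous w') :
    ∫ θ in 0..2 * Real.pi, (dV (pt c S θ h).1 * w (pt c S θ h).1 -
      (pt c S θ h).2 ^ 2 * w' (pt c S θ h).1) *
        (sqDist c (pt c S θ h) / radial c (pt c S θ h)) = 0 := by
  have hwc : Continuous w := continuous_iff_continuousAt.2 fun x => (hw x).continuousAt
  have hdV := continuous_dV
  refine integral_derivative_eq_zero c S h (W := fun p => p.2 * w p.1) (fun θ => ?_)
    (hA.continuous_comp_mul_sqDist_div hh (f := fun p => dV p.1 * w p.1 - p.2 ^ 2 * w' p.1)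
      (by fun_prop))
  have hp := hA.hasDerivAt_pt_angle θ hh
  have h1 := (hasFDerivAt_fst (𝕜 := ℝ) (p := pt c S θ h)).comp_hasDerivAt θ hp
  have h2 := (hasFDerivAt_snd (𝕜 := ℝ) (p := pt c S θ h)).comp_hasDerivAt θ hp
  refine (h2.mul ((hw _).comp θ h1)).congr_deriv ?_
  simp [hamField_eq]
  ring

/-- The derivative of the averaged function is the integral of the divergence. -/
theorem integral_avgDeriv (hA : IsPolarAnnulus c S a b) {h : ℝ} (hh : h ∈ Ioo a b) :
    ∫ θ in 0..2 * Real.pi, avgDeriv c 0 (pt c S θ h) =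
      ∫ θ in 0..2 * Real.pi, divg (pt c S θ h) *
        (sqDist c (pt c S θ h) / radial c (pt c S θ h)) := by
  have hp := hA.continuousOn_pt_angle hh
  have hdc := hA.continuous_comp_mul_sqDist_div hh continuous_divg
  have hac : Continuous fun θ => avgDeriv c 0 (pt c S θ h) := by
    have := (continuousOn_avgDeriv c).comp_continuous (continuous_const.prodMk hp)
      (f := fun θ => ((0 : ℝ), pt c S θ h)) fun θ => by
        have := (hA.radial_pt_pos θ hh).ne'
        exact ⟨by rwa [den_zero], this⟩
    exact this
  -- Differentiating `avg c 0` along the rays does not give the weighted divergence pointwise. The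
  -- difference is the `θ`-derivative of `(x - c) g / radial`, which drops out over a turn.
  have h0 := integral_derivative_eq_zero c S h
    (W := fun p => (p.1 - c) * g p / radial c p)
    (f' := fun θ => divg (pt c S θ h) * (sqDist c (pt c S θ h) / radial c (pt c S θ h)) -
      avgDeriv c 0 (pt c S θ h)) (fun θ => ?_) (hdc.sub hac)
  · rw [intervalIntegral.integral_sub (hdc.intervalIntegrable _ _) (hac.intervalIntegrable _ _),
      sub_eq_zero] at h0
    exact h0.symm
  have hN := (hA.radial_pt_pos θ hh).ne'
  have hpd := hA.hasDerivAt_pt_angle θ hh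
  have h1 : HasDerivAt (fun θ => (pt c S θ h).1) _ θ :=
    (hasFDerivAt_fst (𝕜 := ℝ) (p := pt c S θ h)).comp_hasDerivAt θ hpd
  refine (((h1.sub_const c).mul (hasDerivAt_g_comp hpd)).div (hasDerivAt_radial_comp c hpd)
    hN).congr_deriv ?_
  simp only [avgDeriv, gEuler, den_zero, denEuler, hamField_eq, Prod.smul_mk, smul_eq_mul,
    ContinuousLinearMap.coe_fst', Pi.mul_apply]
  set p := pt c S θ h
  have hNd : radial c p = (p.1 - c) * dV p.1 + p.2 ^ 2 := rfl
  have hRd : sqDist c p = (p.1 - c) ^ 2 + p.2 ^ 2 := rfl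
  rw [hNd] at hN ⊢
  generalize sqDist c p = R
  generalize g p = G at *
  generalize divg p = D
  generalize dV p.1 = V1 at *
  generalize ddV p.1 = V2
  generalize hu : p.1 - c = u at *
  have hx : p.1 = u + c := by linarith
  rw [hx]
  generalize p.2 = y at *
  field_simp
  ring

end IsPolarAnnulus

/-! ### Orbits of the perturbed field in polar coordinates -/

/-- The part of `S` between two levels of `H`. -/
def band (S : Set (ℝ × ℝ)) (a b : ℝ) : Set (ℝ × ℝ) := {p | p ∈ S ∧ H p ∈ Icc a b}

/-- The closed curve with equation `H = u(θ)` in polar coordinates. -/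
def polarGraph (c : ℝ) (S : Set (ℝ × ℝ)) (u : ℝ → ℝ) : Set (ℝ × ℝ) :=
  range fun θ => pt c S θ (u θ)

/-- A periodic function of the polar angle is a continuous function on the punctured plane. -/
theorem exists_angular_function (c : ℝ) {u : ℝ → ℝ} (hu : Continuous u)
    (hper : Function.Periodic u (2 * Real.pi)) :
    ∃ U : ℝ × ℝ → ℝ, ContinuousOn U {p | 0 < sqDist c p} ∧
      ∀ θ, ∀ r > 0, U (ray c θ r) = u θ := by
  have hl : Continuous (hper.lift : Real.Angle → ℝ) := hu.quotient_lift _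
  refine ⟨fun p => hper.lift ((Complex.arg ⟨p.1 - c, p.2⟩ : ℝ) : Real.Angle), ?_, ?_⟩
  · refine hl.comp_continuousOn fun p hp => ?_
    have hne : (⟨p.1 - c, p.2⟩ : ℂ) ≠ 0 := by
      intro h
      have h1 := congrArg Complex.re h
      have h2 := congrArg Complex.im h
      simp only [Complex.zero_re, Complex.zero_im] at h1 h2
      simp [sqDist, h1, h2] at hp
    have hcx : Continuous fun p : ℝ × ℝ => (⟨p.1 - c, p.2⟩ : ℂ) := by
      have : (fun p : ℝ × ℝ => (⟨p.1 - c, p.2⟩ : ℂ)) =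
          fun p => Complex.equivRealProdCLM.symm (p.1 - c, p.2) := by
        funext p; apply Complex.ext <;> simp
      rw [this]
      fun_prop
    exact (ContinuousAt.comp (f := fun p : ℝ × ℝ => (⟨p.1 - c, p.2⟩ : ℂ))
      (Complex.continuousAt_arg_coe_angle hne) hcx.continuousAt).continuousWithinAt
  · intro θ r hr
    have h1 : (⟨(ray c θ r).1 - c, (ray c θ r).2⟩ : ℂ) =
        r * (Complex.cos (θ : Real.Angle).toReal + Complex.sin (θ : Real.Angle).toReal * Complex.I) := by
      rw [← Complex.ofReal_cos, ← Complex.ofReal_sin, Real.Angle.cos_toReal, Real.Angle.sin_toReal,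
        Real.Angle.cos_coe, Real.Angle.sin_coe]
      apply Complex.ext <;> simp [ray, -Complex.ofReal_cos, -Complex.ofReal_sin]
    simp only [h1]
    rw [Complex.arg_mul_cos_add_sin_mul_I hr (Real.Angle.toReal_mem_Ioc _), Real.Angle.coe_toReal]
    exact hper.lift_coe θ

namespace IsPolarAnnulus

variable {c a b a' b' : ℝ} {S : Set (ℝ × ℝ)}

theorem pt_mem_band (hA : IsPolarAnnulus c S a b) (ha : a < a') (hb : b' < b) (θ : ℝ) {h : ℝ}
    (hh : h ∈ Icc a' b') : pt c S θ h ∈ band S a' b' := by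
  obtain ⟨-, h2, h3⟩ := hA.rho_spec θ (Icc_subset_Ioo ha hb hh)
  exact ⟨h2, h3.symm ▸ hh⟩

theorem isCompact_band (hA : IsPolarAnnulus c S a b) (ha : a < a') (hb : b' < b) :
    IsCompact (band S a' b') := by
  have hsub := Icc_subset_Ioo ha hb
  have : band S a' b' =
      (fun q : ℝ × ℝ => pt c S q.1 q.2) '' (Icc 0 (2 * Real.pi) ×ˢ Icc a' b') := by
    refine Subset.antisymm ?_ ?_
    · rintro p ⟨hS, hH⟩
      obtain ⟨θ, hθ⟩ := hA.exists_pt_eq hS (hsub hH)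
      obtain ⟨y, hy, hyθ⟩ := (pt_periodic c S (H p)).exists_mem_Ico₀ (by positivity) θ
      refine ⟨(y, H p), ⟨Ico_subset_Icc_self hy, hH⟩, ?_⟩
      simp only at hyθ ⊢
      rw [← hyθ, hθ]
    · rintro _ ⟨q, hq, rfl⟩
      exact hA.pt_mem_band ha hb q.1 hq.2
  rw [this]
  exact (isCompact_Icc.prod isCompact_Icc).image_of_continuousOn
    (hA.continuousOn_pt.mono (prod_mono (subset_univ _) hsub))

theorem radial_pos_of_mem_band (hA : IsPolarAnnulus c S a b) (ha : a < a') (hb : b' < b)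
    {p : ℝ × ℝ} (hp : p ∈ band S a' b') : 0 < radial c p :=
  hA.radial_pos p hp.1 (Icc_subset_Ioo ha hb hp.2)

theorem sqDist_pos (hA : IsPolarAnnulus c S a b) {p : ℝ × ℝ} (hS : p ∈ S) (hH : H p ∈ Ioo a b) :
    0 < sqDist c p := by
  obtain ⟨θ, hθ⟩ := hA.exists_pt_eq hS hH
  rw [← hθ]
  exact hA.sqDist_pt_pos θ hH

/-- The velocity of `pt` with respect to the level is bounded on a compact band. This turns
closeness in the coordinate `H` into closeness in the plane. -/
theorem exists_dist_pt_le (hA : IsPolarAnnulus c S a b) (ha : a < a') (hb : b' < b) :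
    ∃ L ≥ 0, ∀ θ, ∀ h ∈ Icc a' b', ∀ h' ∈ Icc a' b',
      dist (pt c S θ h) (pt c S θ h') ≤ L * |h - h'| := by
  have hsub := Icc_subset_Ioo ha hb
  have hc : ContinuousOn (fun p : ℝ × ℝ => ((p.1 - c) / radial c p, p.2 / radial c p))
      (band S a' b') := by
    have := continuous_radial c
    refine ContinuousOn.prodMk ?_ ?_ <;>
    exact ContinuousOn.div (by fun_prop) (by fun_prop)
      fun p hp => (hA.radial_pos_of_mem_band ha hb hp).ne'
  obtain ⟨L, hL⟩ := (hA.isCompact_band ha hb).exists_bound_of_continuousOn hc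
  refine ⟨max L 0, le_max_right _ _, fun θ h hh h' hh' => ?_⟩
  rw [dist_eq_norm, ← Real.norm_eq_abs]
  exact (convex_Icc a' b').norm_image_sub_le_of_norm_hasDerivWithin_le
    (fun x hx => (hA.hasDerivAt_pt_level θ (hsub hx)).hasDerivWithinAt)
    (fun x hx => (hL _ (hA.pt_mem_band ha hb θ hx)).trans (le_max_left _ _)) hh' hh

theorem exists_den_pos (hA : IsPolarAnnulus c S a b) (ha : a < a') (hb : b' < b) :
    ∃ e₀ > 0, ∀ e, |e| ≤ e₀ → ∀ p ∈ band S a' b', 0 < den c e p := by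
  have hg := continuous_g
  have hr := continuous_radial c
  obtain ⟨M, hM⟩ := (hA.isCompact_band ha hb).exists_bound_of_continuousOn
    (f := fun p => (p.1 - c) * g p / radial c p)
    (ContinuousOn.div (by fun_prop) (by fun_prop)
      fun p hp => (hA.radial_pos_of_mem_band ha hb hp).ne')
  -- For such `e` the perturbing term in `den` is at most half of `radial`.
  refine ⟨1 / (2 * (|M| + 1)), by positivity, fun e he p hp => ?_⟩
  have hN := hA.radial_pos_of_mem_band ha hb hp
  have h1 := hM p hp
  rw [Real.norm_eq_abs, abs_div, abs_of_pos hN, div_le_iff₀ hN] at h1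
  have h2 : |e * ((p.1 - c) * g p)| ≤ radial c p / 2 := by
    rw [abs_mul]
    calc |e| * |(p.1 - c) * g p| ≤ 1 / (2 * (|M| + 1)) * ((|M| + 1) * radial c p) := by
          gcongr
          refine h1.trans ?_
          gcongr
          linarith [le_abs_self M]
      _ = radial c p / 2 := by field_simp
  have := (abs_le.1 h2).1
  unfold den
  linarith

/-- The flow of `field e` in polar coordinates: `θ' = den / sqDist`, `h' = e * y * g`. -/
theorem hasDerivAt_pt_field (hA : IsPolarAnnulus c S a b) {e t : ℝ} {Θ u : ℝ → ℝ}
    (hut : u (Θ t) ∈ Ioo a b) (hden : den c e (pt c S (Θ t) (u (Θ t))) ≠ 0)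
    (hΘ : HasDerivAt Θ (den c e (pt c S (Θ t) (u (Θ t))) / sqDist c (pt c S (Θ t) (u (Θ t)))) t)
    (hu : HasDerivAt u (e * avg c e (pt c S (Θ t) (u (Θ t)))) (Θ t)) :
    HasDerivAt (fun s => pt c S (Θ s) (u (Θ s))) (field e (pt c S (Θ t) (u (Θ t)))) t := by
  have hR := (hA.sqDist_pt_pos (Θ t) hut).ne'
  refine hA.hasDerivAt_pt (u := fun s => u (Θ s)) hut ?_ ?_
  · refine hΘ.congr_deriv ?_
    simp only [field_eq, den, radial]
    ring
  · refine (HasDerivAt.comp (h₂ := u) (h := Θ) t hu hΘ).congr_deriv ?_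
    simp only [field_eq, avg]
    field_simp
    ring

theorem continuous_pt_comp (hA : IsPolarAnnulus c S a b) {f u : ℝ → ℝ} (hf : Continuous f)
    (hu : Continuous u) (hub : ∀ θ, u θ ∈ Ioo a b) : Continuous fun θ => pt c S (f θ) (u θ) :=
  ContinuousOn.comp_continuous (g := fun q : ℝ × ℝ => pt c S q.1 q.2) (f := fun θ => (f θ, u θ))
    hA.continuousOn_pt (hf.prodMk hu) fun θ => ⟨trivial, hub θ⟩

/-- Provides the upper bound on the speed that `exists_time_change` requires. -/
theorem exists_angular_speed_bound (hA : IsPolarAnnulus c S a b) (ha : a < a') (hb : b' < b)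
    (e : ℝ) : ∃ M, ∀ p ∈ band S a' b', den c e p / sqDist c p ≤ M := by
  have h1 : Continuous (den c e) :=
    (continuous_den c).comp (continuous_const.prodMk continuous_id)
  have h2 := continuous_sqDist c
  obtain ⟨M, hM⟩ := (hA.isCompact_band ha hb).exists_bound_of_continuousOn
    (f := fun p => den c e p / sqDist c p)
    (ContinuousOn.div (by fun_prop) (by fun_prop)
      fun p hp => (hA.sqDist_pos hp.1 (Icc_subset_Ioo ha hb hp.2)).ne')
  exact ⟨M, fun p hp => (le_abs_self _).trans (hM p hp)⟩

/-- A periodic solution in polar coordinates is a closed orbit. -/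
theorem exists_isPeriodParam (hA : IsPolarAnnulus c S a b) (ha : a < a') (hb : b' < b) {e : ℝ}
    {u : ℝ → ℝ} (hper : Function.Periodic u (2 * Real.pi)) (hub : ∀ θ, u θ ∈ Icc a' b')
    (hden : ∀ p ∈ band S a' b', 0 < den c e p)
    (hu : ∀ θ, HasDerivAt u (e * avg c e (pt c S θ (u θ))) θ) :
    ∃ γ T, IsPeriodParam (field e) γ T (polarGraph c S u) ∧
      ∫ t in 0..T, (γ t).2 * g (γ t) =
        ∫ θ in 0..2 * Real.pi, avg c e (pt c S θ (u θ)) := by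
  have hπ : 0 < 2 * Real.pi := by positivity
  have hsub := Icc_subset_Ioo ha hb
  have huc : Continuous u := continuous_iff_continuousAt.2 fun θ => (hu θ).continuousAt
  have hpc : Continuous fun θ => pt c S θ (u θ) :=
    hA.continuous_pt_comp continuous_id huc fun θ => hsub (hub θ)
  have hband : ∀ θ, pt c S θ (u θ) ∈ band S a' b' := fun θ => hA.pt_mem_band ha hb θ (hub θ)
  have hptper : Function.Periodic (fun θ => pt c S θ (u θ)) (2 * Real.pi) := fun θ => by
    have := pt_periodic c S (u θ) θ
    simp only at this
    simp only [hper θ, this]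
  have hdenc : Continuous fun θ => den c e (pt c S θ (u θ)) :=
    (continuous_den c).comp (continuous_const.prodMk hpc)
  have hsq : ∀ θ, 0 < sqDist c (pt c S θ (u θ)) := fun θ => hA.sqDist_pt_pos θ (hsub (hub θ))
  set w : ℝ → ℝ := fun θ => den c e (pt c S θ (u θ)) / sqDist c (pt c S θ (u θ)) with hw
  have hwc : Continuous w :=
    hdenc.div ((continuous_sqDist c).comp hpc) fun θ => (hsq θ).ne'
  have hwpos : ∀ θ, 0 < w θ := fun θ => div_pos (hden _ (hband θ)) (hsq θ)
  obtain ⟨M, hM⟩ := hA.exists_angular_speed_bound ha hb e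
  obtain ⟨Θ, τ, hΘ0, hτ0, hΘm, hτm, hΘτ, hτΘ, hΘd, hτd⟩ :=
    exists_time_change hwc hwpos (fun θ => hM _ (hband θ)) 0
  -- The time of one turn. The speed `w` is periodic, so `τ (θ + 2π) - τ θ` has zero derivative and
  -- always equals `T`.
  set T := τ (2 * Real.pi) with hT
  have hTpos : 0 < T := hτ0 ▸ hτm hπ
  have hτper : ∀ θ, τ (θ + 2 * Real.pi) = τ θ + T := by
    have hwper : ∀ θ, w (θ + 2 * Real.pi) = w θ := fun θ => by
      have := hptper θ
      simp only at this
      simp only [hw, this]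
    have hconst : ∀ θ, HasDerivAt (fun θ => τ (θ + 2 * Real.pi) - τ θ) 0 θ := fun θ => by
      have := ((hτd (θ + 2 * Real.pi)).comp_add_const θ (2 * Real.pi)).sub (hτd θ)
      rw [hwper, sub_self] at this
      exact this
    intro θ
    have := is_const_of_deriv_eq_zero (fun θ => (hconst θ).differentiableAt)
      (fun θ => (hconst θ).deriv) θ 0
    simp only [zero_add, hτ0, sub_zero] at this
    linarith
  have hΘper : ∀ t, Θ (t + T) = Θ t + 2 * Real.pi := fun t => by
    rw [← hΘτ (Θ t + 2 * Real.pi), hτper, hτΘ]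
  have hsol : ∀ t, HasDerivAt (fun s => pt c S (Θ s) (u (Θ s)))
      (field e (pt c S (Θ t) (u (Θ t)))) t := fun t =>
    hA.hasDerivAt_pt_field (hsub (hub _)) (hden _ (hband _)).ne' (hΘd t) (hu (Θ t))
  refine ⟨fun t => pt c S (Θ t) (u (Θ t)), T, ⟨hTpos, hsol, fun t => ?_, ?_, ?_⟩, ?_⟩
  · have := hptper (Θ t)
    simp only at this
    simp only [hΘper, this]
  · intro t₁ h₁ t₂ h₂ heq
    obtain ⟨hcos, hsin, -⟩ := hA.pt_injOn (hsub (hub _)) (hsub (hub _)) heq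
    have hmem : ∀ t ∈ Ico 0 T, Θ t ∈ Ico 0 (2 * Real.pi) := fun t ht => by
      refine ⟨hΘ0 ▸ hΘm.monotone ht.1, ?_⟩
      have := hΘm ht.2
      rwa [hT, hΘτ] at this
    have hang : (Θ t₁ : Real.Angle) = Θ t₂ := Real.Angle.cos_sin_inj hcos hsin
    rw [Real.Angle.angle_eq_iff_two_pi_dvd_sub] at hang
    obtain ⟨n, hn⟩ := hang
    have m1 := hmem t₁ h₁
    have m2 := hmem t₂ h₂
    have hn1 : (n : ℝ) < 1 := by
      by_contra hc
      nlinarith [m1.1, m1.2, m2.1, m2.2]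
    have hn2 : (-1 : ℝ) < n := by
      by_contra hc
      nlinarith [m1.1, m1.2, m2.1, m2.2]
    have hn0 : n = 0 := by
      have : n < 1 := by exact_mod_cast hn1
      have : -1 < n := by exact_mod_cast hn2
      omega
    rw [hn0, Int.cast_zero, mul_zero, sub_eq_zero] at hn
    exact hΘm.injective hn
  · refine Subset.antisymm ?_ ?_
    · rintro _ ⟨t, rfl⟩
      exact ⟨Θ t, rfl⟩
    · rintro _ ⟨θ, rfl⟩
      exact ⟨τ θ, by simp only [hΘτ]⟩
  · have hac : Continuous fun θ => avg c e (pt c S θ (u θ)) :=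
      (continuousOn_avg c).comp_continuous (continuous_const.prodMk hpc)
        (f := fun θ => (e, pt c S θ (u θ))) fun θ => (hden _ (hband θ)).ne'
    -- `Φ ∘ Θ` is a primitive of `y g` in time, which converts the time integral over a period into
    -- the integral of `avg` over the angle.
    set Φ : ℝ → ℝ := fun s => ∫ θ in 0..s, avg c e (pt c S θ (u θ)) with hΦ
    have hΦd : ∀ s, HasDerivAt Φ (avg c e (pt c S s (u s))) s := fun s =>
      intervalIntegral.integral_hasDerivAt_right (hac.intervalIntegrable _ _)
        (hac.stronglyMeasurableAtFilter _ _) hac.continuousAt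
    have hΘc : Continuous Θ := continuous_iff_continuousAt.2 fun t => (hΘd t).continuousAt
    have hgc := continuous_g
    have hγc : Continuous fun t => pt c S (Θ t) (u (Θ t)) := hpc.comp hΘc
    have h1 : ∀ t, HasDerivAt (fun t => Φ (Θ t))
        ((pt c S (Θ t) (u (Θ t))).2 * g (pt c S (Θ t) (u (Θ t)))) t := fun t => by
      refine (HasDerivAt.comp (h₂ := Φ) (h := Θ) t (hΦd (Θ t)) (hΘd t)).congr_deriv ?_
      have e1 := (hden _ (hband (Θ t))).ne'
      have e2 := (hsq (Θ t)).ne'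
      simp only [hw, avg]
      field_simp
    rw [intervalIntegral.integral_eq_sub_of_hasDerivAt (fun t _ => h1 t)
      (((continuous_snd.comp hγc).mul (hgc.comp hγc)).intervalIntegrable _ _), hΘ0, hT, hΘτ]
    simp [hΦ]

/-- Attraction in polar coordinates gives orbital asymptotic stability. -/
theorem isAttracting_polarGraph (hA : IsPolarAnnulus c S a b) (ha : a < a') (hb : b' < b) {e : ℝ}
    {u : ℝ → ℝ} (huc : Continuous u) (hper : Function.Periodic u (2 * Real.pi))
    (hub : ∀ θ, u θ ∈ Icc a' b') (hden : ∀ p ∈ band S a' b', 0 < den c e p) {d C : ℝ} (hd : 0 < d)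
    (hatt : ∀ θ₀ v₀, |v₀ - u θ₀| ≤ d → ∃ v : ℝ → ℝ, Continuous v ∧ v θ₀ = v₀ ∧
        (∀ θ ≥ θ₀, v θ ∈ Icc a' b' ∧ HasDerivAt v (e * avg c e (pt c S θ (v θ))) θ ∧
          |v θ - u θ| ≤ C * |v₀ - u θ₀|) ∧
        Tendsto (fun θ => v θ - u θ) atTop (𝓝 0)) :
    IsAttracting (field e) (polarGraph c S u) := by
  intro V hV hΓV
  have hsub := Icc_subset_Ioo ha hb
  have hpc : Continuous fun θ => pt c S θ (u θ) :=
    hA.continuous_pt_comp continuous_id huc fun θ => hsub (hub θ)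
  have hΓc : IsCompact (polarGraph c S u) := by
    have : polarGraph c S u = (fun θ => pt c S θ (u θ)) '' Icc 0 (2 * Real.pi) := by
      refine Subset.antisymm ?_ (image_subset_range _ _)
      rintro _ ⟨θ, rfl⟩
      have hp : Function.Periodic (fun θ => pt c S θ (u θ)) (2 * Real.pi) := fun θ => by
        have := pt_periodic c S (u θ) θ
        simp only at this
        simp only [hper θ, this]
      obtain ⟨y, hy, hyθ⟩ := hp.exists_mem_Ico₀ (by positivity) θ
      exact ⟨y, Ico_subset_Icc_self hy, hyθ.symm⟩
    rw [this]
    exact isCompact_Icc.image hpc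
  obtain ⟨ρ, hρ, hρV⟩ := hΓc.exists_thickening_subset_open hV hΓV
  obtain ⟨L, hL0, hL⟩ := hA.exists_dist_pt_le ha hb
  obtain ⟨W, hWc, hW⟩ := exists_angular_function c huc hper
  -- A deviation below `d'` in `H` at the start grows at most by the factor `|C|`, and by `L` in
  -- passing to the plane, so it stays below `ρ`.
  set d' := min d (ρ / (L * |C| + 1)) with hd'
  have hd'0 : 0 < d' := lt_min hd (by positivity)
  set U : Set (ℝ × ℝ) := {p | 0 < sqDist c p} ∩ (fun p => |H p - W p|) ⁻¹' Iio d' ∩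
    (S ∩ H ⁻¹' Ioo a b) with hU
  have hUo : IsOpen U := by
    refine IsOpen.inter ?_ (hA.isOpen.inter (isOpen_Ioo.preimage continuous_H))
    exact (continuous_H.continuousOn.sub hWc).abs.isOpen_inter_preimage
      (isOpen_lt continuous_const (continuous_sqDist c)) isOpen_Iio
  refine ⟨U, hUo, ?_, fun p hp => ?_⟩
  · rintro _ ⟨θ, rfl⟩
    obtain ⟨h1, h2, h3⟩ := hA.rho_spec θ (hsub (hub θ))
    refine ⟨⟨hA.sqDist_pt_pos θ (hsub (hub θ)), ?_⟩, h2, ?_⟩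
    · simp only [mem_preimage, h3]
      rw [pt, hW _ _ h1]
      simpa using hd'0
    · simp only [mem_preimage, h3]
      exact hsub (hub θ)
  obtain ⟨⟨-, hpW⟩, hpS, hpH⟩ := hp
  obtain ⟨θ₀, hθ₀⟩ := hA.exists_pt_eq hpS hpH
  have hWp : W p = u θ₀ := by
    rw [← hθ₀, pt, hW _ _ (hA.rho_spec θ₀ hpH).1]
  simp only [mem_preimage, mem_Iio, hWp] at hpW
  obtain ⟨v, hvc, hv0, hv, hvlim⟩ := hatt θ₀ (H p) (hpW.le.trans (min_le_left _ _))
  -- `v` is controlled only for `θ ≥ θ₀`. Freezing the angle before `θ₀` gives a speed that is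
  -- positive and bounded on the whole line, as the change of time requires.
  set f : ℝ → ℝ := fun θ => max θ θ₀ with hf
  have hfc : Continuous f := continuous_id.max continuous_const
  have hvf : ∀ θ, v (f θ) ∈ Icc a' b' := fun θ => (hv _ (le_max_right _ _)).1
  have hqc : Continuous fun θ => pt c S (f θ) (v (f θ)) :=
    hA.continuous_pt_comp hfc (hvc.comp hfc) fun θ => hsub (hvf θ)
  have hband : ∀ θ, pt c S (f θ) (v (f θ)) ∈ band S a' b' := fun θ =>
    hA.pt_mem_band ha hb _ (hvf θ)
  have hsq : ∀ θ, 0 < sqDist c (pt c S (f θ) (v (f θ))) := fun θ =>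
    hA.sqDist_pt_pos _ (hsub (hvf θ))
  set w : ℝ → ℝ := fun θ => den c e (pt c S (f θ) (v (f θ))) / sqDist c (pt c S (f θ) (v (f θ)))
    with hw
  have hwc : Continuous w :=
    ((continuous_den c).comp (continuous_const.prodMk hqc)).div ((continuous_sqDist c).comp hqc)
      fun θ => (hsq θ).ne'
  obtain ⟨M, hM⟩ := hA.exists_angular_speed_bound ha hb e
  obtain ⟨Θ, τ, hΘ0, -, hΘm, -, hΘτ, -, hΘd, -⟩ :=
    exists_time_change hwc (fun θ => div_pos (hden _ (hband θ)) (hsq θ))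
      (fun θ => hM _ (hband θ)) θ₀
  have hΘge : ∀ t ≥ 0, θ₀ ≤ Θ t := fun t ht => hΘ0 ▸ hΘm.monotone ht
  have hfΘ : ∀ t ≥ 0, f (Θ t) = Θ t := fun t ht => max_eq_left (hΘge t ht)
  have hdist : ∀ t ≥ 0, dist (pt c S (Θ t) (v (Θ t))) (pt c S (Θ t) (u (Θ t))) ≤
      L * |v (Θ t) - u (Θ t)| := fun t ht =>
    hL _ _ (hv _ (hΘge t ht)).1 _ (hub _)
  refine ⟨fun t => pt c S (Θ t) (v (Θ t)), by simp only [hΘ0, hv0, hθ₀], fun t ht => ?_,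
    fun t ht => ?_, ?_⟩
  · refine (hA.hasDerivAt_pt_field (hsub (hv _ (hΘge t ht)).1) ?_ ?_
      (hv _ (hΘge t ht)).2.1).hasDerivWithinAt
    · have := hband (Θ t)
      rw [hfΘ t ht] at this
      exact (hden _ this).ne'
    · have := hΘd t
      simp only [hw, hfΘ t ht] at this
      exact this
  · refine hρV (Metric.mem_thickening_iff.2 ⟨_, mem_range_self (Θ t), ?_⟩)
    have h1 := (hv _ (hΘge t ht)).2.2
    calc dist (pt c S (Θ t) (v (Θ t))) (pt c S (Θ t) (u (Θ t)))
        ≤ L * |v (Θ t) - u (Θ t)| := hdist t ht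
      _ ≤ L * (|C| * |H p - u θ₀|) := by
          gcongr
          exact h1.trans (by gcongr; exact le_abs_self C)
      _ ≤ L * (|C| * (ρ / (L * |C| + 1))) := by
          gcongr
          exact hpW.le.trans (min_le_right _ _)
      _ = ρ * (L * |C| / (L * |C| + 1)) := by ring
      _ < ρ * 1 := by
          gcongr
          rw [div_lt_one (by positivity)]
          linarith
      _ = ρ := mul_one ρ
  · have hΘtop : Tendsto Θ atTop atTop := by
      refine tendsto_atTop_atTop.2 fun s => ⟨τ s, fun t ht => ?_⟩
      have := hΘm.monotone ht
      rwa [hΘτ] at this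
    have h1 : Tendsto (fun t => L * |v (Θ t) - u (Θ t)|) atTop (𝓝 0) := by
      have := ((hvlim.comp hΘtop).abs).const_mul L
      simpa using this
    refine squeeze_zero' (Eventually.of_forall fun _ => Metric.infDist_nonneg) ?_ h1
    filter_upwards [eventually_ge_atTop 0] with t ht
    exact (Metric.infDist_le_dist_of_mem (mem_range_self (Θ t))).trans (hdist t ht)

end IsPolarAnnulus

/-! ### Limit cycles bifurcating from a level with vanishing Abelian integral -/

/-- A selection with asymptotically optimal size. -/
theorem exists_selection {ι : Type*} [Nonempty ι] {Q : ℝ → ι → Prop} {B : ι → ℝ → Prop}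
    (mono : ∀ i r s, r ≤ s → B i r → B i s)
    (h : ∀ r > 0, ∀ᶠ ε in 𝓝[>] (0 : ℝ), ∃ i, Q ε i ∧ B i r) :
    ∃ U : ℝ → ι, ∀ r > 0, ∀ᶠ ε in 𝓝[>] (0 : ℝ), Q ε (U ε) ∧ B (U ε) r := by
  set R : ℝ → Set ℝ := fun ε => {r | 0 < r ∧ ∃ i, Q ε i ∧ B i r} with hR
  have hbdd : ∀ ε, BddBelow (R ε) := fun ε => ⟨0, fun r hr => hr.1.le⟩
  -- The threshold for `ε` depends on `r`, while one choice has to serve all `r`. The chosen index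
  -- has size below the infimum of the admissible sizes plus `ε`, whenever such an index exists.
  refine ⟨fun ε => Classical.epsilon fun i => ∃ r < sInf (R ε) + ε, Q ε i ∧ B i r,
    fun r hr => ?_⟩
  have hsmall : ∀ᶠ ε in 𝓝[>] (0 : ℝ), ε < r / 2 :=
    nhdsWithin_le_nhds (gt_mem_nhds (half_pos hr))
  filter_upwards [h (r / 2) (half_pos hr), hsmall, self_mem_nhdsWithin] with ε ⟨i, hi⟩ hε hε0
  have hmem : r / 2 ∈ R ε := ⟨half_pos hr, i, hi⟩
  obtain ⟨r', ⟨-, j, hj⟩, hr'⟩ := exists_lt_of_csInf_lt ⟨_, hmem⟩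
    (show sInf (R ε) < sInf (R ε) + ε from lt_add_of_pos_right _ hε0)
  obtain ⟨r'', hr'', hQ, hB⟩ := Classical.epsilon_spec
    (p := fun i => ∃ r < sInf (R ε) + ε, Q ε i ∧ B i r) ⟨j, r', hr', hj⟩
  refine ⟨hQ, mono _ _ _ ?_ hB⟩
  have := csInf_le (hbdd ε) hmem
  linarith

theorem eventually_abs {Q : ℝ → Prop} (h : ∀ᶠ ε in 𝓝[>] (0 : ℝ), Q ε) :
    ∀ᶠ e in 𝓝[≠] (0 : ℝ), Q |e| := by
  have : Tendsto (fun e : ℝ => |e|) (𝓝[≠] 0) (𝓝[>] 0) := by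
    refine tendsto_nhdsWithin_iff.2 ⟨?_, ?_⟩
    · have := (continuous_abs : Continuous fun e : ℝ => |e|).tendsto 0
      rw [abs_zero] at this
      exact this.mono_left nhdsWithin_le_nhds
    · filter_upwards [self_mem_nhdsWithin] with e he using abs_pos.2 he
  exact this.eventually h

theorem pt_neg {c : ℝ} {S : Set (ℝ × ℝ)} (hS : ∀ p, reflect p ∈ S ↔ p ∈ S) (θ h : ℝ) :
    pt c S (-θ) h = reflect (pt c S θ h) := by
  have hray : ∀ r, ray c (-θ) r = reflect (ray c θ r) := fun r => by simp [ray, reflect]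
  have : rho c S (-θ) h = rho c S θ h := by
    unfold rho
    simp only [hray, hS, H_reflect]
  rw [pt, this, hray, pt]

theorem reflect_image_polarGraph {c : ℝ} {S : Set (ℝ × ℝ)} (hS : ∀ p, reflect p ∈ S ↔ p ∈ S)
    (u : ℝ → ℝ) : reflect '' polarGraph c S u = polarGraph c S fun θ => u (-θ) := by
  rw [polarGraph, polarGraph, ← range_comp]
  refine Subset.antisymm ?_ ?_
  · rintro _ ⟨θ, rfl⟩
    exact ⟨-θ, by simp only [neg_neg, pt_neg hS, Function.comp]⟩
  · rintro _ ⟨θ, rfl⟩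
    refine ⟨-θ, ?_⟩
    simp only [Function.comp, ← pt_neg hS, neg_neg]

namespace IsPolarAnnulus

variable {c a b : ℝ} {S : Set (ℝ × ℝ)}

theorem continuousOn_pt_comp {X : Type*} [TopologicalSpace X] (hA : IsPolarAnnulus c S a b)
    {s : Set X} {f u : X → ℝ} (hf : ContinuousOn f s) (hu : ContinuousOn u s)
    (hub : ∀ x ∈ s, u x ∈ Ioo a b) : ContinuousOn (fun x => pt c S (f x) (u x)) s := by
  have h := hA.continuousOn_pt
  generalize pt c S = P at *
  exact ContinuousOn.comp (g := fun q : ℝ × ℝ => P q.1 q.2) (f := fun x => (f x, u x)) h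
    (hf.prodMk hu) fun x hx => mk_mem_prod (mem_univ _) (hub x hx)

theorem polarGraph_const (hA : IsPolarAnnulus c S a b) {h : ℝ} (hh : h ∈ Ioo a b) :
    polarGraph c S (fun _ => h) = {p | p ∈ S ∧ H p = h} := by
  refine Subset.antisymm ?_ ?_
  · rintro _ ⟨θ, rfl⟩
    exact (hA.rho_spec θ hh).2
  · rintro p ⟨hS, rfl⟩
    exact hA.exists_pt_eq hS hh

/-- The Abelian integral over a level in polar coordinates. -/
theorem hasAbelianIntegral (hA : IsPolarAnnulus c S a b) {h : ℝ} (hh : h ∈ Ioo a b) :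
    HasAbelianIntegral {p | p ∈ S ∧ H p = h}
      (∫ θ in 0..2 * Real.pi, avg c 0 (pt c S θ h)) := by
  obtain ⟨f, T, hf, hI⟩ := hA.exists_isPeriodParam (a' := h) (b' := h) hh.1 hh.2 (e := 0)
    (u := fun _ => h) (fun _ => rfl) (fun _ => ⟨le_rfl, le_rfl⟩)
    (fun p hp => by rw [den_zero]; exact hA.radial_pos_of_mem_band hh.1 hh.2 hp)
    (fun θ => by rw [zero_mul]; exact hasDerivAt_const θ h)
  rw [field_zero, hA.polarGraph_const hh] at hf
  exact hasAbelianIntegral_of_isPeriodParam hf hI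

theorem continuousOn_integral_avg (hA : IsPolarAnnulus c S a b) {a' b' : ℝ} (ha : a < a')
    (hab : a' ≤ b') (hb : b' < b) :
    ContinuousOn (fun h => ∫ θ in 0..2 * Real.pi, avg c 0 (pt c S θ h)) (Icc a' b') := by
  have hsub := Icc_subset_Ioo ha hb
  have hP : Continuous fun q : ℝ × ℝ => pt c S q.2 (projIcc a' b' hab q.1) := by
    have hp : Continuous fun q : ℝ × ℝ => (projIcc a' b' hab q.1 : ℝ) :=
      continuous_subtype_val.comp (continuous_projIcc.comp continuous_fst)
    rw [← continuousOn_univ]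
    exact hA.continuousOn_pt_comp continuousOn_snd hp.continuousOn
      fun q _ => hsub (projIcc a' b' hab q.1).2
  have hF : Continuous fun q : ℝ × ℝ => avg c 0 (pt c S q.2 (projIcc a' b' hab q.1)) :=
    (continuousOn_avg c).comp_continuous (continuous_const.prodMk hP)
      (f := fun q : ℝ × ℝ => ((0 : ℝ), pt c S q.2 (projIcc a' b' hab q.1))) fun q => by
        simp only [mem_ofPred_eq, den_zero]
        exact (hA.radial_pt_pos _ (hsub (projIcc a' b' hab q.1).2)).ne'
  have hI : Continuous fun h =>
      ∫ θ in 0..2 * Real.pi, avg c 0 (pt c S θ (projIcc a' b' hab h)) :=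
    intervalIntegral.continuous_parametric_intervalIntegral_of_continuous'
      (f := fun h θ => avg c 0 (pt c S θ (projIcc a' b' hab h))) hF 0 (2 * Real.pi)
  refine hI.continuousOn.congr fun h hh => ?_
  simp only [projIcc_of_mem hab hh]

/-- Averaging in the parameter `σ * ε` with `ε > 0`: the averaged right side gets the factor `σ`, so
its derivative at `h₀` is negative for either sign of `I'`. -/
theorem eventually_exists_attracting (hA : IsPolarAnnulus c S a b) {h₀ σ : ℝ}
    (hh₀ : h₀ ∈ Ioo a b) (hσ : |σ| = 1)
    (hI : ∫ θ in 0..2 * Real.pi, avg c 0 (pt c S θ h₀) = 0)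
    (hI' : σ * ∫ θ in 0..2 * Real.pi, avgDeriv c 0 (pt c S θ h₀) < 0) {r : ℝ} (hr : 0 < r) :
    ∀ᶠ ε in 𝓝[>] (0 : ℝ), ∃ u : ℝ → ℝ, (Continuous u ∧ Function.Periodic u (2 * Real.pi) ∧
      (∀ θ, u θ ∈ Ioo a b) ∧ IsClosedOrbit (field (σ * ε)) (polarGraph c S u) ∧
      IsAttracting (field (σ * ε)) (polarGraph c S u)) ∧ ∀ θ, |u θ - h₀| ≤ r := by
  obtain ⟨η₀, hη₀, hηa, hηb⟩ : ∃ η > 0, a < h₀ - η ∧ h₀ + η < b :=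
    ⟨min (h₀ - a) (b - h₀) / 2, half_pos (lt_min (sub_pos.2 hh₀.1) (sub_pos.2 hh₀.2)),
      by linarith [min_le_left (h₀ - a) (b - h₀), hh₀.1],
      by linarith [min_le_right (h₀ - a) (b - h₀), hh₀.2]⟩
  have hsub := Icc_subset_Ioo hηa hηb
  obtain ⟨e₀, he₀, hden⟩ := hA.exists_den_pos hηa hηb
  have hσε : ∀ ε ∈ Icc 0 e₀, |σ * ε| ≤ e₀ := fun ε hε => by
    rw [abs_mul, hσ, one_mul, abs_of_nonneg hε.1]; exact hε.2
  have hP : ContinuousOn (fun q : ℝ × ℝ × ℝ => (σ * q.1, pt c S q.2.1 q.2.2))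
      (Icc 0 e₀ ×ˢ univ ×ˢ Icc (h₀ - η₀) (h₀ + η₀)) := by
    exact ContinuousOn.prodMk (by fun_prop) (hA.continuousOn_pt_comp (by fun_prop) (by fun_prop)
      fun q hq => hsub hq.2.2)
  have hden' : ∀ ε ∈ Icc 0 e₀, ∀ θ, ∀ h ∈ Icc (h₀ - η₀) (h₀ + η₀), den c (σ * ε) (pt c S θ h) ≠ 0 :=
    fun ε hε θ h hh => (hden _ (hσε _ hε) _ (hA.pt_mem_band hηa hηb _ hh)).ne'
  have hc : ContinuousOn (fun q : ℝ × ℝ × ℝ => σ * avg c (σ * q.1) (pt c S q.2.1 q.2.2))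
      (Icc 0 e₀ ×ˢ univ ×ˢ Icc (h₀ - η₀) (h₀ + η₀)) :=
    continuousOn_const.mul <| ContinuousOn.comp (g := fun q : ℝ × ℝ × ℝ => avg c q.1 q.2)
      (f := fun q : ℝ × ℝ × ℝ => (σ * q.1, pt c S q.2.1 q.2.2)) (continuousOn_avg c) hP
      fun q hq => hden' _ hq.1 _ _ hq.2.2
  have hc' : ContinuousOn (fun q : ℝ × ℝ × ℝ => σ * avgDeriv c (σ * q.1) (pt c S q.2.1 q.2.2))
      (Icc 0 e₀ ×ˢ univ ×ˢ Icc (h₀ - η₀) (h₀ + η₀)) :=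
    continuousOn_const.mul <| ContinuousOn.comp (g := fun q : ℝ × ℝ × ℝ => avgDeriv c q.1 q.2)
      (f := fun q : ℝ × ℝ × ℝ => (σ * q.1, pt c S q.2.1 q.2.2)) (continuousOn_avgDeriv c) hP
      fun q hq => And.intro (hden' _ hq.1 _ _ hq.2.2)
        (hA.radial_pt_pos _ (hsub hq.2.2)).ne'
  have hd : ∀ ε ∈ Icc 0 e₀, ∀ θ, ∀ h ∈ Icc (h₀ - η₀) (h₀ + η₀), HasDerivAt (fun h => σ * avg c (σ * ε) (pt c S θ h))
      (σ * avgDeriv c (σ * ε) (pt c S θ h)) h := fun ε hε θ h hh =>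
    (hA.hasDerivAt_avg (σ * ε) θ (hsub hh) (hden' _ hε _ _ hh)).const_mul σ
  have hper : ∀ f : ℝ × ℝ → ℝ, ∀ h, Function.Periodic (fun θ => σ * f (pt c S θ h))
      (2 * Real.pi) := fun f h θ => by
    have := pt_periodic c S h θ
    simp only at this
    simp only [this]
  have hI0 : ∫ θ in 0..2 * Real.pi, σ * avg c (σ * 0) (pt c S θ h₀) = 0 := by
    rw [mul_zero, intervalIntegral.integral_const_mul, hI, mul_zero]
  have hD0 : ∫ θ in 0..2 * Real.pi, σ * avgDeriv c (σ * 0) (pt c S θ h₀) < 0 := by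
    rw [mul_zero, intervalIntegral.integral_const_mul]; exact hI'
  have hev := exists_attracting_periodic_of_average (h₀ := h₀) (η₀ := η₀) (ε₀ := e₀)
    (F := fun ε θ h => σ * avg c (σ * ε) (pt c S θ h))
    (F' := fun ε θ h => σ * avgDeriv c (σ * ε) (pt c S θ h)) hη₀ he₀ hc hc' hd
    (fun ε _ h _ => hper _ h) (fun ε _ h _ => hper _ h) hI0 hD0
    (r := min r η₀) (lt_min hr hη₀)
  have hsmall : ∀ᶠ ε in 𝓝[>] (0 : ℝ), ε < e₀ := nhdsWithin_le_nhds (gt_mem_nhds he₀)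
  filter_upwards [hev, hsmall, self_mem_nhdsWithin] with ε hex hε hε0
  obtain ⟨u, hper, hub, hu, d, hd, C, hatt⟩ := hex
  have hεI : ε ∈ Icc 0 e₀ := ⟨le_of_lt hε0, hε.le⟩
  have hub' : ∀ θ, u θ ∈ Icc (h₀ - η₀) (h₀ + η₀) := fun θ => by
    have := abs_le.1 ((hub θ).trans (min_le_right _ _))
    constructor <;> linarith
  have huc : Continuous u := continuous_iff_continuousAt.2 fun θ => (hu θ).continuousAt
  have hdε := hden _ (hσε ε hεI)
  have hode : ∀ q : ℝ × ℝ, ε * (σ * avg c (σ * ε) q) = σ * ε * avg c (σ * ε) q := fun q => by ring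
  simp only [hode] at hu hatt
  obtain ⟨f, T, hf, -⟩ := hA.exists_isPeriodParam hηa hηb hper hub' hdε hu
  have hat : IsAttracting (field (σ * ε)) (polarGraph c S u) := by
    refine hA.isAttracting_polarGraph (C := C) hηa hηb huc hper hub' hdε hd fun θ₀ v₀ hv₀ => ?_
    obtain ⟨v, h1, h2, h3, h4⟩ := hatt θ₀ v₀ hv₀
    refine ⟨v, h1, h2, fun θ hθ => ?_, h4⟩
    obtain ⟨h5, h6, h7⟩ := h3 θ hθ
    have := abs_le.1 h5
    exact ⟨⟨by linarith, by linarith⟩, h6, h7⟩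
  exact ⟨u, ⟨huc, hper, fun θ => hsub (hub' θ), ⟨f, T, hf⟩, hat⟩,
    fun θ => (hub θ).trans (min_le_left _ _)⟩

/-- A simple zero of the Abelian integral gives a family of limit cycles. -/
theorem exists_bifurcatesFrom (hA : IsPolarAnnulus c S a b) (hS : ∀ p, reflect p ∈ S ↔ p ∈ S)
    {h₀ σ : ℝ} (hh₀ : h₀ ∈ Ioo a b) (hσ : σ = 1 ∨ σ = -1)
    (hI : ∫ θ in 0..2 * Real.pi, avg c 0 (pt c S θ h₀) = 0)
    (hI' : σ * ∫ θ in 0..2 * Real.pi, avgDeriv c 0 (pt c S θ h₀) < 0) :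
    ∃ C : ℝ → Set (ℝ × ℝ), BifurcatesFrom field C {p | p ∈ S ∧ H p = h₀} ∧
      (∀ r > 0, ∀ᶠ e in 𝓝[≠] (0 : ℝ), ∃ u : ℝ → ℝ, Continuous u ∧
        Function.Periodic u (2 * Real.pi) ∧ (∀ θ, u θ ∈ Ioo a b) ∧ (∀ θ, |u θ - h₀| ≤ r) ∧
        C e = polarGraph c S u) ∧
      ∀ᶠ e in 𝓝[>] (0 : ℝ), (σ = 1 → IsAttracting (field e) (C e)) ∧
        (σ = -1 → IsRepelling (field e) (C e)) := by
  have hσ1 : |σ| = 1 := by rcases hσ with rfl | rfl <;> simp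
  obtain ⟨U, hU⟩ := exists_selection (B := fun (u : ℝ → ℝ) r => ∀ θ, |u θ - h₀| ≤ r)
    (fun u r s hrs h θ => (h θ).trans hrs)
    fun r hr => hA.eventually_exists_attracting hh₀ hσ1 hI hI' hr
  -- If `e` has the sign of `σ`, the attracting cycle of `field e` itself is taken. Otherwise it is
  -- the reflection of the attracting cycle of `field (-e)`, whose graph has `θ` replaced by `-θ`.
  set C : ℝ → Set (ℝ × ℝ) := fun e =>
    if 0 < σ * e then polarGraph c S (U |e|) else polarGraph c S fun θ => U |e| (-θ) with hC
  have hgraph : ∀ r > 0, ∀ᶠ e in 𝓝[≠] (0 : ℝ), ∃ u : ℝ → ℝ, Continuous u ∧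
        Function.Periodic u (2 * Real.pi) ∧ (∀ θ, u θ ∈ Ioo a b) ∧ (∀ θ, |u θ - h₀| ≤ r) ∧
        C e = polarGraph c S u := by
    intro r hr
    filter_upwards [eventually_abs (hU r hr)] with e hUe
    obtain ⟨⟨h1, h2, h3, h4, h5⟩, h6⟩ := hUe
    by_cases he : 0 < σ * e
    · exact ⟨U |e|, h1, h2, h3, h6, by simp only [hC, if_pos he]⟩
    · refine ⟨fun θ => U |e| (-θ), h1.comp continuous_neg, fun θ => ?_, fun θ => h3 _,
        fun θ => h6 _, by simp only [hC, if_neg he]⟩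
      simp only [neg_add, ← sub_eq_add_neg, h2.sub_eq]
  have hpos : ∀ e, 0 < σ * e → σ * |e| = e := by
    intro e he
    rcases hσ with rfl | rfl
    · rw [one_mul] at he ⊢
      exact abs_of_pos he
    · rw [abs_of_neg (by linarith)]; ring
  have hneg : ∀ e, ¬ 0 < σ * e → -(σ * |e|) = e := by
    intro e he
    rcases hσ with rfl | rfl
    · rw [one_mul, abs_of_nonpos (by linarith), neg_neg]
    · rw [abs_of_nonneg (by linarith)]; ring
  refine ⟨C, ⟨?_, ?_⟩, hgraph, ?_⟩
  · filter_upwards [eventually_abs (hU 1 one_pos)] with e hUe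
    obtain ⟨⟨-, -, -, h4, h5⟩, -⟩ := hUe
    have hlc := h4.isLimitCycle_of_isAttracting (contDiff_field _) h5
    by_cases he : 0 < σ * e
    · simp only [hC, if_pos he]
      rwa [hpos e he] at hlc
    · simp only [hC, if_neg he]
      have := hlc.reflect
      rwa [hneg e he, reflect_image_polarGraph hS] at this
  · obtain ⟨η₀, hη₀, hηa, hηb⟩ : ∃ η > 0, a < h₀ - η ∧ h₀ + η < b :=
      ⟨min (h₀ - a) (b - h₀) / 2, half_pos (lt_min (sub_pos.2 hh₀.1) (sub_pos.2 hh₀.2)),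
        by linarith [min_le_left (h₀ - a) (b - h₀), hh₀.1],
        by linarith [min_le_right (h₀ - a) (b - h₀), hh₀.2]⟩
    obtain ⟨L, hL0, hL⟩ := hA.exists_dist_pt_le hηa hηb
    rw [Metric.tendsto_nhds]
    intro ρ hρ
    set r := min η₀ (ρ / (2 * (L + 1))) with hr
    have hr0 : 0 < r := lt_min hη₀ (by positivity)
    filter_upwards [hgraph r hr0] with e hex
    obtain ⟨u, -, -, -, hu, hCu⟩ := hex
    rw [← hA.polarGraph_const hh₀, hCu, Real.dist_eq, sub_zero,
      abs_of_nonneg Metric.hausdorffDist_nonneg]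
    have hd : ∀ θ, dist (pt c S θ (u θ)) (pt c S θ h₀) ≤ L * r := fun θ => by
      have h1 := abs_le.1 ((hu θ).trans (min_le_left _ _))
      refine (hL θ _ ⟨by linarith, by linarith⟩ _ ⟨by linarith, by linarith⟩).trans ?_
      gcongr
      exact hu θ
    refine (Metric.hausdorffDist_le_of_mem_dist (r := L * r) (by positivity) ?_ ?_).trans_lt ?_
    · rintro _ ⟨θ, rfl⟩
      exact ⟨_, mem_range_self θ, hd θ⟩
    · rintro _ ⟨θ, rfl⟩
      exact ⟨_, mem_range_self θ, by rw [dist_comm]; exact hd θ⟩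
    · calc L * r ≤ L * (ρ / (2 * (L + 1))) := by gcongr; exact min_le_right _ _
        _ = ρ * (L / (2 * (L + 1))) := by ring
        _ < ρ * 1 := by
          gcongr
          rw [div_lt_one (by positivity)]
          linarith
        _ = ρ := mul_one ρ
  · filter_upwards [hU 1 one_pos, self_mem_nhdsWithin] with e hUe he0
    obtain ⟨⟨-, -, -, -, h5⟩, -⟩ := hUe
    have he : |e| = e := abs_of_pos he0
    refine ⟨fun h => ?_, fun h => ?_⟩
    · subst h
      simp only [one_mul] at h5
      simp only [hC, one_mul, if_pos (show 0 < e from he0), he]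
      exact h5
    · subst h
      have hn : ¬ 0 < -1 * e := by
        have : 0 < e := he0
        linarith
      simp only [hC, if_neg hn, he]
      have := h5.isRepelling_reflect
      rw [reflect_image_polarGraph hS] at this
      simpa using this

end IsPolarAnnulus

/-! ### The three families of ovals -/

theorem continuous_H_ray (c θ : ℝ) : Continuous fun r => H (ray c θ r) :=
  continuous_H.comp (by unfold ray; fun_prop)

theorem H_ray_zero (c θ : ℝ) : H (ray c θ 0) = H (c, 0) := by simp [ray]

/-- The levels of `H` about a centre, in a set that is convex along the rays. -/
theorem isPolarAnnulus_of_center {c b : ℝ} {S : Set (ℝ × ℝ)} (hS : IsOpen S)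
    (hconv : ∀ θ r s t, ray c θ r ∈ S → ray c θ s ∈ S → r < t → t < s → ray c θ t ∈ S)
    (hpos : ∀ p ∈ S, 0 < sqDist c p → 0 < radial c p)
    (hex : ∀ θ, ∃ r₁ > 0, b ≤ H (ray c θ r₁) ∧ ∀ r, 0 < r → r < r₁ → ray c θ r ∈ S) :
    IsPolarAnnulus c S (H (c, 0)) b where
  isOpen := hS
  exists_ray θ h hh := by
    obtain ⟨r₁, h0, h1, h2⟩ := hex θ
    obtain ⟨r, hr, hrh⟩ := intermediate_value_Ioo h0.le (continuous_H_ray c θ).continuousOn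
      ⟨(H_ray_zero c θ).trans_lt hh.1, hh.2.trans_le h1⟩
    exact ⟨r, hr.1, h2 r hr.1 hr.2, hrh⟩
  unique θ r s hr hs hrS hsS heq _ := by
    have key : ∀ r s, 0 < r → ray c θ r ∈ S → ray c θ s ∈ S → r < s →
        H (ray c θ r) < H (ray c θ s) := by
      intro r s hr hrS hsS hrs
      refine strictMonoOn_of_deriv_pos (convex_Icc r s) (continuous_H_ray c θ).continuousOn
        (fun t ht => ?_) (left_mem_Icc.2 hrs.le) (right_mem_Icc.2 hrs.le) hrs
      rw [interior_Icc] at ht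
      have ht0 : 0 < t := hr.trans ht.1
      rw [(hasDerivAt_H_ray c θ ht0.ne').deriv]
      refine div_pos (hpos _ (hconv θ r s t hrS hsS ht.1 ht.2) ?_) ht0
      rw [sqDist_ray]; positivity
    rcases lt_trichotomy r s with h | h | h
    · exact absurd heq (key r s hr hrS hsS h).ne
    · exact h
    · exact absurd heq (key s r hs hsS hrS h).ne'
  radial_pos p hp hH := by
    refine hpos p hp (lt_of_le_of_ne (by unfold sqDist; positivity) fun h => ?_)
    have h1 : p.1 - c = 0 := by
      unfold sqDist at h
      nlinarith [sq_nonneg (p.1 - c), sq_nonneg p.2]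
    have h2 : p.2 = 0 := by
      unfold sqDist at h
      nlinarith [sq_nonneg (p.1 - c), sq_nonneg p.2]
    have : p = (c, 0) := Prod.ext (by simpa using sub_eq_zero.1 h1) h2
    exact absurd hH.1 (by rw [this]; exact lt_irrefl _)

theorem H_nonneg_of_fst_eq_zero {p : ℝ × ℝ} (hp : p.1 = 0) : 0 ≤ H p := by
  have : H p = p.2 ^ 2 / 2 := by simp only [H, hp]; ring
  rw [this]; positivity

/-- `dV x = x (x + 1) (x - lam)`, so about `(-1, 0)` the first term of `radial` is `(x + 1)²` times
a factor that is positive for `x < 0`. A ray pointing away from the `y`-axis has `H ≥ 0` at radius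
`1`; any other ray meets the axis, where `H = y² / 2`. -/
theorem isPolarAnnulus_left : IsPolarAnnulus (-1) {p | p.1 < 0} (H (-1, 0)) 0 := by
  refine isPolarAnnulus_of_center (isOpen_lt continuous_fst continuous_const) ?_ ?_ ?_
  · intro θ r s t hr hs hrt hts
    simp only [mem_ofPred_eq, ray] at *
    rcases le_total 0 (Real.cos θ) with h | h <;> nlinarith
  · intro p hp h
    simp only [mem_ofPred_eq] at hp
    have e : radial (-1) p = (p.1 + 1) ^ 2 * (-p.1 * (lam - p.1)) + p.2 ^ 2 := by
      unfold radial dV; ring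
    have hk : 0 < -p.1 * (lam - p.1) := mul_pos (by linarith) (by norm_num [lam]; linarith)
    unfold sqDist at h
    rw [sub_neg_eq_add] at h
    rw [e]
    rcases (sq_nonneg (p.1 + 1)).eq_or_lt with h0 | h0
    · rw [← h0] at h ⊢; simpa using h
    · exact add_pos_of_pos_of_nonneg (mul_pos h0 hk) (sq_nonneg _)
  · intro θ
    rcases le_or_gt (Real.cos θ) 0 with h | h
    · refine ⟨1, one_pos, ?_, fun r hr _ => ?_⟩
      · simp only [H, ray, lam]
        have h1 := Real.neg_one_le_cos θ
        have h2 := Real.sin_sq_add_cos_sq θ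
        generalize Real.cos θ = u at *
        have : Real.sin θ ^ 2 = 1 - u ^ 2 := by linarith
        rw [one_mul, one_mul, this]
        nlinarith [sq_nonneg u, mul_nonneg (neg_nonneg.2 h) (sq_nonneg u), sq_nonneg (u ^ 2)]
      · simp only [mem_ofPred_eq, ray]; nlinarith
    · refine ⟨1 / Real.cos θ, one_div_pos.2 h, ?_, fun r hr h1 => ?_⟩
      · have : -1 + 1 / Real.cos θ * Real.cos θ = 0 := by field_simp; norm_num
        exact H_nonneg_of_fst_eq_zero this
      · rw [lt_div_iff₀ h] at h1
        simp only [mem_ofPred_eq, ray]; linarith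

theorem isPolarAnnulus_right : IsPolarAnnulus lam {p | 0 < p.1} (H (lam, 0)) 0 := by
  have hlam : 0 < lam := by norm_num [lam]
  refine isPolarAnnulus_of_center (isOpen_lt continuous_const continuous_fst) ?_ ?_ ?_
  · intro θ r s t hr hs hrt hts
    simp only [mem_ofPred_eq, ray] at *
    rcases le_total 0 (Real.cos θ) with h | h <;> nlinarith
  · intro p hp h
    simp only [mem_ofPred_eq] at hp
    have e : radial lam p = (p.1 - lam) ^ 2 * (p.1 * (p.1 + 1)) + p.2 ^ 2 := by
      unfold radial dV; ring
    have hk : 0 < p.1 * (p.1 + 1) := mul_pos hp (by linarith)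
    unfold sqDist at h
    rw [e]
    rcases (sq_nonneg (p.1 - lam)).eq_or_lt with h0 | h0
    · rw [← h0] at h ⊢; simpa using h
    · exact add_pos_of_pos_of_nonneg (mul_pos h0 hk) (sq_nonneg _)
  · intro θ
    rcases le_or_gt 0 (Real.cos θ) with h | h
    · refine ⟨1, one_pos, ?_, fun r hr _ => ?_⟩
      · simp only [H, ray, lam]
        have h1 := Real.cos_le_one θ
        have h2 := Real.sin_sq_add_cos_sq θ
        generalize Real.cos θ = u at *
        have : Real.sin θ ^ 2 = 1 - u ^ 2 := by linarith
        rw [one_mul, one_mul, this]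
        nlinarith [sq_nonneg u, mul_nonneg h (sq_nonneg u), sq_nonneg (u ^ 2)]
      · simp only [mem_ofPred_eq, ray]; nlinarith
    · have h' : 0 < -Real.cos θ := by linarith
      refine ⟨lam / -Real.cos θ, by positivity, ?_, fun r hr h1 => ?_⟩
      · have : lam + lam / -Real.cos θ * Real.cos θ = 0 := by
          have := h.ne
          field_simp; norm_num
        exact H_nonneg_of_fst_eq_zero this
      · rw [lt_div_iff₀ h'] at h1
        simp only [mem_ofPred_eq, ray]; linarith

/-- The origin is a saddle, so `H` is not monotone along all the rays from it. Still `radial = 2 H +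
x³ / 60 + x⁴ / 2`, and the last two terms stay above `-0.02`. For uniqueness, the terms quadratic in
the radius are eliminated between two points of one ray on the same level. -/
theorem isPolarAnnulus_outer : IsPolarAnnulus 0 {p | 0.01 < H p} 0.01 1 where
  isOpen := isOpen_lt continuous_const continuous_H
  exists_ray θ h hh := by
    have h3 : 1 ≤ H (ray 0 θ 3) := by
      simp only [H, ray, lam]
      have h1 := Real.neg_one_le_cos θ
      have h2 := Real.sin_sq_add_cos_sq θ
      generalize Real.cos θ = u at *
      have : Real.sin θ ^ 2 = 1 - u ^ 2 := by linarith
      rw [mul_pow, this]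
      nlinarith [sq_nonneg (u ^ 2 - 1 / 5), mul_nonneg (by linarith : 0 ≤ 1 + u) (sq_nonneg u)]
    obtain ⟨r, hr, hrh⟩ := intermediate_value_Ioo (by norm_num : (0 : ℝ) ≤ 3)
      (continuous_H_ray 0 θ).continuousOn
      ⟨by rw [H_ray_zero]; exact lt_trans (by norm_num [H]) hh.1, hh.2.trans_le h3⟩
    exact ⟨r, hr.1, by simpa only [mem_ofPred_eq, hrh] using hh.1, hrh⟩
  unique θ r s hr hs _ _ heq hH := by
    have key : ∀ r, H (ray 0 θ r) = r ^ 2 * (Real.sin θ ^ 2 / 2 - lam / 2 * Real.cos θ ^ 2) +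
        (r * Real.cos θ) ^ 3 / 60 + (r * Real.cos θ) ^ 4 / 4 := fun r => by
      simp only [H, ray, lam]; ring
    have h0 := hH.1
    by_contra hne
    have h1 : H (ray 0 θ r) * (r + s) + (r * s) ^ 2 *
        (Real.cos θ ^ 3 / 60 + Real.cos θ ^ 4 / 4 * (r + s)) = 0 := by
      refine (mul_eq_zero.1 (?_ : (s - r) * _ = 0)).resolve_left (sub_ne_zero.2 (Ne.symm hne))
      have : (s - r) * (H (ray 0 θ r) * (r + s)) =
          s ^ 2 * H (ray 0 θ r) - r ^ 2 * H (ray 0 θ s) := by rw [← heq]; ring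
      rw [mul_add, this, key, key]
      ring
    generalize H (ray 0 θ r) = h at *
    generalize Real.cos θ = c at *
    have hrs : 0 < r + s := add_pos hr hs
    have hh : 0 < h := lt_trans (by norm_num) h0
    rcases le_or_gt 0 c with hc | hc
    · have := mul_pos hh hrs
      have : 0 ≤ (r * s) ^ 2 * (c ^ 3 / 60 + c ^ 4 / 4 * (r + s)) := by positivity
      linarith
    · obtain ⟨d, hd, rfl⟩ : ∃ d > 0, c = -d := ⟨-c, by linarith, by ring⟩
      -- In these quantities the relation reads `h t + q² (t / 4 - 1 / 60) = 0`, with `q ≤ t² / 4`.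
      -- The second term can be negative only for `t < 1 / 15`, and then `q² / 60` is too small to
      -- cancel `h t`.
      set t := d * (r + s) with ht
      set q := d ^ 2 * (r * s) with hq
      have ht0 : 0 < t := by positivity
      have hq0 : 0 < q := by positivity
      have hqt : 4 * q ≤ t ^ 2 := by
        rw [ht, hq]; nlinarith [mul_nonneg (sq_nonneg d) (sq_nonneg (r - s))]
      have h2 : h * t + q ^ 2 * (t / 4 - 1 / 60) = 0 := by
        have : h * t + q ^ 2 * (t / 4 - 1 / 60) = d * (h * (r + s) + (r * s) ^ 2 *
          ((-d) ^ 3 / 60 + (-d) ^ 4 / 4 * (r + s))) := by rw [ht, hq]; ring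
        rw [this, h1, mul_zero]
      rcases le_or_gt (1 / 15) t with h3 | h3
      · have : 0 ≤ q ^ 2 * (t / 4 - 1 / 60) := mul_nonneg (sq_nonneg _) (by linarith)
        nlinarith
      · have h4 : q ≤ t := by nlinarith
        have h5 : q ≤ 1 := by nlinarith
        have h6 : q ^ 2 * (1 / 60) ≤ t * (1 / 60) := by nlinarith
        nlinarith [mul_pos (mul_pos hq0 hq0) ht0]
  radial_pos p hp _ := by
    simp only [mem_ofPred_eq, H, lam] at hp
    simp only [radial, dV, lam]
    nlinarith [sq_nonneg (p.1 ^ 2 - 1 / 50), sq_nonneg (p.1 ^ 2 + p.1)]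

/-! ### Positivity of polynomials with integer coefficients on an interval -/

/-- The value at `x` of the polynomial with the coefficients `l`, the constant term first. -/
noncomputable def ev : List ℤ → ℝ → ℝ
  | [], _ => 0
  | c :: l, x => c + x * ev l x

def padd : List ℤ → List ℤ → List ℤ
  | [], m => m
  | c :: l, [] => c :: l
  | c :: l, d :: m => (c + d) :: padd l m

def psmul (k : ℤ) : List ℤ → List ℤ
  | [] => []
  | c :: l => k * c :: psmul k l

def pmul : List ℤ → List ℤ → List ℤ
  | [], _ => []
  | c :: l, m => padd (psmul c m) (0 :: pmul l m)

def pderiv : List ℤ → List ℤ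
  | [] => []
  | _ :: l => padd l (0 :: pderiv l)

/-- The Taylor expansion at `a`. -/
def pshift (a : ℤ) : List ℤ → List ℤ
  | [] => []
  | c :: l => padd (c :: pshift a l) (psmul a (pshift a l))

/-- The coefficients of `(1 + t) ^ n`. -/
def ppow : ℕ → List ℤ
  | 0 => [1]
  | n + 1 => padd (0 :: ppow n) (ppow n)

/-- The coefficients of `(1 + t) ^ n p(d / (1 + t))`, where `n` is the length of `p`. -/
def pmobius (d : ℤ) : List ℤ → List ℤ
  | [] => []
  | c :: l => padd (psmul c (ppow (l.length + 1))) (psmul d (pmobius d l))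

def allPos : List ℤ → Bool
  | [] => true
  | c :: l => decide (0 < c) && allPos l

/-- A sufficient condition for positivity on the interval from `a` to the last point of the list of
subdivision points. -/
def posOn (l : List ℤ) : ℤ → List ℤ → Bool
  | _, [] => true
  | a, b :: bs => allPos (pmobius (b - a) (pshift a l)) &&
      !(pmobius (b - a) (pshift a l)).isEmpty && posOn l b bs

theorem ev_padd (l m : List ℤ) (x : ℝ) : ev (padd l m) x = ev l x + ev m x := by
  induction l, m using padd.induct with
  | case1 m => simp [padd, ev]
  | case2 c l => simp [padd, ev]
  | case3 c l d m ih => simp only [padd, ev, ih]; push_cast; ring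

theorem ev_psmul (k : ℤ) (l : List ℤ) (x : ℝ) : ev (psmul k l) x = k * ev l x := by
  induction l with
  | nil => simp [psmul, ev]
  | cons c l ih => simp only [psmul, ev, ih]; push_cast; ring

theorem ev_pmul (l m : List ℤ) (x : ℝ) : ev (pmul l m) x = ev l x * ev m x := by
  induction l with
  | nil => simp [pmul, ev]
  | cons c l ih => simp only [pmul, ev, ev_padd, ev_psmul, ih]; push_cast; ring

theorem hasDerivAt_ev (l : List ℤ) (x : ℝ) : HasDerivAt (ev l) (ev (pderiv l) x) x := by
  induction l with
  | nil => simpa [ev, pderiv] using hasDerivAt_const x (0 : ℝ)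
  | cons c l ih =>
    refine (((hasDerivAt_id x).mul ih).const_add (c : ℝ)).congr_deriv ?_
    simp [pderiv, ev, ev_padd]

theorem continuous_ev (l : List ℤ) : Continuous (ev l) :=
  continuous_iff_continuousAt.2 fun x => (hasDerivAt_ev l x).continuousAt

theorem ev_pshift (a : ℤ) (l : List ℤ) (x : ℝ) : ev (pshift a l) x = ev l (a + x) := by
  induction l with
  | nil => simp [pshift, ev]
  | cons c l ih => simp only [pshift, ev, ev_padd, ev_psmul, ih]; ring

theorem ev_ppow (n : ℕ) (t : ℝ) : ev (ppow n) t = (1 + t) ^ n := by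
  induction n with
  | zero => simp [ppow, ev]
  | succ n ih => simp only [ppow, ev, ev_padd, ih]; push_cast; ring

theorem ev_pmobius (d : ℤ) (l : List ℤ) {t : ℝ} (ht : 1 + t ≠ 0) :
    ev (pmobius d l) t = (1 + t) ^ l.length * ev l (d / (1 + t)) := by
  induction l with
  | nil => simp [pmobius, ev]
  | cons c l ih =>
    simp only [pmobius, ev, ev_padd, ev_psmul, ev_ppow, ih, List.length_cons]
    field_simp
    ring

theorem ev_nonneg_of_allPos {l : List ℤ} (hl : allPos l = true) {t : ℝ} (ht : 0 ≤ t) :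
    0 ≤ ev l t := by
  induction l with
  | nil => exact le_rfl
  | cons c l ih =>
    simp only [allPos, Bool.and_eq_true, decide_eq_true_eq] at hl
    have : (0 : ℝ) < c := by exact_mod_cast hl.1
    exact add_nonneg this.le (mul_nonneg ht (ih hl.2))

/-- A point of `(a, b]` is `a + (b - a) / (1 + t)` with `t ≥ 0`; after clearing denominators the
polynomial becomes one in `t`, and positive coefficients suffice. The left end corresponds to
infinite `t`, hence the half-open intervals; interior subdivision points are covered as right ends.
-/
theorem ev_pos_of_posOn {l : List ℤ} {a : ℤ} {bs : List ℤ} (h : posOn l a bs = true) {x : ℝ}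
    (ha : a < x) (hb : x ≤ bs.getLastD a) : 0 < ev l x := by
  induction bs generalizing a with
  | nil => exact absurd hb (not_le.2 ha)
  | cons b bs ih =>
    simp only [posOn, Bool.and_eq_true] at h
    obtain ⟨⟨h1, h2⟩, h3⟩ := h
    rw [List.getLastD_cons] at hb
    rcases lt_or_ge (b : ℝ) x with hx | hx
    · exact ih h3 hx hb
    have hxa : 0 < x - a := sub_pos.2 ha
    set t : ℝ := (b - x) / (x - a) with ht
    have ht0 : 0 ≤ t := div_nonneg (sub_nonneg.2 hx) hxa.le
    have hdt : ((b - a : ℤ) : ℝ) / (1 + t) = x - a := by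
      have : 1 + t = (b - a) / (x - a) := by rw [ht]; field_simp; ring
      rw [this]
      have : (b : ℝ) - a ≠ 0 := by linarith
      push_cast
      field_simp
    have key := ev_pmobius (b - a) (pshift a l) (t := t) (by positivity)
    rw [hdt, ev_pshift, add_sub_cancel] at key
    have hpos : 0 < ev (pmobius (b - a) (pshift a l)) t := by
      generalize pmobius (b - a) (pshift a l) = m at *
      cases m with
      | nil => simp at h2
      | cons c m =>
        simp only [allPos, Bool.and_eq_true, decide_eq_true_eq] at h1
        have : (0 : ℝ) < c := by exact_mod_cast h1.1
        exact add_pos_of_pos_of_nonneg this (mul_nonneg ht0 (ev_nonneg_of_allPos h1.2 ht0))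
    rw [key] at hpos
    exact pos_of_mul_pos_right hpos (by positivity)

/-! ### The Abelian integral and its derivative up to exact forms

Modulo an exact form `d(y w(x))`, the integrands are polynomials in `x` on a level `H = k / 200`.
The polynomials below are written in the variable `X = 100 x`. -/

/-- `300 * 100 ^ 4 * y ^ 2` on the level `k / 200`. -/
def sqPoly (k : ℤ) : List ℤ := [300000000 * k, 0, 2850000, -1000, -150]

/-- `10 ^ 8 * (α + β x + γ x ^ 2)`. -/
def quadPoly : List ℤ := [43849050000, -25246900, -4527899]

/-- `20 * 100 ^ 3 * dV x`. -/
def dVPoly : List ℤ := [0, -190000, 100, 20]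

/-- The integrand `y g` plus the exact correction with `w = ev l / (9 * 10 ^ 16 * q)`, where `y²` is
replaced by its value on the level and denominators are cleared. The list `l` acts as a certificate
with denominator `q`. -/
def intPoly (k q : ℤ) (l : List ℤ) : List ℤ :=
  padd (psmul q (padd (psmul 9000000 (pmul (sqPoly k) quadPoly))
    (psmul (-7410341) (pmul (sqPoly k) (sqPoly k)))))
    (padd (psmul 15 (pmul dVPoly l)) (psmul (-1) (pmul (sqPoly k) (pderiv l))))

/-- The counterpart of `intPoly` for the divergence, with `w = ev l / (10 ^ 6 * q)`. -/
def derivPoly (k q : ℤ) (l : List ℤ) : List ℤ :=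
  padd (psmul q (padd (psmul 3000000 quadPoly) (psmul (-7410341) (sqPoly k))))
    (padd (psmul 15 (pmul dVPoly l)) (psmul (-1) (pmul (sqPoly k) (pderiv l))))

/-- `27 * 10 ^ 24 * (300 * 100 ^ 4) * q` times the polynomial `f * sqDist 0 - (n / 10) * radial 0`,
where `f` is represented by `intPoly k q l`. -/
def boundPoly (k q n : ℤ) (l : List ℤ) : List ℤ :=
  padd (pmul (intPoly k q l) (padd [0, 0, 3000000] (sqPoly k)))
    (psmul (-27 * 10 ^ 23 * n * q) (padd (0 :: psmul 15 dVPoly) (sqPoly k)))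

theorem ev_sqPoly {k : ℤ} {p : ℝ × ℝ} (hp : H p = k / 200) :
    ev (sqPoly k) (100 * p.1) = 300 * 100 ^ 4 * p.2 ^ 2 := by
  have h1 : p.2 ^ 2 = 2 * (k / 200 - (p.1 ^ 4 / 4 + (1 - lam) / 3 * p.1 ^ 3 - lam / 2 * p.1 ^ 2)) := by
    rw [← hp, H]; ring
  rw [h1]
  simp only [ev, sqPoly, lam]
  push_cast
  ring

theorem ev_cons (c : ℤ) (l : List ℤ) (x : ℝ) : ev (c :: l) x = c + x * ev l x := rfl

theorem ev_quadPoly (x : ℝ) : ev quadPoly (100 * x) = 10 ^ 8 * (α + β * x + γ * x ^ 2) := by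
  simp only [ev, quadPoly, α, β, γ]; push_cast; ring

theorem ev_dVPoly (x : ℝ) : ev dVPoly (100 * x) = 20 * 100 ^ 3 * dV x := by
  simp only [ev, dVPoly, dV, lam]; push_cast; ring

theorem hasDerivAt_ev_mul (κ : ℝ) (l : List ℤ) (x : ℝ) :
    HasDerivAt (fun x => κ * ev l (100 * x)) (κ * (100 * ev (pderiv l) (100 * x))) x := by
  have := (((hasDerivAt_ev l (100 * x)).comp x ((hasDerivAt_id x).const_mul 100))).const_mul κ
  refine this.congr_deriv ?_
  simp only [mul_one]; ring

theorem ev_intPoly {k q : ℤ} (hq : q ≠ 0) (l : List ℤ) {p : ℝ × ℝ} (hp : H p = k / 200) :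
    ev (intPoly k q l) (100 * p.1) = 27 * 10 ^ 24 * q * (p.2 * g p +
      (dV p.1 * ((9 * 10 ^ 16 * q : ℝ)⁻¹ * ev l (100 * p.1)) -
        p.2 ^ 2 * ((9 * 10 ^ 16 * q : ℝ)⁻¹ * (100 * ev (pderiv l) (100 * p.1))))) := by
  have : (q : ℝ) ≠ 0 := by exact_mod_cast hq
  simp only [intPoly, ev_padd, ev_psmul, ev_pmul, ev_sqPoly hp, ev_quadPoly, ev_dVPoly, g, δ]
  field_simp
  push_cast
  ring

/-- The divergence is affine in `y²` and `y²` is affine in the level. With `w` fixed, the polynomial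
of an intermediate level is thus a convex combination of those of the end levels, and positivity at
both ends carries over. -/
theorem ev_derivPoly {k m q : ℤ} (hq : q ≠ 0) (l : List ℤ) {p : ℝ × ℝ} {s t : ℝ} (hst : s + t = 1)
    (hp : H p = s * (k / 200) + t * (m / 200)) :
    s * ev (derivPoly k q l) (100 * p.1) + t * ev (derivPoly m q l) (100 * p.1) =
      3 * 10 ^ 14 * q * (divg p + (dV p.1 * ((10 ^ 6 * q : ℝ)⁻¹ * ev l (100 * p.1)) -
        p.2 ^ 2 * ((10 ^ 6 * q : ℝ)⁻¹ * (100 * ev (pderiv l) (100 * p.1))))) := by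
  have : (q : ℝ) ≠ 0 := by exact_mod_cast hq
  have hy : 300 * 100 ^ 4 * p.2 ^ 2 =
      s * ev (sqPoly k) (100 * p.1) + t * ev (sqPoly m) (100 * p.1) := by
    have h1 : p.2 ^ 2 = 2 * (H p - (s + t) * (p.1 ^ 4 / 4 + (1 - lam) / 3 * p.1 ^ 3 - lam / 2 * p.1 ^ 2)) := by
      rw [H, hst]; ring
    rw [h1, hp]
    simp only [ev, sqPoly, lam]
    push_cast
    ring
  have hy' : p.2 ^ 2 = (s * ev (sqPoly k) (100 * p.1) + t * ev (sqPoly m) (100 * p.1)) / (300 * 100 ^ 4) := by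
    rw [← hy]; ring
  simp only [derivPoly, ev_padd, ev_psmul, ev_pmul, ev_quadPoly, ev_dVPoly, divg, δ]
  rw [hy']
  obtain rfl : t = 1 - s := by linarith
  field_simp
  push_cast
  ring

namespace IsPolarAnnulus

variable {c a b : ℝ} {S : Set (ℝ × ℝ)}

/-- The freedom in `w` serves to replace an integrand of varying sign by one of constant sign. -/
theorem integral_add_exact (hA : IsPolarAnnulus c S a b) {h : ℝ} (hh : h ∈ Ioo a b)
    {f : ℝ × ℝ → ℝ} (hf : Continuous f) {w w' : ℝ → ℝ} (hw : ∀ x, HasDerivAt w (w' x) x)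
    (hc : Continuous w') :
    ∫ θ in 0..2 * Real.pi, f (pt c S θ h) * (sqDist c (pt c S θ h) / radial c (pt c S θ h)) =
      ∫ θ in 0..2 * Real.pi, (f (pt c S θ h) + (dV (pt c S θ h).1 * w (pt c S θ h).1 -
        (pt c S θ h).2 ^ 2 * w' (pt c S θ h).1)) *
          (sqDist c (pt c S θ h) / radial c (pt c S θ h)) := by
  have hwc : Continuous w := continuous_iff_continuousAt.2 fun x => (hw x).continuousAt
  have hdV := continuous_dV
  simp only [add_mul]
  rw [intervalIntegral.integral_add
      ((hA.continuous_comp_mul_sqDist_div hh hf).intervalIntegrable _ _)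
      ((hA.continuous_comp_mul_sqDist_div hh
        (f := fun p => dV p.1 * w p.1 - p.2 ^ 2 * w' p.1) (by fun_prop)).intervalIntegrable _ _),
    hA.integral_exact_eq_zero hh hw hc, add_zero]

theorem integral_pos (hA : IsPolarAnnulus c S a b) {h : ℝ} (hh : h ∈ Ioo a b)
    {f : ℝ × ℝ → ℝ} (hf : Continuous f) (hpos : ∀ p ∈ S, H p = h → 0 < f p) :
    0 < ∫ θ in 0..2 * Real.pi,
      f (pt c S θ h) * (sqDist c (pt c S θ h) / radial c (pt c S θ h)) := by
  refine intervalIntegral.intervalIntegral_pos_of_pos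
    ((hA.continuous_comp_mul_sqDist_div hh hf).intervalIntegrable _ _) (fun θ => ?_)
    Real.two_pi_pos
  have := hA.rho_spec θ hh
  exact mul_pos (hpos _ this.2.1 this.2.2)
    (div_pos (hA.sqDist_pt_pos θ hh) (hA.radial_pt_pos θ hh))

theorem avg_zero_eq (c : ℝ) (p : ℝ × ℝ) :
    avg c 0 p = p.2 * g p * (sqDist c p / radial c p) := by
  rw [avg, den_zero, mul_div_assoc]

/-- The sign of the Abelian integral on the level `k / 200`. -/
theorem integral_avg_pos (hA : IsPolarAnnulus c S a b) {h : ℝ} (hh : h ∈ Ioo a b) {k q : ℤ}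
    (hk : h = k / 200) (hq : 0 < q) {σ : ℤ} (l : List ℤ)
    (hpos : ∀ p ∈ S, H p = h → 0 < ev (psmul σ (intPoly k q l)) (100 * p.1)) :
    0 < σ * ∫ θ in 0..2 * Real.pi, avg c 0 (pt c S θ h) := by
  have hg := continuous_g
  have hdV := continuous_dV
  have hl := continuous_ev l
  have hl' := continuous_ev (pderiv l)
  have hq' : (0 : ℝ) < q := by exact_mod_cast hq
  simp only [avg_zero_eq]
  rw [hA.integral_add_exact hh (f := fun p => p.2 * g p) (by fun_prop)
    (hasDerivAt_ev_mul (9 * 10 ^ 16 * q : ℝ)⁻¹ l) (by fun_prop),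
    ← intervalIntegral.integral_const_mul]
  simp only [← mul_assoc (σ : ℝ)]
  refine hA.integral_pos hh (f := fun p => σ * (p.2 * g p +
      (dV p.1 * ((9 * 10 ^ 16 * q : ℝ)⁻¹ * ev l (100 * p.1)) -
        p.2 ^ 2 * ((9 * 10 ^ 16 * q : ℝ)⁻¹ * (100 * ev (pderiv l) (100 * p.1))))))
    (by fun_prop) fun p hp hH => ?_
  have := hpos p hp hH
  rw [ev_psmul, ev_intPoly hq.ne' l (hH.trans hk), mul_left_comm] at this
  exact pos_of_mul_pos_right this (by positivity)

/-- The sign of the derivative of the Abelian integral on the levels in `[k / 200, m / 200]`. -/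
theorem integral_avgDeriv_pos (hA : IsPolarAnnulus c S a b) {h : ℝ} (hh : h ∈ Ioo a b) {k m q : ℤ}
    (hk : h ∈ Ioo (k / 200 : ℝ) (m / 200)) (hq : 0 < q) {σ : ℤ} (l : List ℤ)
    (hpos : ∀ p ∈ S, H p = h → 0 < ev (psmul σ (derivPoly k q l)) (100 * p.1) ∧
      0 < ev (psmul σ (derivPoly m q l)) (100 * p.1)) :
    0 < σ * ∫ θ in 0..2 * Real.pi, avgDeriv c 0 (pt c S θ h) := by
  have hg := continuous_divg
  have hdV := continuous_dV
  have hl := continuous_ev l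
  have hl' := continuous_ev (pderiv l)
  have hq' : (0 : ℝ) < q := by exact_mod_cast hq
  have hkm : (0 : ℝ) < m / 200 - k / 200 := by linarith [hk.1, hk.2]
  rw [hA.integral_avgDeriv hh, hA.integral_add_exact hh (f := divg) hg
    (hasDerivAt_ev_mul (10 ^ 6 * q : ℝ)⁻¹ l) (by fun_prop),
    ← intervalIntegral.integral_const_mul]
  simp only [← mul_assoc (σ : ℝ)]
  refine hA.integral_pos hh (f := fun p => σ * (divg p +
      (dV p.1 * ((10 ^ 6 * q : ℝ)⁻¹ * ev l (100 * p.1)) -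
        p.2 ^ 2 * ((10 ^ 6 * q : ℝ)⁻¹ * (100 * ev (pderiv l) (100 * p.1))))))
    (by fun_prop) fun p hp hH => ?_
  obtain ⟨h1, h2⟩ := hpos p hp hH
  set t := (h - k / 200) / (m / 200 - k / 200) with ht
  have ht0 : 0 < t := div_pos (by linarith [hk.1]) hkm
  have ht1 : t < 1 := by rw [ht, div_lt_one hkm]; linarith [hk.2]
  have := ev_derivPoly hq.ne' l (p := p) (k := k) (m := m) (s := 1 - t) (t := t) (by ring) (by
    have : t * (m / 200 - k / 200) = h - k / 200 := div_mul_cancel₀ _ hkm.ne'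
    linarith)
  rw [ev_psmul] at h1 h2
  have h3 : 0 < σ * ((1 - t) * ev (derivPoly k q l) (100 * p.1) +
      t * ev (derivPoly m q l) (100 * p.1)) := by
    nlinarith [mul_pos (sub_pos.2 ht1) h1, mul_pos ht0 h2]
  rw [this, mul_left_comm] at h3
  exact pos_of_mul_pos_right h3 (by positivity)

/-- A bound for the Abelian integral over the outer oval on the level `k / 200`. -/
theorem bound_integral_avg {a b : ℝ} (hA : IsPolarAnnulus 0 S a b) {h : ℝ} (hh : h ∈ Ioo a b)
    {k q : ℤ} (hk : h = k / 200) (hq : 0 < q) {σ n : ℤ} (l : List ℤ)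
    (hpos : ∀ p ∈ S, H p = h → 0 < ev (psmul σ (boundPoly k q n l)) (100 * p.1)) :
    0 < σ * ((∫ θ in 0..2 * Real.pi, avg 0 0 (pt 0 S θ h)) - n / 10 * (2 * Real.pi)) := by
  have hg := continuous_g
  have hdV := continuous_dV
  have hl := continuous_ev l
  have hl' := continuous_ev (pderiv l)
  have hq' : (0 : ℝ) < q := by exact_mod_cast hq
  set f : ℝ × ℝ → ℝ := fun p => p.2 * g p +
      (dV p.1 * ((9 * 10 ^ 16 * q : ℝ)⁻¹ * ev l (100 * p.1)) -
        p.2 ^ 2 * ((9 * 10 ^ 16 * q : ℝ)⁻¹ * (100 * ev (pderiv l) (100 * p.1)))) with hf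
  have hfc : Continuous f := by fun_prop
  have h1 := hA.continuous_comp_mul_sqDist_div hh hfc
  simp only [avg_zero_eq]
  rw [hA.integral_add_exact hh (f := fun p => p.2 * g p) (by fun_prop)
    (hasDerivAt_ev_mul (9 * 10 ^ 16 * q : ℝ)⁻¹ l) (by fun_prop)]
  have e : (n / 10 : ℝ) * (2 * Real.pi) = ∫ _ in 0..2 * Real.pi, (n / 10 : ℝ) := by
    rw [intervalIntegral.integral_const]; simp; ring
  rw [e, ← intervalIntegral.integral_sub (h1.intervalIntegrable _ _)
    (continuous_const.intervalIntegrable _ _), ← intervalIntegral.integral_const_mul]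
  refine intervalIntegral.intervalIntegral_pos_of_pos
    ((continuous_const.mul (h1.sub continuous_const)).intervalIntegrable _ _) (fun θ => ?_)
    Real.two_pi_pos
  obtain ⟨-, hS, hH⟩ := hA.rho_spec θ hh
  have hR := hA.radial_pt_pos θ hh
  have := hpos _ hS hH
  change 0 < (σ : ℝ) * (f (pt 0 S θ h) * (sqDist 0 (pt 0 S θ h) / radial 0 (pt 0 S θ h)) - n / 10)
  generalize pt 0 S θ h = p at *
  -- Multiplication by `radial > 0` turns the pointwise comparison of `f * sqDist / radial` with `n
  -- / 10` into a polynomial inequality.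
  have key : ev (boundPoly k q n l) (100 * p.1) =
      81 * 10 ^ 34 * q * (f p * sqDist 0 p - n / 10 * radial 0 p) := by
    have e1 := ev_intPoly hq.ne' l (hH.trans hk)
    rw [boundPoly, ev_padd, ev_pmul, e1, ev_padd, ev_sqPoly (hH.trans hk), ev_psmul, ev_padd,
      ev_sqPoly (hH.trans hk), ev_cons 0 (psmul 15 dVPoly), ev_psmul, ev_dVPoly]
    simp only [ev, sqDist, radial]
    push_cast
    ring
  rw [ev_psmul, key, mul_left_comm] at this
  have h2 := pos_of_mul_pos_right this (by positivity)
  have h3 : (σ : ℝ) * (f p * (sqDist 0 p / radial 0 p) - n / 10) =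
      σ * (f p * sqDist 0 p - n / 10 * radial 0 p) / radial 0 p := by field_simp
  rw [h3]
  exact div_pos h2 hR

end IsPolarAnnulus

/-! ### The zeros of the Abelian integrals -/

/-- Bounds for the abscissas of the points below the level `k / 200`. -/
theorem mem_Ioc_of_H_le {k a b lo hi : ℤ} {p : ℝ × ℝ} (hp : H p ≤ k / 200)
    (hlo : lo < 100 * p.1) (hhi : 100 * p.1 ≤ hi)
    (ha : posOn (psmul (-1) (sqPoly k)) lo [a] = true)
    (hb : posOn (psmul (-1) (sqPoly k)) b [hi] = true) : 100 * p.1 ∈ Ioc (a : ℝ) b := by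
  -- On or below the level `k / 200` the polynomial `sqPoly k` cannot be negative, so the abscissas
  -- where it is certified negative are excluded.
  have h0 : 0 ≤ ev (sqPoly k) (100 * p.1) := by
    have h1 : ev (sqPoly k) (100 * p.1) =
        300 * 100 ^ 4 * (p.2 ^ 2 + 2 * (k / 200 - H p)) := by
      simp only [ev, sqPoly, H, lam]
      push_cast
      ring
    have := sub_nonneg.2 hp
    rw [h1]; positivity
  refine ⟨lt_of_not_ge fun h => ?_, le_of_not_gt fun h => ?_⟩
  · have := ev_pos_of_posOn ha hlo h
    rw [ev_psmul] at this
    push_cast at this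
    linarith
  · have := ev_pos_of_posOn hb h hhi
    rw [ev_psmul] at this
    push_cast at this
    linarith

theorem abs_fst_lt {p : ℝ × ℝ} (hp : H p ≤ 1) : |p.1| < 3 := by
  simp only [H, lam] at hp
  rw [abs_lt]
  constructor
  · by_contra! h
    nlinarith [sq_nonneg p.2, mul_nonneg (sub_nonneg.2 h) (sub_nonneg.2 h), sq_nonneg (p.1 ^ 2),
      mul_nonneg (sq_nonneg p.1) (sub_nonneg.2 h), mul_nonneg (sq_nonneg p.1) (sq_nonneg (p.1 + 3))]
  · by_contra! h
    nlinarith [sq_nonneg p.2, mul_nonneg (sub_nonneg.2 h) (sub_nonneg.2 h), sq_nonneg (p.1 ^ 2),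
      mul_nonneg (sq_nonneg p.1) (sub_nonneg.2 h), mul_nonneg (sq_nonneg p.1) (sq_nonneg (p.1 - 3))]

namespace IsPolarAnnulus

variable {c a b : ℝ} {S : Set (ℝ × ℝ)}

/-- The intermediate value theorem does not locate the zero, so the sign of the derivative is
certified on all levels between by one multiplier `l` valid at both ends. The range of `x` at the
upper level contains those of the lower ones. -/
theorem exists_simple_zero (hA : IsPolarAnnulus c S a b) {k m : ℤ} (hk : a < k / 200)
    (hkm : (k : ℝ) / 200 ≤ m / 200) (hm : m / 200 < b) {σ A B : ℤ} {q : ℤ} (hq : 0 < q)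
    (hJ : ∀ p ∈ S, H p ≤ m / 200 → 100 * p.1 ∈ Ioc (A : ℝ) B)
    (hIk : 0 < σ * ∫ θ in 0..2 * Real.pi, avg c 0 (pt c S θ (k / 200)))
    (hIm : 0 < (-σ : ℤ) * ∫ θ in 0..2 * Real.pi, avg c 0 (pt c S θ (m / 200)))
    (l : List ℤ) {bs : List ℤ} (hB : bs.getLastD A = B)
    (h1 : posOn (psmul (-σ) (derivPoly k q l)) A bs = true)
    (h2 : posOn (psmul (-σ) (derivPoly m q l)) A bs = true) :
    ∃ h ∈ Ioo (k / 200 : ℝ) (m / 200), (∫ θ in 0..2 * Real.pi, avg c 0 (pt c S θ h)) = 0 ∧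
      σ * ∫ θ in 0..2 * Real.pi, avgDeriv c 0 (pt c S θ h) < 0 := by
  have hc : ContinuousOn (fun h => (σ : ℝ) * ∫ θ in 0..2 * Real.pi, avg c 0 (pt c S θ h))
      (Icc (k / 200) (m / 200)) :=
    continuousOn_const.mul (hA.continuousOn_integral_avg hk hkm hm)
  push_cast at hIm
  obtain ⟨h, hh, h0⟩ := intermediate_value_Ioo' hkm hc (mem_Ioo.2 ⟨by linarith only [hIm], hIk⟩)
  refine ⟨h, hh, (mul_eq_zero.1 h0).resolve_left fun hσ => ?_, ?_⟩
  · rw [hσ, zero_mul] at hIk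
    exact lt_irrefl _ hIk
  · have := hA.integral_avgDeriv_pos ⟨hk.trans hh.1, hh.2.trans hm⟩ hh hq (σ := -σ) l
      fun p hp hH => by
        have hx := hJ p hp (hH.trans_le hh.2.le)
        rw [← hB] at hx
        exact ⟨ev_pos_of_posOn h1 hx.1 hx.2, ev_pos_of_posOn h2 hx.1 hx.2⟩
    push_cast at this
    linarith

theorem integral_avg_pos_of_posOn (hA : IsPolarAnnulus c S a b) {k q : ℤ}
    (hh : (k / 200 : ℝ) ∈ Ioo a b) (hq : 0 < q) {σ A B : ℤ}
    (hJ : ∀ p ∈ S, H p ≤ k / 200 → 100 * p.1 ∈ Ioc (A : ℝ) B)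
    (l : List ℤ) {bs : List ℤ} (hB : bs.getLastD A = B)
    (h1 : posOn (psmul σ (intPoly k q l)) A bs = true) :
    0 < σ * ∫ θ in 0..2 * Real.pi, avg c 0 (pt c S θ (k / 200)) :=
  hA.integral_avg_pos hh rfl hq l fun p hp hH => by
    have hx := hJ p hp hH.le
    rw [← hB] at hx
    exact ev_pos_of_posOn h1 hx.1 hx.2

end IsPolarAnnulus

theorem mem_Ioc_left {k a b : ℤ} (hk : (k : ℝ) / 200 ≤ 0)
    (ha : posOn (psmul (-1) (sqPoly k)) (-300) [a] = true)
    (hb : posOn (psmul (-1) (sqPoly k)) b [0] = true) :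
    ∀ p ∈ {p : ℝ × ℝ | p.1 < 0}, H p ≤ k / 200 → 100 * p.1 ∈ Ioc (a : ℝ) b := fun p hp hH => by
  have h3 := abs_lt.1 (abs_fst_lt (hH.trans (hk.trans zero_le_one)))
  rw [mem_ofPred_eq] at hp
  exact mem_Ioc_of_H_le hH (by push_cast; linarith) (by push_cast; linarith) ha hb

theorem mem_Ioc_right {k a b : ℤ} (hk : (k : ℝ) / 200 ≤ 0)
    (ha : posOn (psmul (-1) (sqPoly k)) 0 [a] = true)
    (hb : posOn (psmul (-1) (sqPoly k)) b [300] = true) :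
    ∀ p ∈ {p : ℝ × ℝ | 0 < p.1}, H p ≤ k / 200 → 100 * p.1 ∈ Ioc (a : ℝ) b := fun p hp hH => by
  have h3 := abs_lt.1 (abs_fst_lt (hH.trans (hk.trans zero_le_one)))
  rw [mem_ofPred_eq] at hp
  exact mem_Ioc_of_H_le hH (by push_cast; linarith) (by push_cast; linarith) ha hb

theorem H_left_lt : H (-1, 0) < -0.2 := by norm_num [H, lam]

theorem H_right_lt : H (lam, 0) < -0.2 := by norm_num [H, lam]

/-- The lists are the multipliers `w` in the variable `100 x`, up to scale: one for the sign of `I`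
at each end level, the last for `I'`. Nothing is required of them beyond the positivity checks. The
lists `bs` cut the range of `100 x` into pieces on which the coefficient test succeeds. -/
theorem exists_simple_zero_left_low : ∃ h ∈ Ioo ((-31 : ℤ) / 200 : ℝ) ((-28 : ℤ) / 200),
    (∫ θ in 0..2 * Real.pi, avg (-1) 0 (pt (-1) {p | p.1 < 0} θ h)) = 0 ∧
      (1 : ℤ) * ∫ θ in 0..2 * Real.pi, avgDeriv (-1) 0 (pt (-1) {p | p.1 < 0} θ h) < 0 := by
  have hJ := mem_Ioc_left (k := -28) (a := -129) (b := -59) (by norm_num) (by decide +kernel)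
    (by decide +kernel)
  have ha := H_left_lt
  have hk : (((-31 : ℤ) : ℝ) / 200) ∈ Ioo (H (-1, 0)) 0 :=
    ⟨by push_cast; linarith, by norm_num⟩
  have hm : (((-28 : ℤ) : ℝ) / 200) ∈ Ioo (H (-1, 0)) 0 :=
    ⟨by push_cast; linarith, by norm_num⟩
  have hkm : (((-31 : ℤ) : ℝ) / 200) ≤ ((-28 : ℤ) : ℝ) / 200 := by norm_num
  exact isPolarAnnulus_left.exists_simple_zero hk.1 hkm hm.2 one_pos hJ
    (isPolarAnnulus_left.integral_avg_pos_of_posOn hk one_pos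
      (fun p hp h => hJ p hp (h.trans hkm))
      [18045386480819977252, 350363444866025769, -78545228622098, -21792218474515, -64673950359]
      (bs := [-84, -59]) rfl (by decide +kernel))
    (isPolarAnnulus_left.integral_avg_pos_of_posOn hm one_pos hJ
      [16685102800886724460, 336088152341722784, -160297431271188, -22157966127692, -65358924571]
      (bs := [-89, -59]) rfl (by decide +kernel))
    [-1385579016, -11296776, -23744] (bs := [-69, -59]) rfl (by decide +kernel)
    (by decide +kernel)

/-- Here `I` passes from negative to positive, hence `σ = -1`. The range of `x` is wider than near
the centre, and the multipliers have one degree more. -/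
theorem exists_simple_zero_left_high : ∃ h ∈ Ioo ((-10 : ℤ) / 200 : ℝ) ((-7 : ℤ) / 200),
    (∫ θ in 0..2 * Real.pi, avg (-1) 0 (pt (-1) {p | p.1 < 0} θ h)) = 0 ∧
      (-1 : ℤ) * ∫ θ in 0..2 * Real.pi, avgDeriv (-1) 0 (pt (-1) {p | p.1 < 0} θ h) < 0 := by
  have hJ := mem_Ioc_left (k := -7) (a := -139) (b := -27) (by norm_num) (by decide +kernel)
    (by decide +kernel)
  have ha := H_left_lt
  have hk : (((-10 : ℤ) : ℝ) / 200) ∈ Ioo (H (-1, 0)) 0 :=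
    ⟨by push_cast; linarith, by norm_num⟩
  have hm : (((-7 : ℤ) : ℝ) / 200) ∈ Ioo (H (-1, 0)) 0 :=
    ⟨by push_cast; linarith, by norm_num⟩
  have hkm : (((-10 : ℤ) : ℝ) / 200) ≤ ((-7 : ℤ) : ℝ) / 200 := by norm_num
  exact isPolarAnnulus_left.exists_simple_zero hk.1 hkm hm.2 one_pos hJ
    (isPolarAnnulus_left.integral_avg_pos_of_posOn hk one_pos
      (fun p hp h => hJ p hp (h.trans hkm))
      [9932575912149945740, 360154509407720902, 1792291915892695, 1275702971615, 62258041866,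
        268170671]
      (bs := [-69, -27]) rfl (by decide +kernel))
    (isPolarAnnulus_left.integral_avg_pos_of_posOn hm one_pos hJ
      [8129827525307764378, 338126852881239776, 1618157139702405, 111423332789, 57556924223,
        259933108]
      (bs := [-59, -27]) rfl (by decide +kernel))
    [-2106655984, -26494166, -151366, -380] (bs := [-59, -32, -27]) rfl (by decide +kernel)
    (by decide +kernel)

theorem exists_simple_zero_right_low : ∃ h ∈ Ioo ((-31 : ℤ) / 200 : ℝ) ((-29 : ℤ) / 200),
    (∫ θ in 0..2 * Real.pi, avg lam 0 (pt lam {p | 0 < p.1} θ h)) = 0 ∧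
      (1 : ℤ) * ∫ θ in 0..2 * Real.pi, avgDeriv lam 0 (pt lam {p | 0 < p.1} θ h) < 0 := by
  have hJ := mem_Ioc_right (k := -29) (a := 63) (b := 119) (by norm_num) (by decide +kernel)
    (by decide +kernel)
  have ha := H_right_lt
  have hk : (((-31 : ℤ) : ℝ) / 200) ∈ Ioo (H (lam, 0)) 0 :=
    ⟨by push_cast; linarith, by norm_num⟩
  have hm : (((-29 : ℤ) : ℝ) / 200) ∈ Ioo (H (lam, 0)) 0 :=
    ⟨by push_cast; linarith, by norm_num⟩
  have hkm : (((-31 : ℤ) : ℝ) / 200) ≤ ((-29 : ℤ) : ℝ) / 200 := by norm_num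
  exact isPolarAnnulus_right.exists_simple_zero hk.1 hkm hm.2 one_pos hJ
    (isPolarAnnulus_right.integral_avg_pos_of_posOn hk one_pos
      (fun p hp h => hJ p hp (h.trans hkm))
      [-17978975272519732299, 356271139495077057, -192165136766827, -20623270627465, 63831549577]
      (bs := [108, 119]) rfl (by decide +kernel))
    (isPolarAnnulus_right.integral_avg_pos_of_posOn hm one_pos hJ
      [-17103455796783913371, 347142000677529320, -140564835487788, -20858604139809, 64284733738]
      (bs := [108, 119]) rfl (by decide +kernel))
    [1361424463, -11306866, 24483] (bs := [119]) rfl (by decide +kernel) (by decide +kernel)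

theorem exists_simple_zero_right_high : ∃ h ∈ Ioo ((-12 : ℤ) / 200 : ℝ) ((-10 : ℤ) / 200),
    (∫ θ in 0..2 * Real.pi, avg lam 0 (pt lam {p | 0 < p.1} θ h)) = 0 ∧
      (-1 : ℤ) * ∫ θ in 0..2 * Real.pi, avgDeriv lam 0 (pt lam {p | 0 < p.1} θ h) < 0 := by
  have hJ := mem_Ioc_right (k := -10) (a := 33) (b := 131) (by norm_num) (by decide +kernel)
    (by decide +kernel)
  have ha := H_right_lt
  have hk : (((-12 : ℤ) : ℝ) / 200) ∈ Ioo (H (lam, 0)) 0 :=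
    ⟨by push_cast; linarith, by norm_num⟩
  have hm : (((-10 : ℤ) : ℝ) / 200) ∈ Ioo (H (lam, 0)) 0 :=
    ⟨by push_cast; linarith, by norm_num⟩
  have hkm : (((-12 : ℤ) : ℝ) / 200) ≤ ((-10 : ℤ) : ℝ) / 200 := by norm_num
  exact isPolarAnnulus_right.exists_simple_zero hk.1 hkm hm.2 one_pos hJ
    (isPolarAnnulus_right.integral_avg_pos_of_posOn hk one_pos
      (fun p hp h => hJ p hp (h.trans hkm))
      [-10958374449558743113, 367814134228417755, -1921413603672936, 993756694436, -58265976269,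
        266755650]
      (bs := [103, 131]) rfl (by decide +kernel))
    (isPolarAnnulus_right.integral_avg_pos_of_posOn hm one_pos hJ
      [-9868778499881409195, 355500015562918655, -1836742659788173, 468070790127, -56213528888,
        263188239]
      (bs := [103, 131]) rfl (by decide +kernel))
    [1936945333, -23674032, 131965, -334] (bs := [83, 131]) rfl (by decide +kernel)
    (by decide +kernel)

theorem mem_Ioc_outer : ∀ p ∈ {p : ℝ × ℝ | 0.01 < H p}, H p ≤ (22 : ℤ) / 200 →
    100 * p.1 ∈ Ioc ((-149 : ℤ) : ℝ) (143 : ℤ) := fun p _ hH => by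
  have h3 := abs_lt.1 (abs_fst_lt (hH.trans (by norm_num)))
  exact mem_Ioc_of_H_le hH (lo := -300) (hi := 300) (by push_cast; linarith)
    (by push_cast; linarith) (by decide +kernel) (by decide +kernel)

theorem bound_integral_avg_outer_of_posOn {k q : ℤ} (hk : (0.01 : ℝ) < k / 200) (hk' : k ≤ 22)
    (hq : 0 < q) {σ n : ℤ} (l : List ℤ) {bs : List ℤ} (hB : bs.getLastD (-149) = 143)
    (h1 : posOn (psmul σ (boundPoly k q n l)) (-149) bs = true) :
    0 < σ * ((∫ θ in 0..2 * Real.pi, avg 0 0 (pt 0 {p | 0.01 < H p} θ (k / 200))) -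
      n / 10 * (2 * Real.pi)) := by
  have hk2 : (k : ℝ) ≤ 22 := by exact_mod_cast hk'
  refine isPolarAnnulus_outer.bound_integral_avg ⟨hk, by linarith⟩ rfl hq l fun p hp hH => ?_
  have hx := mem_Ioc_outer p hp (hH.trans_le (by push_cast; linarith))
  rw [← hB] at hx
  exact ev_pos_of_posOn h1 hx.1 hx.2

/-- A multiplier of degree 19, used with `q = 10 ^ 26`. More than a sign is demanded of it: per unit
of angle, the corrected integrand must lie between `1.4` and `3.9` on the whole level `0.09`. -/
def outerCertificate₁ : List ℤ :=
  [-22874708403006548012492814758910851099369448,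
    33642160737430489984838096270512282055085415, -6199704951567899559228301008455944151120,
    -6194940948887684048115123736986358234629, 1422142076060201140879018621772673348,
    1298512216804983519126177717829351041, -600158377217850453122893667223419,
    -242673193794526605852418463386005, 136476106398069492500249366784,
    31577602035665183694515792138, -18059549246213897427771946, -2769341386788204258039929,
    1444998373519740341453, 159945281602426172657, -68726017777439016, -5811588022251942,
    1785584012113, 120141164691, -19490378, -1075972]

/-- The same for the level `0.11`, with the bounds `-4` and `-1.6`. -/
def outerCertificate₂ : List ℤ :=
  [-23972955053534486136872788000955708377288904,
    35279666936710473608721335887281727388529817, -6992484208579371502647227862675545967735,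
    -6570031276656584273010705686652944473538, 1768683188107296847695215791216102788,
    1365452605545078509417746830604683181, -692794388515129063212923865019354,
    -253053353709639742610171583758686, 152690120264449808389929018256,
    32834346950858704639261495785, -19915330985686340878925370, -2879301224893838477993220,
    1581471500398094416805, 166515950067872720579, -74914419933564858, -6063594549483731,
    1942718705147, 125707875736, -21197498, -1129686]

theorem integral_avg_outer_mem₁ :
    (∫ θ in 0..2 * Real.pi, avg 0 0 (pt 0 {p | 0.01 < H p} θ ((18 : ℤ) / 200))) ∈
      Icc (8.715 : ℝ) 24.83 := by
  -- The integral lies between `1.4 * 2π > 8.79` and `3.9 * 2π < 24.51`.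
  have h1 := bound_integral_avg_outer_of_posOn (k := 18) (q := 10 ^ 26) (σ := 1) (n := 14)
    (by norm_num) (by norm_num) (by norm_num) outerCertificate₁
    (bs := [-114, -54, -19, 41, 121, 143]) rfl (by decide +kernel)
  have h2 := bound_integral_avg_outer_of_posOn (k := 18) (q := 10 ^ 26) (σ := -1) (n := 39)
    (by norm_num) (by norm_num) (by norm_num) outerCertificate₁
    (bs := [-114, -54, -19, 41, 121, 143]) rfl (by decide +kernel)
  have := Real.pi_gt_d4
  have := Real.pi_lt_d4
  push_cast at h1 h2 ⊢
  constructor <;> linarith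

theorem integral_avg_outer_mem₂ :
    (∫ θ in 0..2 * Real.pi, avg 0 0 (pt 0 {p | 0.01 < H p} θ ((22 : ℤ) / 200))) ∈
      Icc (-25.37 : ℝ) (-9.821) := by
  -- The integral lies between `-4 * 2π > -25.14` and `-1.6 * 2π < -10.05`.
  have h1 := bound_integral_avg_outer_of_posOn (k := 22) (q := 10 ^ 26) (σ := 1) (n := -40)
    (by norm_num) (by norm_num) (by norm_num) outerCertificate₂
    (bs := [-114, -54, -27, 18, 88, 143]) rfl (by decide +kernel)
  have h2 := bound_integral_avg_outer_of_posOn (k := 22) (q := 10 ^ 26) (σ := -1) (n := -16)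
    (by norm_num) (by norm_num) (by norm_num) outerCertificate₂
    (bs := [-114, -54, -27, 18, 88, 143]) rfl (by decide +kernel)
  have := Real.pi_gt_d4
  have := Real.pi_lt_d4
  push_cast at h1 h2 ⊢
  constructor <;> linarith

/-- The numerical bounds already give the signs at the end levels, so only the derivative needs a
certificate. -/
theorem exists_simple_zero_outer : ∃ h ∈ Ioo ((18 : ℤ) / 200 : ℝ) ((22 : ℤ) / 200),
    (∫ θ in 0..2 * Real.pi, avg 0 0 (pt 0 {p | 0.01 < H p} θ h)) = 0 ∧
      (1 : ℤ) * ∫ θ in 0..2 * Real.pi, avgDeriv 0 0 (pt 0 {p | 0.01 < H p} θ h) < 0 := by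
  have h1 := integral_avg_outer_mem₁.1
  have h2 := integral_avg_outer_mem₂.2
  refine isPolarAnnulus_outer.exists_simple_zero (by norm_num) (by norm_num) (by norm_num)
    (q := 10 ^ 12) (by norm_num) mem_Ioc_outer (by push_cast at *; linarith)
    (by push_cast at *; linarith)
    [-4110598926992068033, 17358459900850143241, -5664320822663769, -3014241352504862,
      1182539885676, 260424785237, -86801735, -11105253, 2099, 182]
    (bs := [-69, 1, 101, 143]) rfl (by decide +kernel) (by decide +kernel)

/-! ### The position of the limit cycles -/

/-- A component of the complement is connected, so it cannot leave the bounded one of two disjoint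
open sets that cover it. -/
theorem surrounds_of_separation {Γ K B B' : Set (ℝ × ℝ)} (hB : IsOpen B) (hB' : IsOpen B')
    (hd : Disjoint B B') (hc : Γᶜ ⊆ B ∪ B') (hb : Bornology.IsBounded B) (hK : K ⊆ B)
    (hKΓ : Disjoint K Γ) : Surrounds Γ K := fun p hp => by
  have hpΓ : p ∉ Γ := disjoint_left.1 hKΓ hp
  refine ⟨hpΓ, hb.subset ?_⟩
  exact isPreconnected_connectedComponentIn.subset_left_of_subset_union hB hB' hd
    ((connectedComponentIn_subset _ _).trans hc) ⟨p, mem_connectedComponentIn hpΓ, hK hp⟩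

theorem isBounded_H_le_one : Bornology.IsBounded {p : ℝ × ℝ | H p ≤ 1} := by
  refine (Metric.isBounded_closedBall (x := (0 : ℝ × ℝ)) (r := 5)).subset fun p hp => ?_
  rw [mem_ofPred_eq] at hp
  have hx := abs_fst_lt hp
  rw [mem_closedBall_zero_iff, Prod.norm_def, Real.norm_eq_abs, Real.norm_eq_abs]
  refine max_le (by linarith) (abs_le_of_sq_le_sq (?_ : p.2 ^ 2 ≤ 5 ^ 2) (by norm_num))
  have h1 := abs_lt.1 hx
  simp only [H, lam] at hp
  nlinarith [sq_nonneg (p.1 ^ 2), sq_nonneg p.1, mul_nonneg (sq_nonneg p.1) (by linarith : 0 ≤ p.1 + 3)]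

/-- Inside and outside are told apart by the sign of `U - H`, where `U` extends `u` to the punctured
plane. The angle is undefined at the origin, so the region `H < 0.01` is added to the inside; it
contains the figure eight loop and lies below the graph. -/
theorem surrounds_polarGraph {u : ℝ → ℝ} (hu : Continuous u)
    (hper : Function.Periodic u (2 * Real.pi)) (hub : ∀ θ, u θ ∈ Ioo (0.01 : ℝ) 1) :
    Surrounds (polarGraph 0 {p | 0.01 < H p} u) figureEightLoop := by
  obtain ⟨U, hU, hUu⟩ := exists_angular_function 0 hu hper
  have hopen : IsOpen {p | 0 < sqDist 0 p} := isOpen_lt continuous_const (continuous_sqDist 0)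
  have hd := hU.sub continuous_H.continuousOn
  have hUb : ∀ p, 0 < sqDist 0 p → U p ∈ Ioo (0.01 : ℝ) 1 := fun p hp => by
    obtain ⟨θ, r, hr, rfl⟩ := exists_ray_eq 0 hp
    rw [hUu θ r hr]
    exact hub θ
  refine surrounds_of_separation
    (B := {p | H p < 0.01} ∪ {p | 0 < sqDist 0 p} ∩ (fun p => U p - H p) ⁻¹' Ioi 0)
    (B' := {p | 0 < sqDist 0 p} ∩ (fun p => U p - H p) ⁻¹' Iio 0)
    ((isOpen_lt continuous_H continuous_const).union (hd.isOpen_inter_preimage hopen isOpen_Ioi))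
    (hd.isOpen_inter_preimage hopen isOpen_Iio) ?_ ?_ ?_ ?_ ?_
  · refine disjoint_left.2 fun p hp hp' => ?_
    have h1 : U p - H p < 0 := hp'.2
    rcases hp with hp | hp
    · rw [mem_ofPred_eq] at hp
      linarith [(hUb p hp'.1).1]
    · have h2 : 0 < U p - H p := hp.2
      linarith
  · intro p hp
    rcases (by unfold sqDist; positivity : 0 ≤ sqDist 0 p).eq_or_lt with h0 | h0
    · have h1 : p.1 = 0 ∧ p.2 = 0 := by
        unfold sqDist at h0
        constructor <;> nlinarith [sq_nonneg (p.1 - 0), sq_nonneg p.2]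
      exact Or.inl (Or.inl (by simp [H, h1.1, h1.2]; norm_num))
    · rcases lt_trichotomy (U p - H p) 0 with h | h | h
      · exact Or.inr ⟨h0, h⟩
      · refine absurd ?_ hp
        have hb := hUb p h0
        obtain ⟨θ, r, hr, rfl⟩ := exists_ray_eq 0 h0
        rw [hUu θ r hr] at h hb
        have hH : H (ray 0 θ r) = u θ := by linarith
        refine ⟨θ, ?_⟩
        have := isPolarAnnulus_outer.rho_eq (θ := θ) hr (by rw [mem_ofPred_eq, hH]; exact hb.1)
          (by rw [hH]; exact hb)
        rw [hH] at this
        simp only [pt, this]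
      · exact Or.inl (Or.inr ⟨h0, h⟩)
  · refine isBounded_H_le_one.subset fun p hp => ?_
    rw [mem_ofPred_eq]
    rcases hp with hp | hp
    · rw [mem_ofPred_eq] at hp
      linarith
    · have h2 : 0 < U p - H p := hp.2
      linarith [(hUb p hp.1).2]
  · intro p hp
    have : H p = 0 := hp
    exact Or.inl (by rw [mem_ofPred_eq, this]; norm_num)
  · refine disjoint_left.2 fun p hp hp' => ?_
    obtain ⟨θ, rfl⟩ := hp'
    have h1 : H _ = 0 := hp
    simp only [(isPolarAnnulus_outer.rho_spec θ (hub θ)).2.2] at h1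
    linarith [(hub θ).1]

/-- The limit cycles near an oval lie between the neighbouring ovals. -/
theorem IsPolarAnnulus.polarGraph_bounds {c a b h r : ℝ} {S : Set (ℝ × ℝ)}
    (hA : IsPolarAnnulus c S a b) {u : ℝ → ℝ} (hub : ∀ θ, u θ ∈ Ioo a b)
    (hur : ∀ θ, |u θ - h| ≤ r) :
    (polarGraph c S u).Nonempty ∧
      ∀ p ∈ polarGraph c S u, p ∈ S ∧ H p ∈ Ioo a b ∧ H p ∈ Icc (h - r) (h + r) := by
  refine ⟨range_nonempty _, ?_⟩
  rintro _ ⟨θ, rfl⟩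
  obtain ⟨-, hS, hH⟩ := hA.rho_spec θ (hub θ)
  simp only [hH]
  have := abs_le.1 (hur θ)
  exact ⟨hS, hub θ, by linarith [this.1], by linarith [this.2]⟩

theorem ne_of_forall_mem {X : Type*} {A B : Set X} (P : X → Prop) (hA : A.Nonempty)
    (h : ∀ p ∈ A, P p) (h' : ∀ p ∈ B, ¬ P p) : A ≠ B := by
  rintro rfl
  obtain ⟨p, hp⟩ := hA
  exact h' p hp (h p hp)

theorem outerOval_eq {h : ℝ} (hh : 0.01 < h) :
    {p | p ∈ {p : ℝ × ℝ | 0.01 < H p} ∧ H p = h} = outerOval h := by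
  ext p
  simp only [outerOval, mem_ofPred_eq, and_iff_right_iff_imp]
  rintro rfl
  exact hh

end Bifurcation

/-! ### The main theorem: the five families of limit cycles -/

open Bifurcation in
theorem mainTheorem2 :
    (∃ v ∈ Icc (8.715 : ℝ) 24.83, HasAbelianIntegral (outerOval 0.09) v) ∧
    (∃ v ∈ Icc (-25.37 : ℝ) (-9.821), HasAbelianIntegral (outerOval 0.11) v) ∧
    ∃ ho ∈ Ioo (0.09 : ℝ) 0.11,
    ∃ hl₁ ∈ Ioo (-0.1933 : ℝ) (-0.0846), ∃ hl₂ ∈ Ioo (-0.0846 : ℝ) (-0.0121),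
    ∃ hr₁ ∈ Ioo (-0.1686 : ℝ) (-0.0738), ∃ hr₂ ∈ Ioo (-0.0738 : ℝ) (-0.0105),
      HasAbelianIntegral (outerOval ho) 0 ∧ Surrounds (outerOval ho) figureEightLoop ∧
      HasAbelianIntegral (leftOval hl₁) 0 ∧ HasAbelianIntegral (leftOval hl₂) 0 ∧
      HasAbelianIntegral (rightOval hr₁) 0 ∧ HasAbelianIntegral (rightOval hr₂) 0 ∧
      ∃ Co Cl₁ Cl₂ Cr₁ Cr₂ : ℝ → Set (ℝ × ℝ),
        BifurcatesFrom field Co (outerOval ho) ∧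
        BifurcatesFrom field Cl₁ (leftOval hl₁) ∧ BifurcatesFrom field Cl₂ (leftOval hl₂) ∧
        BifurcatesFrom field Cr₁ (rightOval hr₁) ∧ BifurcatesFrom field Cr₂ (rightOval hr₂) ∧
        (∀ᶠ ε in 𝓝[≠] 0,
          [Co ε, Cl₁ ε, Cl₂ ε, Cr₁ ε, Cr₂ ε].Nodup ∧
          Surrounds (Co ε) figureEightLoop ∧
          Cl₁ ε ⊆ insideLeftLoop ∧ Cl₂ ε ⊆ insideLeftLoop ∧
          Cr₁ ε ⊆ insideRightLoop ∧ Cr₂ ε ⊆ insideRightLoop) ∧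
        (∀ᶠ ε in 𝓝[>] 0,
          IsAttracting (field ε) (Co ε) ∧
          IsAttracting (field ε) (Cl₁ ε) ∧ IsRepelling (field ε) (Cl₂ ε) ∧
          IsAttracting (field ε) (Cr₁ ε) ∧ IsRepelling (field ε) (Cr₂ ε)) := by
  have hO := isPolarAnnulus_outer
  have hL := isPolarAnnulus_left
  have hR := isPolarAnnulus_right
  have haL := H_left_lt
  have haR := H_right_lt
  obtain ⟨ho, hho, hIo, hDo⟩ := exists_simple_zero_outer
  obtain ⟨l₁, hl₁, hIl₁, hDl₁⟩ := exists_simple_zero_left_low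
  obtain ⟨l₂, hl₂, hIl₂, hDl₂⟩ := exists_simple_zero_left_high
  obtain ⟨r₁, hr₁, hIr₁, hDr₁⟩ := exists_simple_zero_right_low
  obtain ⟨r₂, hr₂, hIr₂, hDr₂⟩ := exists_simple_zero_right_high
  push_cast at hho hl₁ hl₂ hr₁ hr₂
  have mo : ho ∈ Ioo (0.01 : ℝ) 1 := ⟨by linarith [hho.1], by linarith [hho.2]⟩
  have ml₁ : l₁ ∈ Ioo (H (-1, 0)) 0 := ⟨by linarith [hl₁.1], by linarith [hl₁.2]⟩
  have ml₂ : l₂ ∈ Ioo (H (-1, 0)) 0 := ⟨by linarith [hl₂.1], by linarith [hl₂.2]⟩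
  have mr₁ : r₁ ∈ Ioo (H (lam, 0)) 0 := ⟨by linarith [hr₁.1], by linarith [hr₁.2]⟩
  have mr₂ : r₂ ∈ Ioo (H (lam, 0)) 0 := ⟨by linarith [hr₂.1], by linarith [hr₂.2]⟩
  have sO : ∀ p, reflect p ∈ {p : ℝ × ℝ | 0.01 < H p} ↔ p ∈ {p : ℝ × ℝ | 0.01 < H p} := fun p => by
    simp only [mem_ofPred_eq, H_reflect]
  obtain ⟨Co, bo, no, ao⟩ := hO.exists_bifurcatesFrom sO mo (σ := 1) (Or.inl rfl) hIo
    (by exact_mod_cast hDo)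
  obtain ⟨Cl₁, bl₁, nl₁, al₁⟩ := hL.exists_bifurcatesFrom (fun p => Iff.rfl) ml₁ (σ := 1)
    (Or.inl rfl) hIl₁ (by exact_mod_cast hDl₁)
  obtain ⟨Cl₂, bl₂, nl₂, al₂⟩ := hL.exists_bifurcatesFrom (fun p => Iff.rfl) ml₂ (σ := -1)
    (Or.inr rfl) hIl₂ (by exact_mod_cast hDl₂)
  obtain ⟨Cr₁, br₁, nr₁, ar₁⟩ := hR.exists_bifurcatesFrom (fun p => Iff.rfl) mr₁ (σ := 1)
    (Or.inl rfl) hIr₁ (by exact_mod_cast hDr₁)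
  obtain ⟨Cr₂, br₂, nr₂, ar₂⟩ := hR.exists_bifurcatesFrom (fun p => Iff.rfl) mr₂ (σ := -1)
    (Or.inr rfl) hIr₂ (by exact_mod_cast hDr₂)
  have jo := hO.hasAbelianIntegral mo
  have jl₁ := hL.hasAbelianIntegral ml₁
  have jl₂ := hL.hasAbelianIntegral ml₂
  have jr₁ := hR.hasAbelianIntegral mr₁
  have jr₂ := hR.hasAbelianIntegral mr₂
  rw [hIo, outerOval_eq mo.1] at jo
  rw [hIl₁] at jl₁
  rw [hIl₂] at jl₂
  rw [hIr₁] at jr₁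
  rw [hIr₂] at jr₂
  have hS := surrounds_polarGraph (u := fun _ => ho) continuous_const (fun _ => rfl) fun _ => mo
  rw [hO.polarGraph_const mo, outerOval_eq mo.1] at hS
  rw [outerOval_eq mo.1] at bo
  have e9 : (((18 : ℤ) : ℝ) / 200) = 0.09 := by norm_num
  have e11 : (((22 : ℤ) : ℝ) / 200) = 0.11 := by norm_num
  have i9 := integral_avg_outer_mem₁
  have i11 := integral_avg_outer_mem₂
  rw [e9] at i9
  rw [e11] at i11
  have j9 := hO.hasAbelianIntegral (h := 0.09) (by norm_num)
  have j11 := hO.hasAbelianIntegral (h := 0.11) (by norm_num)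
  rw [outerOval_eq (by norm_num)] at j9 j11
  refine ⟨⟨_, i9, j9⟩, ⟨_, i11, j11⟩, ho, ⟨by linarith [hho.1], by linarith [hho.2]⟩,
    l₁, ⟨by linarith [hl₁.1], by linarith [hl₁.2]⟩, l₂, ⟨by linarith [hl₂.1], by linarith [hl₂.2]⟩,
    r₁, ⟨by linarith [hr₁.1], by linarith [hr₁.2]⟩, r₂, ⟨by linarith [hr₂.1], by linarith [hr₂.2]⟩,
    jo, hS, jl₁, jl₂, jr₁, jr₂, Co, Cl₁, Cl₂, Cr₁, Cr₂, bo, bl₁, bl₂, br₁, br₂, ?_, ?_⟩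
  -- The lower zeros are below `-0.14` and the upper ones above `-0.06`, so with tolerance `0.01`
  -- the level `-0.1` separates the two cycles in each half. All other pairs differ in the sign of
  -- `H` or of `x`.
  · have h01 : (0 : ℝ) < 0.01 := by norm_num
    filter_upwards [no 0.01 h01, nl₁ 0.01 h01, nl₂ 0.01 h01, nr₁ 0.01 h01, nr₂ 0.01 h01] with
      ε go gl₁ gl₂ gr₁ gr₂
    obtain ⟨uo, uoc, uop, uob, uor, eo⟩ := go
    obtain ⟨ul₁, -, -, ul₁b, ul₁r, el₁⟩ := gl₁
    obtain ⟨ul₂, -, -, ul₂b, ul₂r, el₂⟩ := gl₂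
    obtain ⟨ur₁, -, -, ur₁b, ur₁r, er₁⟩ := gr₁
    obtain ⟨ur₂, -, -, ur₂b, ur₂r, er₂⟩ := gr₂
    obtain ⟨po, qo⟩ := hO.polarGraph_bounds uob uor
    obtain ⟨pl₁, ql₁⟩ := hL.polarGraph_bounds ul₁b ul₁r
    obtain ⟨pl₂, ql₂⟩ := hL.polarGraph_bounds ul₂b ul₂r
    obtain ⟨pr₁, qr₁⟩ := hR.polarGraph_bounds ur₁b ur₁r
    obtain ⟨pr₂, qr₂⟩ := hR.polarGraph_bounds ur₂b ur₂r
    have hSo := surrounds_polarGraph uoc uop uob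
    rw [← eo] at po qo hSo
    rw [← el₁] at pl₁ ql₁
    rw [← el₂] at pl₂ ql₂
    rw [← er₁] at pr₁ qr₁
    rw [← er₂] at pr₂ qr₂
    have hpos : ∀ p ∈ Co ε, 0 < H p := fun p hp => by linarith [(qo p hp).2.1.1]
    refine ⟨?_, hSo, fun p hp => ⟨(ql₁ p hp).1, (ql₁ p hp).2.1.2⟩,
      fun p hp => ⟨(ql₂ p hp).1, (ql₂ p hp).2.1.2⟩, fun p hp => ⟨(qr₁ p hp).1, (qr₁ p hp).2.1.2⟩,
      fun p hp => ⟨(qr₂ p hp).1, (qr₂ p hp).2.1.2⟩⟩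
    have hlr : ∀ (p : ℝ × ℝ), p ∈ {p : ℝ × ℝ | 0 < p.1} → ¬ p ∈ {p : ℝ × ℝ | p.1 < 0} :=
      fun p h h' => lt_asymm (show 0 < p.1 from h) h'
    simp only [List.nodup_cons, List.mem_cons, List.not_mem_nil, or_false, not_or, not_false_eq_true,
      List.nodup_nil, and_true]
    refine ⟨⟨?_, ?_, ?_, ?_⟩, ⟨?_, ?_, ?_⟩, ⟨?_, ?_⟩, ?_⟩
    · exact ne_of_forall_mem (fun p => 0 < H p) po hpos fun p hp => (ql₁ p hp).2.1.2.not_gt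
    · exact ne_of_forall_mem (fun p => 0 < H p) po hpos fun p hp => (ql₂ p hp).2.1.2.not_gt
    · exact ne_of_forall_mem (fun p => 0 < H p) po hpos fun p hp => (qr₁ p hp).2.1.2.not_gt
    · exact ne_of_forall_mem (fun p => 0 < H p) po hpos fun p hp => (qr₂ p hp).2.1.2.not_gt
    · exact ne_of_forall_mem (fun p => H p < -0.1) pl₁
        (fun p hp => by linarith [(ql₁ p hp).2.2.2, hl₁.2])
        fun p hp => by linarith [(ql₂ p hp).2.2.1, hl₂.1]
    · exact ne_of_forall_mem _ pl₁ (fun p hp => (ql₁ p hp).1) fun p hp => hlr p (qr₁ p hp).1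
    · exact ne_of_forall_mem _ pl₁ (fun p hp => (ql₁ p hp).1) fun p hp => hlr p (qr₂ p hp).1
    · exact ne_of_forall_mem _ pl₂ (fun p hp => (ql₂ p hp).1) fun p hp => hlr p (qr₁ p hp).1
    · exact ne_of_forall_mem _ pl₂ (fun p hp => (ql₂ p hp).1) fun p hp => hlr p (qr₂ p hp).1
    · exact ne_of_forall_mem (fun p => H p < -0.1) pr₁
        (fun p hp => by linarith [(qr₁ p hp).2.2.2, hr₁.2])
        fun p hp => by linarith [(qr₂ p hp).2.2.1, hr₂.1]
  · filter_upwards [ao, al₁, al₂, ar₁, ar₂] with ε so sl₁ sl₂ sr₁ sr₂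
    exact ⟨so.1 rfl, sl₁.1 rfl, sl₂.2 rfl, sr₁.1 rfl, sr₂.2 rfl⟩
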